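/- Write $\mathrm{GF}(9)=\{a+b\omega : a,b\in\mathrm{GF}(3)\}$ with $\omega^2=\omega+1$, let $\overline{x}=x^3$ and $\operatorname{tr}(x)=x+\overline{x}$. An additive code of length $n$ over $\mathrm{GF}(9)$ is a $\mathrm{GF}(3)$-linear subgroup $\mathcal C$ of $\mathrm{GF}(9)^n$; it is self-dual if $\mathcal C=\{u\in\mathrm{GF}(9)^n : (u,c)=0 \text{ for all } c\in\mathcal C\}$, where $(u,v)=\operatorname{tr}\bigl(\omega^2\sum_i u_i\overline{v_i}\bigr)$ is the Hermitian trace inner product. Its minimum distance $d$ is the least Hamming distance between two distinct codewords. Let $\mathrm{Sp}_2(3)\wr\mathrm{Sym}(n)$ act on $\mathrm{GF}(9)^n$ by permuting coordinates and applying, independently in each coordinate, a $2\times2$ matrix over $\mathrm{GF}(3)$ of determinant $1$ to the column $\binom{a}{b}$ representing $a+b\omega$. Two self-dual additive codes of length $n$ are equivalent if an element of this group maps one onto the other, and the automorphism group $\mathrm{Aut}(\mathcal C)$ consists of the elements of this group that map $\mathcal C$ to itself; it always contains $\{I,-I\}$, and it is called trivial if it equals $\{I,-I\}$. Then: 1.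 Every self-dual additive code over $\mathrm{GF}(9)$ of length $n$ with $1\le n\le 7$ has a nontrivial automorphism group, that is, $\{I,-I\}\subsetneq\mathrm{Aut}(\mathcal C)$. 2. Up to equivalence there are exactly $35$ self-dual additive codes of length $8$ over $\mathrm{GF}(9)$ with trivial automorphism group: exactly $32$ of them have minimum distance $3$, and exactly $3$ have minimum distance $4$. In particular, the smallest codes with trivial automorphism group have length $8$. -/

import Mathlib

noncomputable section

namespace AdditiveGF9

/-- The field `GF(9)`. -/
abbrev GF9 : Type := GaloisField 3 2

/-- There is an element `ω` of `GF(9)` with `ω² = ω + 1`. -/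
theorem exists_omega : ∃ w : GF9, w ^ 2 = w + 1 := by
  have : Fintype GF9 := Fintype.ofFinite GF9
  have hcard : Fintype.card GF9 = 9 := by
    rw [← Nat.card_eq_fintype_card, GaloisField.card 3 2 two_ne_zero]; norm_num
  obtain ⟨i, hi⟩ := (FiniteField.isSquare_neg_one_iff (F := GF9)).2 (by rw [hcard]; norm_num)
  have h3 : (3 : GF9) = 0 := by exact_mod_cast CharP.cast_eq_zero GF9 3
  refine ⟨i - 1, ?_⟩
  linear_combination (-1) * hi - i * h3

/-- The fixed primitive element `ω` of `GF(9)`, satisfying `ω² = ω + 1`. -/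
def ω : GF9 := exists_omega.choose

theorem ω_sq : ω ^ 2 = ω + 1 := exists_omega.choose_spec

/-- `(a, b) ↦ a + b ω` as a linear map over `GF(3)`. -/
def coordHom : (Fin 2 → ZMod 3) →ₗ[ZMod 3] GF9 where
  toFun v := algebraMap (ZMod 3) GF9 (v 0) + algebraMap (ZMod 3) GF9 (v 1) * ω
  map_add' u v := by simp only [Pi.add_apply, map_add]; ring
  map_smul' c v := by
    simp only [Pi.smul_apply, smul_eq_mul, map_mul, RingHom.id_apply, Algebra.smul_def]; ring

theorem ω_not_mem_prime_field (c : ZMod 3) : algebraMap (ZMod 3) GF9 c ≠ ω := by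
  intro h
  have h1 := ω_sq
  rw [← h, ← map_pow, ← map_one (algebraMap (ZMod 3) GF9), ← map_add] at h1
  have h2 := (algebraMap (ZMod 3) GF9).injective h1
  have key : ∀ x : ZMod 3, x ^ 2 ≠ x + 1 := by decide
  exact key c h2

theorem coordHom_injective : Function.Injective coordHom := by
  rw [← LinearMap.ker_eq_bot, LinearMap.ker_eq_bot']
  intro v hv
  have hv' : algebraMap (ZMod 3) GF9 (v 0) + algebraMap (ZMod 3) GF9 (v 1) * ω = 0 := hv
  have hb : v 1 = 0 := by
    by_contra hb
    apply ω_not_mem_prime_field (-(v 0) / v 1)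
    have : algebraMap (ZMod 3) GF9 (v 1) ≠ 0 := by simpa using hb
    rw [map_div₀, map_neg, div_eq_iff this]
    linear_combination -hv'
  have ha : v 0 = 0 := by simpa [hb] using hv'
  ext i
  fin_cases i
  · exact ha
  · exact hb

/-- The identification of `GF(3)²` with `GF(9)`, `(a, b) ↦ a + b ω`. -/
def coord : (Fin 2 → ZMod 3) ≃ₗ[ZMod 3] GF9 :=
  LinearEquiv.ofInjectiveOfFinrankEq coordHom coordHom_injective (by
    rw [Module.finrank_fin_fun, GaloisField.finrank 3 two_ne_zero])

theorem coord_apply (v : Fin 2 → ZMod 3) :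
    coord v = algebraMap (ZMod 3) GF9 (v 0) + algebraMap (ZMod 3) GF9 (v 1) * ω := rfl

/-- Conjugation `x ↦ x³` of `GF(9)`. -/
def conj (x : GF9) : GF9 := x ^ 3

/-- The trace map `x ↦ x + x³`, whose values lie in the prime field `GF(3)` of `GF(9)`. -/
def tr (x : GF9) : GF9 := x + conj x

variable {n : ℕ}

/-- The Hermitian trace inner product `(u, v) = tr (ω² (u ⬝ conj v))`. -/
def traceInner (u v : Fin n → GF9) : GF9 := tr (ω ^ 2 * ∑ i, u i * conj (v i))

/-- Additive codes over `GF(9)` of length `n`: the `GF(3)`-linear subgroups of `GF(9)ⁿ`. -/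
abbrev AdditiveCode (n : ℕ) : Type := Submodule (ZMod 3) (Fin n → GF9)

/-- The dual of a code with respect to the Hermitian trace inner product. -/
def dual (C : AdditiveCode n) : Set (Fin n → GF9) := {u | ∀ c ∈ C, traceInner u c = 0}

/-- `C` is self-dual: `C = C^⊥`. -/
def IsSelfDual (C : AdditiveCode n) : Prop := (C : Set (Fin n → GF9)) = dual C

open scoped Classical in
/-- The minimum distance: the least Hamming distance between two distinct codewords. -/
def minDist (C : AdditiveCode n) : ℕ :=
  sInf {d | ∃ u ∈ C, ∃ v ∈ C, u ≠ v ∧ hammingDist u v = d}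

/-- The action of `Sp₂(3) = SL₂(3)` on `GF(9)`: the matrix premultiplies the column `(a, b)`
that represents the element `a + b ω`. -/
def symp (M : Matrix.SpecialLinearGroup (Fin 2) (ZMod 3)) (x : GF9) : GF9 :=
  coord (M.1.mulVec (coord.symm x))

theorem symp_one (x : GF9) : symp 1 x = x := by simp [symp]

theorem symp_mul (M N : Matrix.SpecialLinearGroup (Fin 2) (ZMod 3)) (x : GF9) :
    symp (M * N) x = symp M (symp N x) := by
  rw [symp, symp, symp, LinearEquiv.symm_apply_apply, Matrix.mulVec_mulVec,
    Matrix.SpecialLinearGroup.coe_mul]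

/-- The `GF(3)`-linear automorphisms of `GF(9)ⁿ`. -/
abbrev LinAut (n : ℕ) : Type := (Fin n → GF9) ≃ₗ[ZMod 3] (Fin n → GF9)

/-- The group `Sp₂(3) ≀ Sym(n)`, as a group of transformations of `GF(9)ⁿ` (on which it acts
faithfully): permutations of the coordinates combined with elements of `Sp₂(3)` applied
independently to each coordinate. -/
def codeTransformations (n : ℕ) : Subgroup (LinAut n) where
  carrier := {T | ∃ (A : Fin n → Matrix.SpecialLinearGroup (Fin 2) (ZMod 3))
    (σ : Equiv.Perm (Fin n)), ∀ u i, T u i = symp (A i) (u (σ i))}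
  one_mem' := ⟨1, 1, fun u i => by simp [symp_one]⟩
  mul_mem' := by
    rintro S T ⟨A, σ, hS⟩ ⟨B, τ, hT⟩
    exact ⟨fun i => A i * B (σ i), τ * σ, fun u i => by
      rw [LinearEquiv.mul_apply, hS, hT, symp_mul, Equiv.Perm.mul_apply]⟩
  inv_mem' := by
    rintro T ⟨A, σ, hT⟩
    refine ⟨fun i => (A (σ⁻¹ i))⁻¹, σ⁻¹, fun u i => ?_⟩
    have h := hT (T⁻¹ u) (σ⁻¹ i)
    have h' : T (T⁻¹ u) = u := T.apply_symm_apply u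
    rw [h', show σ (σ⁻¹ i) = i from σ.apply_symm_apply i] at h
    rw [h, ← symp_mul, inv_mul_cancel, symp_one]

/-- The automorphism group of a code: the transformations in `Sp₂(3) ≀ Sym(n)` that map the
code to itself. -/
def autGroup (C : AdditiveCode n) : Subgroup (LinAut n) where
  carrier := {T | T ∈ codeTransformations n ∧ C.map (T : (Fin n → GF9) →ₗ[ZMod 3] _) = C}
  one_mem' := ⟨one_mem _, Submodule.map_id C⟩
  mul_mem' := by
    rintro S T ⟨hS, hS'⟩ ⟨hT, hT'⟩
    refine ⟨mul_mem hS hT, ?_⟩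
    change C.map ((S : (Fin n → GF9) →ₗ[ZMod 3] _) ∘ₗ (T : (Fin n → GF9) →ₗ[ZMod 3] _)) = C
    rw [Submodule.map_comp, hT', hS']
  inv_mem' := by
    rintro T ⟨hT, hT'⟩
    refine ⟨inv_mem hT, ?_⟩
    change C.map (T.symm : (Fin n → GF9) →ₗ[ZMod 3] _) = C
    exact (Submodule.map_symm_eq_iff T).2 hT'

/-- The set `{I, -I}`: global multiplication of the coordinates by `1` or `-1`. -/
def trivialGroup (n : ℕ) : Set (LinAut n) := {1, LinearEquiv.neg (ZMod 3)}

/-- `C` has trivial automorphism group: `Aut(C) = {I, -I}`. -/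
def HasTrivialAut (C : AdditiveCode n) : Prop := (autGroup C : Set (LinAut n)) = trivialGroup n

/-- The type of self-dual additive codes of length `n`. -/
abbrev SelfDualCode (n : ℕ) : Type := {C : AdditiveCode n // IsSelfDual C}

/-- Equivalence of self-dual additive codes: one is mapped onto the other by an element of
`Sp₂(3) ≀ Sym(n)`. -/
def codeEquiv (n : ℕ) : Setoid (SelfDualCode n) where
  r C D := ∃ T ∈ codeTransformations n, C.1.map (T : (Fin n → GF9) →ₗ[ZMod 3] _) = D.1
  iseqv :=
    { refl := fun C => ⟨1, one_mem _, Submodule.map_id C.1⟩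
      symm := by
        rintro C D ⟨T, hT, h⟩
        exact ⟨T⁻¹, inv_mem hT, (Submodule.map_symm_eq_iff T).2 h⟩
      trans := by
        rintro C D E ⟨T, hT, h⟩ ⟨S, hS, h'⟩
        refine ⟨S * T, mul_mem hS hT, ?_⟩
        change C.1.map ((S : (Fin n → GF9) →ₗ[ZMod 3] _) ∘ₗ
          (T : (Fin n → GF9) →ₗ[ZMod 3] _)) = E.1
        rw [Submodule.map_comp, h, h'] }

/-- The equivalence classes of self-dual additive codes of length `n` that have trivial
automorphism group. -/
def trivialAutClasses (n : ℕ) : Set (Quotient (codeEquiv n)) :=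
  {q | ∃ C : SelfDualCode n, Quotient.mk (codeEquiv n) C = q ∧ HasTrivialAut C.1}

/-- The equivalence classes of self-dual additive codes of length `n` and minimum distance `d`
that have trivial automorphism group. -/
def trivialAutClassesOfDist (n d : ℕ) : Set (Quotient (codeEquiv n)) :=
  {q | ∃ C : SelfDualCode n,
    Quotient.mk (codeEquiv n) C = q ∧ HasTrivialAut C.1 ∧ minDist C.1 = d}

end AdditiveGF9

end

noncomputable section

namespace AdditiveGF9

/-! Writing entries as `a + b ω` turns the trace inner product into minus the standard symplectic
form on `GF(3)²ⁿ` (`traceInner_eq`). Self-dual codes are therefore Lagrangian subspaces, and the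
group `Sp₂(3) ≀ Sym(n)` preserves the form. Exchanging `a` and `b` up to sign in suitable
coordinates makes a Lagrangian subspace transversal to `b = 0`, hence a graph `a = Γ b` with `Γ`
symmetric, and shears in the single coordinates clear the diagonal of `Γ` (`codeEq_graphCode`). Up
to equivalence, a code is thus a graph with edge weights in `GF(3)`.

Such graphs are classified by adding one vertex at a time. A transformation that carries the graph
code of `Γ` to that of `Γ'` extends to the new coordinate and carries the extension of `Γ` by a row
`v` to the extension of `Γ'` by a row that depends linearly on `v` (`extM_map`). So it suffices to
extend one representative of each class, and only by vectors `v` up to sign and up to known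
automorphisms of the representative. Descent in the lexicographic order (`forall_of_cover`) leaves
only those vectors that no listed automorphism makes smaller; for each of them a certificate gives
an explicit transformation onto a listed code. This produces lists of 1, 2, 3, 7, 13, 39 and 121
codes of lengths 1 to 7 that meet every class. Every listed code comes with an explicit nontrivial
automorphism, which is the first claim.

In the step to length 8, codes with a nontrivial automorphism may be discarded: a certificate may
consist of such an automorphism, and a vector fixed up to sign by a nontrivial automorphism of the
smaller code needs no certificate, because that automorphism extends. What remains is a list of 35
codes (`covers_reps8`).

For the converse, an integer is attached to each position of a code and each element of `GF(9)`,
built from the codewords of weight at most 5; an equivalence given by `A` and `σ` permutes these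
integers accordingly (`inv2_wreath`). For the 35 codes, the tables at two different positions are
never related by an element of `SL₂(3)`, and a table is related to itself only by `±I`. An
automorphism hence fixes every position and acts there by a sign, and the signs agree because the
graph is connected (`hasTrivialAut_of_rigid`). Comparison of tables also shows that the 35 codes are
pairwise inequivalent (`not_codeEq_of_distinct`). Their minimum distances come from counting words
of small weight.

The finite checks are evaluated by the kernel. For this reason vectors, codewords and
transformations are packed into single natural numbers, and the checks are built from recursors,
`cond` and the basic operations on `ℕ`. -/

variable {n : ℕ}

/-! ### Coordinates over `GF(3)` and the symplectic form. -/

/-- The coordinates `a` of a vector with entries `a + b ω`. -/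
def ca (u : Fin n → GF9) (i : Fin n) : ZMod 3 := coord.symm (u i) 0

/-- The coordinates `b` of a vector with entries `a + b ω`. -/
def cb (u : Fin n → GF9) (i : Fin n) : ZMod 3 := coord.symm (u i) 1

/-- The vector with entries `a + b ω`. -/
def ofAB (a b : Fin n → ZMod 3) : Fin n → GF9 := fun i => coord ![a i, b i]

@[simp] theorem ca_ofAB (a b : Fin n → ZMod 3) (i : Fin n) : ca (ofAB a b) i = a i := by
  simp [ca, ofAB]

@[simp] theorem cb_ofAB (a b : Fin n → ZMod 3) (i : Fin n) : cb (ofAB a b) i = b i := by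
  simp [cb, ofAB]

@[simp] theorem ca_add (u v : Fin n → GF9) (i : Fin n) : ca (u + v) i = ca u i + ca v i := by
  simp [ca]

@[simp] theorem cb_add (u v : Fin n → GF9) (i : Fin n) : cb (u + v) i = cb u i + cb v i := by
  simp [cb]

@[simp] theorem ca_smul (c : ZMod 3) (u : Fin n → GF9) (i : Fin n) :
    ca (c • u) i = c * ca u i := by
  simp [ca]

@[simp] theorem cb_smul (c : ZMod 3) (u : Fin n → GF9) (i : Fin n) :
    cb (c • u) i = c * cb u i := by
  simp [cb]

@[simp] theorem ca_zero (i : Fin n) : ca (0 : Fin n → GF9) i = 0 := by simp [ca]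

@[simp] theorem cb_zero (i : Fin n) : cb (0 : Fin n → GF9) i = 0 := by simp [cb]

@[simp] theorem ca_neg (u : Fin n → GF9) (i : Fin n) : ca (-u) i = -ca u i := by simp [ca]

@[simp] theorem cb_neg (u : Fin n → GF9) (i : Fin n) : cb (-u) i = -cb u i := by simp [cb]

theorem entry_eq_iff {m : ℕ} (u : Fin n → GF9) (v : Fin m → GF9) (i : Fin n) (j : Fin m) :
    u i = v j ↔ ca u i = ca v j ∧ cb u i = cb v j := by
  refine ⟨fun h => by simp [ca, cb, h], fun h => coord.symm.injective ?_⟩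
  ext k
  fin_cases k
  · exact h.1
  · exact h.2

theorem vec_ext {u v : Fin n → GF9} (ha : ∀ i, ca u i = ca v i) (hb : ∀ i, cb u i = cb v i) :
    u = v :=
  funext fun i => (entry_eq_iff u v i i).2 ⟨ha i, hb i⟩

theorem entry_eq_zero_iff (u : Fin n → GF9) (i : Fin n) : u i = 0 ↔ ca u i = 0 ∧ cb u i = 0 := by
  simpa using entry_eq_iff u 0 i i

/-- Cubing is additive in characteristic 3 and fixes `GF(3)`, so everything follows from `ω³ = 2ω +
1 = 1 - ω`. -/
theorem conj_coord (c d : ZMod 3) :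
    conj (algebraMap _ GF9 c + algebraMap _ GF9 d * ω) =
      algebraMap _ GF9 (c + d) - algebraMap _ GF9 d * ω := by
  have h3 : (3 : GF9) = 0 := by exact_mod_cast CharP.cast_eq_zero GF9 3
  have fr : ∀ x : ZMod 3, algebraMap _ GF9 x ^ 3 = algebraMap _ GF9 x := fun x => by
    rw [← map_pow, ZMod.pow_card]
  have e : conj (algebraMap _ GF9 c + algebraMap _ GF9 d * ω) =
      algebraMap _ GF9 c ^ 3 + algebraMap _ GF9 d ^ 3 * ω ^ 3 := by
    rw [conj]
    linear_combination (algebraMap _ GF9 c ^ 2 * algebraMap _ GF9 d * ω +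
      algebraMap _ GF9 c * algebraMap _ GF9 d ^ 2 * ω ^ 2) * h3
  rw [e, fr, fr, map_add]
  linear_combination (algebraMap _ GF9 d * (ω + 1)) * ω_sq + algebraMap _ GF9 d * ω * h3

/-- The standard symplectic form on `GF(9)ⁿ = GF(3)²ⁿ`. -/
def sform (u v : Fin n → GF9) : ZMod 3 := ∑ i, (ca u i * cb v i - cb u i * ca v i)

theorem tr_mul_conj (a b c d : ZMod 3) :
    tr (ω ^ 2 * ((algebraMap _ GF9 a + algebraMap _ GF9 b * ω) *
      conj (algebraMap _ GF9 c + algebraMap _ GF9 d * ω))) = algebraMap _ GF9 (b * c - a * d) := by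
  have h3 : (3 : GF9) = 0 := by exact_mod_cast CharP.cast_eq_zero GF9 3
  -- Since `tr (x + y ω) = 2x + y`, the common part `ac + ad - bd` of the two coefficients is
  -- counted three times and vanishes; what is left is `4 (bc - ad) = bc - ad`.
  have e : ω ^ 2 * ((algebraMap _ GF9 a + algebraMap _ GF9 b * ω) *
      conj (algebraMap _ GF9 c + algebraMap _ GF9 d * ω)) =
      algebraMap _ GF9 (a * c + a * d - b * d + b * c - a * d) +
      algebraMap _ GF9 (a * c + a * d - b * d + 2 * (b * c - a * d)) * ω := by
    rw [conj_coord]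
    simp only [map_add, map_sub, map_mul, map_ofNat]
    set a := algebraMap _ GF9 a
    set b := algebraMap _ GF9 b
    set c := algebraMap _ GF9 c
    set d := algebraMap _ GF9 d
    linear_combination (a * (c + d) + (b * (c + d) - a * d) * (ω + 1) - b * d * (ω ^ 2 + ω + 2))
      * ω_sq
  rw [e, tr, conj_coord]
  simp only [map_add, map_sub, map_mul, map_ofNat]
  set a := algebraMap _ GF9 a
  set b := algebraMap _ GF9 b
  set c := algebraMap _ GF9 c
  set d := algebraMap _ GF9 d
  linear_combination (a * c + a * d - b * d + b * c - a * d) * h3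

theorem conj_add (x y : GF9) : conj (x + y) = conj x + conj y := by
  have h3 : (3 : GF9) = 0 := by exact_mod_cast CharP.cast_eq_zero GF9 3
  simp only [conj]
  linear_combination (x ^ 2 * y + x * y ^ 2) * h3

/-- The trace map as an additive homomorphism. -/
def trHom : GF9 →+ GF9 where
  toFun := tr
  map_zero' := by simp [tr, conj]
  map_add' x y := by simp only [tr, conj_add]; ring

/-- The sign does not affect orthogonality, so duality can be tested with `sform`, whose values lie
in `ZMod 3`. -/
theorem traceInner_eq (u v : Fin n → GF9) : traceInner u v = algebraMap _ GF9 (-sform u v) := by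
  have hu : ∀ (u : Fin n → GF9) i,
      u i = algebraMap _ GF9 (ca u i) + algebraMap _ GF9 (cb u i) * ω := fun u i => by
    rw [← coord.apply_symm_apply (u i), coord_apply]; simp [ca, cb]
  have h : traceInner u v = ∑ i, tr (ω ^ 2 * (u i * conj (v i))) := by
    rw [traceInner, Finset.mul_sum]
    exact map_sum trHom _ _
  rw [h, sform, ← Finset.sum_neg_distrib, map_sum]
  refine Finset.sum_congr rfl fun i _ => ?_
  rw [hu u i, hu v i, tr_mul_conj]
  congr 1
  ring

theorem mem_dual_iff (C : AdditiveCode n) (u : Fin n → GF9) :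
    u ∈ dual C ↔ ∀ c ∈ C, sform u c = 0 := by
  simp [dual, traceInner_eq]

theorem isSelfDual_iff (C : AdditiveCode n) :
    IsSelfDual C ↔ ∀ u, u ∈ C ↔ ∀ c ∈ C, sform u c = 0 := by
  simp only [IsSelfDual, Set.ext_iff, mem_dual_iff, SetLike.mem_coe]

/-! ### Explicit transformations and their action on coordinates. -/

abbrev SL := Matrix.SpecialLinearGroup (Fin 2) (ZMod 3)

/-- The transformation that permutes the coordinates and applies an element of `Sp₂(3)` to each. -/
def wreath (A : Fin n → SL) (σ : Equiv.Perm (Fin n)) : LinAut n where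
  toFun u i := symp (A i) (u (σ i))
  map_add' u v := by ext i; simp only [symp, Pi.add_apply, map_add, Matrix.mulVec_add]
  map_smul' c v := by
    ext i; simp only [symp, Pi.smul_apply, map_smul, Matrix.mulVec_smul, RingHom.id_apply]
  invFun u i := symp (A (σ⁻¹ i))⁻¹ (u (σ⁻¹ i))
  left_inv u := by ext i; simp [← symp_mul, symp_one]
  right_inv u := by ext i; simp [← symp_mul, symp_one]

theorem wreath_apply (A : Fin n → SL) (σ : Equiv.Perm (Fin n)) (u : Fin n → GF9) (i : Fin n) :
    wreath A σ u i = symp (A i) (u (σ i)) := rfl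

theorem wreath_mem (A : Fin n → SL) (σ : Equiv.Perm (Fin n)) :
    wreath A σ ∈ codeTransformations n := ⟨A, σ, fun _ _ => rfl⟩

theorem mem_codeTransformations_iff (T : LinAut n) :
    T ∈ codeTransformations n ↔ ∃ A σ, T = wreath A σ :=
  ⟨fun ⟨A, σ, h⟩ => ⟨A, σ, LinearEquiv.ext fun u => funext fun i => h u i⟩,
    fun ⟨A, σ, h⟩ => h ▸ wreath_mem A σ⟩

@[simp] theorem ca_wreath (A : Fin n → SL) (σ : Equiv.Perm (Fin n)) (u : Fin n → GF9) (i : Fin n) :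
    ca (wreath A σ u) i = A i 0 0 * ca u (σ i) + A i 0 1 * cb u (σ i) := by
  simp [ca, cb, wreath_apply, symp]

@[simp] theorem cb_wreath (A : Fin n → SL) (σ : Equiv.Perm (Fin n)) (u : Fin n → GF9) (i : Fin n) :
    cb (wreath A σ u) i = A i 1 0 * ca u (σ i) + A i 1 1 * cb u (σ i) := by
  simp [ca, cb, wreath_apply, symp]

theorem det_eq (M : SL) : M 0 0 * M 1 1 - M 0 1 * M 1 0 = 1 := by
  have := M.2
  rwa [Matrix.det_fin_two] at this

/-- In one coordinate the form is a `2 × 2` determinant, which a matrix of determinant 1 preserves;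
a permutation only reorders the summands. -/
theorem sform_wreath (A : Fin n → SL) (σ : Equiv.Perm (Fin n)) (u v : Fin n → GF9) :
    sform (wreath A σ u) (wreath A σ v) = sform u v := by
  rw [sform, sform, ← Equiv.sum_comp σ fun i => ca u i * cb v i - cb u i * ca v i]
  refine Finset.sum_congr rfl fun i _ => ?_
  simp only [ca_wreath, cb_wreath]
  linear_combination (ca u (σ i) * cb v (σ i) - cb u (σ i) * ca v (σ i)) * det_eq (A i)

/-! ### Graph codes. -/

/-- The additive code generated by the rows of `Γ + ω I`, for a symmetric matrix `Γ`. -/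
def graphCode (Γ : Matrix (Fin n) (Fin n) (ZMod 3)) : AdditiveCode n where
  carrier := {u | ∀ i, ca u i = ∑ j, Γ i j * cb u j}
  zero_mem' := by simp
  add_mem' {u v} hu hv i := by simp [hu i, hv i, mul_add, Finset.sum_add_distrib]
  smul_mem' c u hu i := by
    simp only [ca_smul, cb_smul, hu i, Finset.mul_sum]
    exact Finset.sum_congr rfl fun j _ => by ring

theorem mem_graphCode {Γ : Matrix (Fin n) (Fin n) (ZMod 3)} {u : Fin n → GF9} :
    u ∈ graphCode Γ ↔ ∀ i, ca u i = ∑ j, Γ i j * cb u j := Iff.rfl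

/-- The codeword of a graph code with prescribed coordinates `b`. -/
def graphWord (Γ : Matrix (Fin n) (Fin n) (ZMod 3)) (x : Fin n → ZMod 3) : Fin n → GF9 :=
  ofAB (fun i => ∑ j, Γ i j * x j) x

theorem graphWord_mem (Γ : Matrix (Fin n) (Fin n) (ZMod 3)) (x : Fin n → ZMod 3) :
    graphWord Γ x ∈ graphCode Γ := by simp [mem_graphCode, graphWord]

theorem eq_graphWord {Γ : Matrix (Fin n) (Fin n) (ZMod 3)} {u : Fin n → GF9}
    (hu : u ∈ graphCode Γ) : graphWord Γ (cb u) = u :=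
  vec_ext (fun i => by simp [graphWord, hu i]) (fun i => by simp [graphWord])

/-- The codewords of a graph code are parametrized by their coordinates `b`. -/
def graphCodeEquiv (Γ : Matrix (Fin n) (Fin n) (ZMod 3)) :
    (Fin n → ZMod 3) ≃ₗ[ZMod 3] graphCode Γ where
  toFun x := ⟨graphWord Γ x, graphWord_mem Γ x⟩
  map_add' x y := Subtype.ext <| vec_ext
    (fun i => by simp [graphWord, mul_add, Finset.sum_add_distrib])
    (fun i => by simp [graphWord])
  map_smul' c x := Subtype.ext <| vec_ext
    (fun i => by
      simp only [graphWord, Pi.smul_apply, smul_eq_mul, ca_ofAB, RingHom.id_apply,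
        SetLike.mk_smul_mk, ca_smul, Finset.mul_sum]
      exact Finset.sum_congr rfl fun j _ => by ring)
    (fun i => by simp [graphWord])
  invFun u := cb u.1
  left_inv x := by ext i; simp [graphWord]
  right_inv u := Subtype.ext (eq_graphWord u.2)

theorem finrank_graphCode (Γ : Matrix (Fin n) (Fin n) (ZMod 3)) :
    Module.finrank (ZMod 3) (graphCode Γ) = n := by
  rw [← (graphCodeEquiv Γ).finrank_eq, Module.finrank_fin_fun]

/-- Both codes have dimension `n`, so an inclusion is an equality. -/
theorem map_graphCode_eq {Γ Γ' : Matrix (Fin n) (Fin n) (ZMod 3)} (T : LinAut n)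
    (h : ∀ u ∈ graphCode Γ, T u ∈ graphCode Γ') :
    (graphCode Γ).map T.toLinearMap = graphCode Γ' := by
  have hle : (graphCode Γ).map T.toLinearMap ≤ graphCode Γ' := by
    rintro _ ⟨u, hu, rfl⟩
    exact h u hu
  refine Submodule.eq_of_le_of_finrank_le hle ?_
  rw [finrank_graphCode, LinearEquiv.finrank_map_eq, finrank_graphCode]

/-- By symmetry of `Γ`, pairing `v` with a codeword measures only the defect `a - Γ b` of `v`,
tested against the coordinates `b` of the codeword, which are arbitrary. This identity drives both
the self-duality of graph codes and the computation of the new row in `extM_map`. -/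
theorem sform_graphCode {Γ : Matrix (Fin n) (Fin n) (ZMod 3)} (hΓ : Γ.IsSymm) (v : Fin n → GF9)
    {u : Fin n → GF9} (hu : u ∈ graphCode Γ) :
    sform v u = ∑ j, (ca v j - ∑ i, Γ j i * cb v i) * cb u j := by
  have h : ∑ i, cb v i * ca u i = ∑ j, (∑ i, Γ j i * cb v i) * cb u j := by
    simp only [mem_graphCode.1 hu, Finset.mul_sum, Finset.sum_mul]
    rw [Finset.sum_comm]
    refine Finset.sum_congr rfl fun j _ => Finset.sum_congr rfl fun i _ => ?_
    rw [← hΓ.apply i j]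
    ring
  simp only [sform, Finset.sum_sub_distrib, sub_mul, h]

theorem isSelfDual_graphCode {Γ : Matrix (Fin n) (Fin n) (ZMod 3)} (hΓ : Γ.IsSymm) :
    IsSelfDual (graphCode Γ) := by
  rw [isSelfDual_iff]
  intro u
  constructor
  · intro hu c hc
    rw [sform_graphCode hΓ u hc]
    exact Finset.sum_eq_zero fun j _ => by rw [← hu j, sub_self, zero_mul]
  -- The codeword with `b` the unit vector at `j` isolates the defect of `u` at `j`.
  · intro h j
    have := h _ (graphWord_mem Γ (Pi.single j 1))
    rw [sform_graphCode hΓ u (graphWord_mem Γ _)] at this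
    simp only [graphWord, cb_ofAB, Pi.single_apply, mul_ite, mul_one, mul_zero,
      Finset.sum_ite_eq', Finset.mem_univ, if_true] at this
    exact sub_eq_zero.1 this

theorem IsSelfDual.map_wreath {C : AdditiveCode n} (hC : IsSelfDual C) (A : Fin n → SL)
    (σ : Equiv.Perm (Fin n)) :
    IsSelfDual (C.map (wreath A σ).toLinearMap) := by
  rw [isSelfDual_iff] at hC ⊢
  intro u
  obtain ⟨v, rfl⟩ := (wreath A σ).surjective u
  have hm : ∀ v, wreath A σ v ∈ C.map (wreath A σ).toLinearMap ↔ v ∈ C :=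
    fun v => ⟨fun ⟨w, hw, h⟩ => (wreath A σ).injective h ▸ hw, fun h => ⟨v, h, rfl⟩⟩
  rw [hm, hC]
  constructor
  · rintro h _ ⟨c, hc, rfl⟩
    exact (sform_wreath A σ v c).trans (h c hc)
  · intro h c hc
    rw [← sform_wreath A σ]
    exact h _ ⟨c, hc, rfl⟩

/-! ### Equivalence and nontrivial automorphisms. -/

/-- Equivalence of additive codes. -/
def CodeEq (C D : AdditiveCode n) : Prop := ∃ T ∈ codeTransformations n, C.map T.toLinearMap = D

theorem CodeEq.refl (C : AdditiveCode n) : CodeEq C C := ⟨1, one_mem _, Submodule.map_id C⟩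

theorem CodeEq.symm {C D : AdditiveCode n} : CodeEq C D → CodeEq D C := by
  rintro ⟨T, hT, h⟩
  exact ⟨T⁻¹, inv_mem hT, (Submodule.map_symm_eq_iff T).2 h⟩

theorem map_mul (S T : LinAut n) (C : AdditiveCode n) :
    C.map (S * T).toLinearMap = (C.map T.toLinearMap).map S.toLinearMap :=
  Submodule.map_comp _ _ _

theorem CodeEq.trans {C D E : AdditiveCode n} : CodeEq C D → CodeEq D E → CodeEq C E := by
  rintro ⟨T, hT, h⟩ ⟨S, hS, h'⟩
  exact ⟨S * T, mul_mem hS hT, by rw [map_mul, h, h']⟩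

/-- `C` has an automorphism other than `I` and `-I`. -/
def HasNontrivialAut (C : AdditiveCode n) : Prop :=
  ∃ T ∈ autGroup C, T ≠ 1 ∧ T ≠ LinearEquiv.neg (ZMod 3)

/-- Conjugation by the equivalence carries automorphisms to automorphisms, and it fixes `1` and
`-I`, as these are central. -/
theorem HasNontrivialAut.of_codeEq {C D : AdditiveCode n} (h : CodeEq C D)
    (hD : HasNontrivialAut D) : HasNontrivialAut C := by
  obtain ⟨T, hT, rfl⟩ := h
  obtain ⟨S, ⟨hS, hS'⟩, h1, h2⟩ := hD
  refine ⟨T⁻¹ * S * T, ⟨mul_mem (mul_mem (inv_mem hT) hS) hT, ?_⟩, ?_, ?_⟩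
  · change C.map (T⁻¹ * S * T).toLinearMap = C
    rw [map_mul, map_mul, hS', ← map_mul, inv_mul_cancel]
    exact Submodule.map_id C
  · intro h
    apply h1
    rw [mul_assoc, inv_mul_eq_one] at h
    simpa using h.symm
  · intro h
    apply h2
    have h' : S = T * LinearEquiv.neg (ZMod 3) * T⁻¹ := by rw [← h]; group
    rw [h']
    ext u : 1
    change T (-(T⁻¹ u)) = -u
    rw [map_neg]
    congr 1
    exact T.apply_symm_apply u

/-- The matrix `-I`. -/
def negSL : SL := ⟨!![-1, 0; 0, -1], by simp [Matrix.det_fin_two]⟩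

@[simp] theorem negSL_00 : negSL 0 0 = -1 := rfl

@[simp] theorem negSL_01 : negSL 0 1 = 0 := rfl

@[simp] theorem negSL_10 : negSL 1 0 = 0 := rfl

@[simp] theorem negSL_11 : negSL 1 1 = -1 := rfl

theorem wreath_negSL : wreath (fun _ : Fin n => negSL) 1 = LinearEquiv.neg (ZMod 3) := by
  ext u : 1
  exact vec_ext (fun i => by simp) (fun i => by simp)

theorem trivialGroup_subset (C : AdditiveCode n) : trivialGroup n ⊆ autGroup C := by
  rintro T (rfl | rfl)
  · exact one_mem _
  · refine ⟨wreath_negSL (n := n) ▸ wreath_mem _ _, ?_⟩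
    ext u
    constructor
    · rintro ⟨v, hv, rfl⟩
      exact neg_mem hv
    · exact fun h => ⟨-u, neg_mem h, neg_neg u⟩

theorem HasNontrivialAut.ssubset {C : AdditiveCode n} (h : HasNontrivialAut C) :
    trivialGroup n ⊂ (autGroup C : Set (LinAut n)) := by
  refine ⟨trivialGroup_subset C, fun hle => ?_⟩
  obtain ⟨T, hT, h1, h2⟩ := h
  rcases hle hT with rfl | rfl
  · exact h1 rfl
  · exact h2 rfl

theorem hasTrivialAut_iff (C : AdditiveCode n) : HasTrivialAut C ↔ ¬ HasNontrivialAut C := by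
  constructor
  · rintro h ⟨T, hT, h1, h2⟩
    have : T ∈ trivialGroup n := h ▸ hT
    rcases this with rfl | rfl
    · exact h1 rfl
    · exact h2 rfl
  · intro h
    refine Set.Subset.antisymm (fun T hT => ?_) (trivialGroup_subset C)
    by_contra hn
    exact h ⟨T, hT, fun e => hn (Or.inl e), fun e => hn (Or.inr e)⟩

/-- The transformation given by `A` and `σ` is not `I` or `-I`. -/
def NontrivialData (A : Fin n → SL) (σ : Equiv.Perm (Fin n)) : Prop :=
  (∃ i, σ i ≠ i) ∨ (∃ i, A i 0 1 ≠ 0 ∨ A i 1 0 ≠ 0) ∨ ∃ i j, A i 0 0 ≠ A j 0 0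

/-- With `c = 1` and `c = -1` this shows that data of this kind never describe `I` or `-I`, so that
nontriviality can be read off from `A` and `σ`. -/
theorem not_nontrivialData {A : Fin n → SL} {σ : Equiv.Perm (Fin n)} {c : ZMod 3}
    (h : ∀ u, wreath A σ u = c • u) : ¬ NontrivialData A σ := by
  have ha : ∀ x y : Fin n → ZMod 3, ∀ i,
      A i 0 0 * x (σ i) + A i 0 1 * y (σ i) = c * x i := fun x y i => by
    simpa using congrArg (ca · i) (h (ofAB x y))
  have hb : ∀ x y : Fin n → ZMod 3, ∀ i,
      A i 1 0 * x (σ i) + A i 1 1 * y (σ i) = c * y i := fun x y i => by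
    simpa using congrArg (cb · i) (h (ofAB x y))
  rintro (⟨i, hi⟩ | ⟨i, hi⟩ | ⟨i, j, hij⟩)
  -- The unit vector at `σ i` vanishes at `i`, while its image has the first column of `A i` there.
  -- This column would be zero, against determinant 1.
  · have h1 := ha (Pi.single (σ i) 1) 0 i
    have h2 := hb (Pi.single (σ i) 1) 0 i
    rw [Pi.single_eq_same, Pi.single_eq_of_ne' hi] at h1
    rw [Pi.single_eq_same] at h2
    simp only [mul_one, Pi.zero_apply, mul_zero, add_zero] at h1 h2
    have := det_eq (A i)
    rw [h1, h2] at this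
    simp at this
  · have h1 := ha 0 1 i
    have h2 := hb 1 0 i
    simp at h1 h2
    tauto
  · have h1 := ha 1 0 i
    have h2 := ha 1 0 j
    simp at h1 h2
    exact hij (h1.trans h2.symm)

theorem HasNontrivialAut.of_data {C : AdditiveCode n} {A : Fin n → SL} {σ : Equiv.Perm (Fin n)}
    (hd : NontrivialData A σ) (h : C.map (wreath A σ).toLinearMap = C) : HasNontrivialAut C := by
  refine ⟨wreath A σ, ⟨wreath_mem A σ, h⟩, fun e => ?_, fun e => ?_⟩
  · exact not_nontrivialData (c := 1) (fun u => by rw [e, one_smul]; rfl) hd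
  · exact not_nontrivialData (c := -1) (fun u => by rw [e, neg_one_smul]; rfl) hd

/-! ### Every self-dual code is equivalent to a graph code with zero diagonal. -/

/-- The symplectic matrix interchanging the two coordinates up to sign. -/
def rotSL : SL := ⟨!![0, -1; 1, 0], by simp [Matrix.det_fin_two]⟩

/-- An upper triangular unipotent matrix. -/
def shearSL (c : ZMod 3) : SL := ⟨!![1, c; 0, 1], by simp [Matrix.det_fin_two]⟩

@[simp] theorem rotSL_00 : rotSL 0 0 = 0 := rfl

@[simp] theorem rotSL_01 : rotSL 0 1 = -1 := rfl

@[simp] theorem rotSL_10 : rotSL 1 0 = 1 := rfl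

@[simp] theorem rotSL_11 : rotSL 1 1 = 0 := rfl

@[simp] theorem shearSL_00 (c : ZMod 3) : shearSL c 0 0 = 1 := rfl

@[simp] theorem shearSL_01 (c : ZMod 3) : shearSL c 0 1 = c := rfl

@[simp] theorem shearSL_10 (c : ZMod 3) : shearSL c 1 0 = 0 := rfl

@[simp] theorem shearSL_11 (c : ZMod 3) : shearSL c 1 1 = 1 := rfl

/-- Among the `2ⁿ` ways to rotate some of the coordinates, choose one for which the set of codewords
with `b = 0` after rotation is smallest. If a nonzero word `u` is left in it, flip the choice at a
coordinate where `u` is nonzero: orthogonality to `u` shows that the new set lies in the old one,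
and `u` itself is lost. -/
theorem exists_codeEq_transversal (C : AdditiveCode n) (hC : IsSelfDual C) :
    ∃ A : Fin n → SL, ∀ u ∈ C, (∀ i, cb (wreath A 1 u) i = 0) → u = 0 := by
  let A : (Fin n → Bool) → Fin n → SL := fun s i => if s i then rotSL else 1
  let K : (Fin n → Bool) → Set (Fin n → GF9) :=
    fun s => {u | u ∈ C ∧ ∀ i, cb (wreath (A s) 1 u) i = 0}
  obtain ⟨s, hs⟩ := Finite.exists_min fun s => (K s).ncard
  refine ⟨A s, fun u hu hu0 => ?_⟩
  by_contra hne
  obtain ⟨i, hi⟩ : ∃ i, u i ≠ 0 := by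
    by_contra! h
    exact hne (funext h)
  have hA : ca (wreath (A s) 1 u) i ≠ 0 := by
    intro h0
    have hz := (entry_eq_zero_iff (wreath (A s) 1 u) i).2 ⟨h0, hu0 i⟩
    apply hi
    rw [wreath_apply, symp, Equiv.Perm.one_apply] at hz
    have h1 : (A s i).1.mulVec (coord.symm (u i)) = 0 := by simpa using hz
    have h2 := congrArg ((A s i)⁻¹.1.mulVec) h1
    rw [Matrix.mulVec_mulVec, ← Matrix.SpecialLinearGroup.coe_mul, inv_mul_cancel,
      Matrix.SpecialLinearGroup.coe_one, Matrix.one_mulVec, Matrix.mulVec_zero] at h2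
    simpa using h2
  let s' := Function.update s i (!s i)
  refine absurd (hs s') (not_le.2 (Set.ncard_lt_ncard ?_ (Set.toFinite _)))
  have hj : ∀ j, j ≠ i → A s' j = A s j := fun j h => by simp [A, s', h]
  refine ⟨fun w hw => ⟨hw.1, fun j => ?_⟩, fun hle => ?_⟩
  · have hne : ∀ j, j ≠ i → cb (wreath (A s) 1 w) j = 0 := fun j h => by
      have := hw.2 j
      rwa [cb_wreath, hj j h, ← cb_wreath] at this
    by_cases h : j = i
    · subst h
      -- Both rotated words have `b = 0` away from `j`, and `u` has it also at `j`. Orthogonality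
      -- therefore reduces to the product of the coordinate `b` of `w` and the nonzero coordinate
      -- `a` of `u` at `j`.
      have h0 := ((isSelfDual_iff C).1 hC w).1 hw.1 u hu
      rw [← sform_wreath (A s) 1, sform, Finset.sum_eq_single j] at h0
      · rw [hu0, mul_zero, zero_sub, neg_eq_zero] at h0
        exact (mul_eq_zero.1 h0).resolve_right hA
      · intro k _ hk
        rw [hne k hk, hu0]
        simp
      · simp
    · exact hne j h
  -- The flip exchanges the two coordinates at `i` up to sign, so the new coordinate `b` of `u` is
  -- its old coordinate `a` up to sign, which is not zero.
  · have h1 := (hle ⟨hu, hu0⟩).2 i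
    have h2 := hu0 i
    apply hA
    cases hsi : s i <;> simp_all [A, s']

/-- A Lagrangian subspace that meets `b = 0` trivially projects onto the coordinates `b`: a
functional that kills the projection would give a nonzero vector with `b = 0` orthogonal to `D`,
hence in `D`. Words over the unit vectors give the columns of `Γ`, and their mutual orthogonality is
the symmetry of `Γ`. -/
theorem exists_graphCode_eq {D : AdditiveCode n} (hD : IsSelfDual D)
    (h0 : ∀ u ∈ D, (∀ i, cb u i = 0) → u = 0) :
    ∃ Γ : Matrix (Fin n) (Fin n) (ZMod 3), Γ.IsSymm ∧ D = graphCode Γ := by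
  rw [isSelfDual_iff] at hD
  let π : (Fin n → GF9) →ₗ[ZMod 3] (Fin n → ZMod 3) :=
    { toFun := cb
      map_add' := fun u v => funext (cb_add u v)
      map_smul' := fun c u => funext (cb_smul c u) }
  have hsurj : D.map π = ⊤ := by
    by_contra hne
    obtain ⟨f, hf, hle⟩ := Submodule.exists_le_ker_of_lt_top _ (lt_top_iff_ne_top.2 hne)
    apply hf
    -- The pairing of this vector with `c` is the value of `f` at the coordinates `b` of `c`.
    have hmem : ofAB (fun i => f (Pi.single i 1)) 0 ∈ D := by
      rw [hD]
      intro c hc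
      have : f (cb c) = 0 := hle ⟨c, hc, rfl⟩
      rw [LinearMap.pi_apply_eq_sum_univ] at this
      simp only [sform, ca_ofAB, cb_ofAB, Pi.zero_apply, zero_mul, sub_zero]
      rw [← this]
      refine Finset.sum_congr rfl fun i _ => ?_
      rw [smul_eq_mul, mul_comm]
      congr 2
      ext j
      simp [Pi.single_apply, eq_comm]
    have hz := h0 _ hmem (by simp)
    ext i
    simpa using congrArg (ca · i) hz
  have hex : ∀ x : Fin n → ZMod 3, ∃ u ∈ D, cb u = x := fun x => by
    have : x ∈ D.map π := hsurj ▸ Submodule.mem_top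
    exact this
  choose g hgD hg using fun j : Fin n => hex (Pi.single j 1)
  refine ⟨Matrix.of fun i j => ca (g j) i, ?_, ?_⟩
  · ext i j
    have h := (hD (g i)).1 (hgD i) (g j) (hgD j)
    simp only [sform, hg, Pi.single_apply, mul_ite, mul_one, mul_zero, ite_mul, one_mul,
      zero_mul, Finset.sum_sub_distrib, Finset.sum_ite_eq', Finset.mem_univ, if_true] at h
    exact sub_eq_zero.1 h
  · have hw : ∀ x : Fin n → ZMod 3, ∃ w ∈ D, cb w = x ∧ ∀ i, ca w i = ∑ j, ca (g j) i * x j := by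
      intro x
      have hca : ∀ i, ca (∑ j, x j • g j) i = ∑ j, ca (g j) i * x j := fun i => by
        let φ : (Fin n → GF9) →ₗ[ZMod 3] ZMod 3 :=
          { toFun := fun u => ca u i
            map_add' := fun u v => ca_add u v i
            map_smul' := fun c u => ca_smul c u i }
        have := map_sum φ (fun j => x j • g j) Finset.univ
        simp only [map_smul, smul_eq_mul] at this
        exact this.trans (Finset.sum_congr rfl fun j _ => mul_comm _ _)
      refine ⟨∑ j, x j • g j, sum_mem fun j _ => D.smul_mem _ (hgD j), ?_, hca⟩
      have := map_sum π (fun j => x j • g j) Finset.univ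
      simp only [map_smul] at this
      refine this.trans (funext fun i => ?_)
      have hπ : ∀ j, π (g j) = Pi.single j 1 := hg
      simp [hπ, Pi.single_apply]
    ext u
    obtain ⟨w, hwD, hwb, hwa⟩ := hw (cb u)
    constructor
    · intro hu i
      have hz := h0 (u - w) (D.sub_mem hu hwD) fun i => by
        simp [sub_eq_add_neg, hwb]
      have h := hwa i
      rwa [← sub_eq_zero.1 hz] at h
    · intro hu
      have : u = w := vec_ext (fun i => (hu i).trans (hwa i).symm) (fun i => by rw [hwb])
      exact this ▸ hwD

/-- A transversal position exists after rotations, and there the code is a graph. Removing the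
diagonal leaves, in each coordinate, only the freedom that the group does not obviously absorb. -/
theorem codeEq_graphCode {C : AdditiveCode n} (hC : IsSelfDual C) :
    ∃ Γ : Matrix (Fin n) (Fin n) (ZMod 3), Γ.IsSymm ∧ (∀ i, Γ i i = 0) ∧
      CodeEq C (graphCode Γ) := by
  obtain ⟨A, hA⟩ := exists_codeEq_transversal C hC
  obtain ⟨Γ, hΓ, hD⟩ := exists_graphCode_eq (hC.map_wreath A 1) (by
    rintro _ ⟨u, hu, rfl⟩ h
    change wreath A 1 u = 0
    rw [hA u hu h, map_zero])
  let Γ' : Matrix (Fin n) (Fin n) (ZMod 3) :=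
    Matrix.of fun i j => if i = j then 0 else Γ i j
  have h1 : CodeEq C (graphCode Γ) := ⟨_, wreath_mem A 1, hD⟩
  -- The shear by `-Γ i i` adds `-Γ i i * b i` to `a i` and leaves `b` alone, so it changes exactly
  -- the diagonal entry.
  refine ⟨Γ', ?_, by simp [Γ'], h1.trans ⟨_, wreath_mem (fun i => shearSL (-Γ i i)) 1,
    map_graphCode_eq _ fun u hu i => ?_⟩⟩
  · ext i j
    simp only [Γ', Matrix.transpose_apply, Matrix.of_apply, eq_comm (a := j)]
    rw [hΓ.apply]
  · simp only [ca_wreath, cb_wreath, Equiv.Perm.one_apply, shearSL_00, shearSL_01, shearSL_10,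
      shearSL_11, Γ', Matrix.of_apply, one_mul, zero_mul, zero_add, hu i]
    rw [← Finset.add_sum_erase _ _ (Finset.mem_univ i),
      ← Finset.add_sum_erase Finset.univ (fun j => (if i = j then 0 else Γ i j) * cb u j)
        (Finset.mem_univ i), if_pos rfl, zero_mul, zero_add, add_right_comm, ← add_mul,
      add_neg_cancel, zero_mul, zero_add]
    refine Finset.sum_congr rfl fun j hj => ?_
    rw [if_neg (Finset.ne_of_mem_erase hj).symm]

/-! ### Extension of a graph by one vertex. -/

/-- The matrix obtained by adding a new first row and column to a symmetric matrix. -/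
def extM (Γ : Matrix (Fin n) (Fin n) (ZMod 3)) (v : Fin n → ZMod 3) :
    Matrix (Fin (n + 1)) (Fin (n + 1)) (ZMod 3) :=
  Matrix.of (Fin.cons (Fin.cons 0 v) fun i => Fin.cons (v i) (Γ i))

@[simp] theorem extM_zero_zero (Γ : Matrix (Fin n) (Fin n) (ZMod 3)) (v : Fin n → ZMod 3) :
    extM Γ v 0 0 = 0 := rfl

@[simp] theorem extM_zero_succ (Γ : Matrix (Fin n) (Fin n) (ZMod 3)) (v : Fin n → ZMod 3)
    (j : Fin n) : extM Γ v 0 j.succ = v j := rfl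

@[simp] theorem extM_succ_zero (Γ : Matrix (Fin n) (Fin n) (ZMod 3)) (v : Fin n → ZMod 3)
    (i : Fin n) : extM Γ v i.succ 0 = v i := rfl

@[simp] theorem extM_succ_succ (Γ : Matrix (Fin n) (Fin n) (ZMod 3)) (v : Fin n → ZMod 3)
    (i j : Fin n) : extM Γ v i.succ j.succ = Γ i j := rfl

theorem extM_isSymm {Γ : Matrix (Fin n) (Fin n) (ZMod 3)} (hΓ : Γ.IsSymm) (v : Fin n → ZMod 3) :
    (extM Γ v).IsSymm := by
  ext i j
  rw [Matrix.transpose_apply]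
  cases i using Fin.cases <;> cases j using Fin.cases <;> simp [hΓ.apply]

theorem exists_eq_extM {Γ : Matrix (Fin (n + 1)) (Fin (n + 1)) (ZMod 3)} (hΓ : Γ.IsSymm)
    (h0 : ∀ i, Γ i i = 0) : ∃ (Γ' : Matrix (Fin n) (Fin n) (ZMod 3)) (v : Fin n → ZMod 3),
      Γ'.IsSymm ∧ (∀ i, Γ' i i = 0) ∧ Γ = extM Γ' v := by
  refine ⟨Matrix.of fun i j => Γ i.succ j.succ, fun j => Γ 0 j.succ, ?_, fun i => h0 _, ?_⟩
  · ext i j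
    exact hΓ.apply _ _
  · ext i j
    cases i using Fin.cases <;> cases j using Fin.cases <;> simp [h0, hΓ.apply]

/-- The action of a transformation on the vectors that extend a graph code. -/
def extAct (A : Fin n → SL) (σ : Equiv.Perm (Fin n)) (Γ : Matrix (Fin n) (Fin n) (ZMod 3))
    (v : Fin n → ZMod 3) (i : Fin n) : ZMod 3 :=
  A i 0 0 * v (σ i) - ∑ k, Γ i k * (A k 1 0 * v (σ k))

/-- The extension of a permutation by a new fixed point `0`. -/
def extPerm (σ : Equiv.Perm (Fin n)) : Equiv.Perm (Fin (n + 1)) :=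
  Equiv.Perm.decomposeFin.symm (0, σ)

@[simp] theorem extPerm_zero (σ : Equiv.Perm (Fin n)) : extPerm σ 0 = 0 := by simp [extPerm]

@[simp] theorem extPerm_succ (σ : Equiv.Perm (Fin n)) (i : Fin n) :
    extPerm σ i.succ = (σ i).succ := by simp [extPerm]

/-- The word over the new unit vector has entries `a = v`, `b = 0` in the old coordinates. Its image
there has `a = A₀₀ v(σ)` and `b = A₁₀ v(σ)`, and the defect `a - Γ' b` is the new row `extAct A σ Γ'
v`. The old words keep their place because the form is invariant. This reduces the extension problem
to one matrix in each class, modulo a linear action on the vectors `v`. -/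
theorem extM_map {Γ Γ' : Matrix (Fin n) (Fin n) (ZMod 3)} (hΓ' : Γ'.IsSymm) {A : Fin n → SL}
    {σ : Equiv.Perm (Fin n)} (h : (graphCode Γ).map (wreath A σ).toLinearMap = graphCode Γ')
    (v : Fin n → ZMod 3) : ∃ S : SL,
      (graphCode (extM Γ v)).map (wreath (Fin.cons S A) (extPerm σ)).toLinearMap =
        graphCode (extM Γ' (extAct A σ Γ' v)) := by
  set w := extAct A σ Γ' v with hw
  -- The image of the word over the new unit vector has nonzero coordinates `b` in the old
  -- positions, so its entry `a` at `0` must be the pairing of these with `w`. The shear supplies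
  -- this value.
  refine ⟨shearSL (∑ i, w i * (A i 1 0 * v (σ i))), map_graphCode_eq _ fun u hu => ?_⟩
  let x : Fin n → ZMod 3 := fun i => cb u i.succ
  have hua : ∀ i : Fin n, ca u i.succ = v i * cb u 0 + ca (graphWord Γ x) i := fun i => by
    rw [mem_graphCode.1 hu, Fin.sum_univ_succ]
    simp [graphWord, x]
  have hu0 : ca u 0 = ∑ j, v j * x j := by
    rw [mem_graphCode.1 hu, Fin.sum_univ_succ]
    simp [x]
  set t := wreath A σ (graphWord Γ x) with ht
  have htm : t ∈ graphCode Γ' := h ▸ ⟨_, graphWord_mem Γ x, rfl⟩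
  have hta : ∀ i, A i 0 0 * ca u (σ i).succ + A i 0 1 * cb u (σ i).succ =
      A i 0 0 * v (σ i) * cb u 0 + ca t i := fun i => by
    rw [ht, ca_wreath, hua]
    simp only [graphWord, cb_ofAB, x]
    ring
  have htb : ∀ i, A i 1 0 * ca u (σ i).succ + A i 1 1 * cb u (σ i).succ =
      A i 1 0 * v (σ i) * cb u 0 + cb t i := fun i => by
    rw [ht, cb_wreath, hua]
    simp only [graphWord, cb_ofAB, x]
    ring
  intro i
  rw [Fin.sum_univ_succ]
  cases i using Fin.cases with
  | zero =>
    -- Invariance of the form, applied to the vector with coordinates `a = v`, `b = 0` and a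
    -- codeword. The defect of the transformed vector with respect to `Γ'` is `w`.
    have hs : ∑ j, w j * cb t j = ∑ j, v j * x j := by
      have h1 := sform_graphCode hΓ' (wreath A σ (ofAB v 0)) htm
      rw [ht, sform_wreath, ← ht] at h1
      simp only [sform, graphWord, ca_ofAB, cb_ofAB, ca_wreath, cb_wreath, Pi.zero_apply, zero_mul,
        sub_zero, mul_zero, add_zero] at h1
      exact h1.symm
    simp only [ca_wreath, cb_wreath, extPerm_zero, extPerm_succ, Fin.cons_zero, Fin.cons_succ,
      extM_zero_zero, extM_zero_succ, zero_mul, zero_add, htb, mul_add, Finset.sum_add_distrib, hs,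
      hu0]
    simp only [shearSL_00, shearSL_01, one_mul, Finset.sum_mul]
    rw [add_comm]
    congr 1
    exact Finset.sum_congr rfl fun j _ => by ring
  | succ i =>
    simp only [ca_wreath, cb_wreath, extPerm_zero, extPerm_succ, Fin.cons_zero, Fin.cons_succ,
      extM_succ_zero, extM_succ_succ, htb, hta, mul_add, Finset.sum_add_distrib]
    rw [← mem_graphCode.1 htm, ← add_assoc]
    congr 1
    simp only [hw, extAct, shearSL_10, shearSL_11, zero_mul, one_mul, mul_zero, zero_add,
      sub_mul, Finset.sum_mul]
    rw [eq_comm, sub_add_eq_add_sub, sub_eq_iff_eq_add]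
    congr 1
    exact Finset.sum_congr rfl fun j _ => by ring

/-- Nontriviality is visible in the old coordinates, whatever matrix acts on the new one. -/
theorem NontrivialData.cons {A : Fin n → SL} {σ : Equiv.Perm (Fin n)} (h : NontrivialData A σ)
    (S : SL) : NontrivialData (Fin.cons S A : Fin (n + 1) → SL) (extPerm σ) := by
  rcases h with ⟨i, hi⟩ | ⟨i, hi⟩ | ⟨i, j, hij⟩
  · exact Or.inl ⟨i.succ, by simpa using hi⟩
  · exact Or.inr (Or.inl ⟨i.succ, by simpa using hi⟩)
  · exact Or.inr (Or.inr ⟨i.succ, j.succ, by simpa using hij⟩)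

/-! ### Packed encodings of matrices, transformations and certificates, with the checks on them. -/

/-- The entry of a list at a position. -/
def nth {α : Type} (d : α) (l : List α) : ℕ → α :=
  @List.rec α (fun _ => ℕ → α) (fun _ => d)
    (fun x _ ih k => @Nat.rec (fun _ => α) x (fun m _ => ih m) k) l

/-- A property holds for the element of a list at a position. -/
def atIndex {α : Type} (p : α → Bool) (l : List α) : ℕ → Bool :=
  @List.rec α (fun _ => ℕ → Bool) (fun _ => false)
    (fun x _ ih k => @Nat.rec (fun _ => Bool) (p x) (fun m _ => ih m) k) l

/-- The linear combination of a list of numbers, with coefficients the digits of a number in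
base `4096`. -/
def dotp (l : List ℕ) : ℕ → ℕ :=
  @List.rec ℕ (fun _ => ℕ → ℕ) (fun _ => 0)
    (fun w _ ih x => Nat.add (Nat.mul (Nat.mod x 4096) w) (ih (Nat.div x 4096))) l

/-- All of the last `n` digits in base `4096` are divisible by `3`. -/
def lanes3 (n : ℕ) : ℕ → Bool :=
  @Nat.rec (fun _ => ℕ → Bool) (fun _ => true)
    (fun _ ih x => cond (Nat.beq (Nat.mod (Nat.mod x 4096) 3) 0) (ih (Nat.div x 4096)) false) n

/-- The coordinates `a` of the image of the rows of `G` in one coordinate. -/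
def rowU (G : List ℕ) (c : ℕ) : ℕ :=
  Nat.add (Nat.mul (Nat.mod (Nat.div c 27) 3) (nth 0 G (Nat.div c 81)))
    (Nat.mul (Nat.mod (Nat.div c 9) 3) (Nat.pow 4096 (Nat.div c 81)))

/-- The coordinates `b` of the image of the rows of `G` in one coordinate. -/
def rowW (G : List ℕ) (c : ℕ) : ℕ :=
  Nat.add (Nat.mul (Nat.mod (Nat.div c 3) 3) (nth 0 G (Nat.div c 81)))
    (Nat.mul (Nat.mod c 3) (Nat.pow 4096 (Nat.div c 81)))

/-- The coordinates `b` of the images of the rows of `G` under the transformation `t`. -/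
def rowsW (G : List ℕ) (n : ℕ) : ℕ → List ℕ :=
  @Nat.rec (fun _ => ℕ → List ℕ) (fun _ => [])
    (fun _ ih t => rowW G (Nat.mod t 648) :: ih (Nat.div t 648)) n

/-- Comparison of the coordinates `a` of the images with those that `H` prescribes. -/
def checkRows (n : ℕ) (G W H : List ℕ) : ℕ → Bool :=
  @List.rec ℕ (fun _ => ℕ → Bool) (fun _ => true)
    (fun h _ ih t => cond
      (lanes3 n (Nat.add (rowU G (Nat.mod t 648)) (Nat.mul 2 (dotp W h))))
      (ih (Nat.div t 648)) false) H

/-- Every digit of `t` in base `648` encodes an element of `{0, …, N - 1} × SL₂(3)`. -/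
def digitsValid (N n : ℕ) : ℕ → Bool :=
  @Nat.rec (fun _ => ℕ → Bool) (fun _ => true)
    (fun _ ih t =>
      cond (Nat.ble (Nat.succ (Nat.div (Nat.mod t 648) 81)) N)
        (cond (Nat.beq (Nat.mod (Nat.add
            (Nat.mul (Nat.mod (Nat.div (Nat.mod t 648) 27) 3) (Nat.mod (Nat.mod t 648) 3))
            (Nat.mul 2 (Nat.mul (Nat.mod (Nat.div (Nat.mod t 648) 9) 3)
              (Nat.mod (Nat.div (Nat.mod t 648) 3) 3)))) 3) 1)
          (ih (Nat.div t 648)) false) false) n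

/-- The number that has digit `m` in base `4096` equal to the number of coordinates of the
transformation `t` that come from coordinate `m`. -/
def positions (n : ℕ) : ℕ → ℕ :=
  @Nat.rec (fun _ => ℕ → ℕ) (fun _ => 0)
    (fun _ ih t => Nat.add (Nat.pow 4096 (Nat.div (Nat.mod t 648) 81)) (ih (Nat.div t 648))) n

/-- The number with `n` digits `1` in base `4096`. -/
def ones (n : ℕ) : ℕ :=
  @Nat.rec (fun _ => ℕ) 0 (fun _ ih => Nat.add 1 (Nat.mul 4096 ih)) n

/-- The transformation `t` maps the graph code of `G` to that of `H`. -/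
def checkT (n : ℕ) (G H : List ℕ) (t : ℕ) : Bool :=
  cond (digitsValid n n t)
    (cond (Nat.beq (positions n t) (ones n)) (checkRows n G (rowsW G n t) H t) false) false

/-- The transformation `t` is not `I` or `-I`. Here `k` is the position of the first of the `n`
coordinates and `p` is the expected upper left entry of the matrices. -/
def nontrivialFrom (p n : ℕ) : ℕ → ℕ → Bool :=
  @Nat.rec (fun _ => ℕ → ℕ → Bool) (fun _ _ => false)
    (fun _ ih k t =>
      cond (Nat.beq (Nat.mod t 648) (Nat.add (Nat.mul 81 k) (Nat.mul 28 p)))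
        (ih (Nat.succ k) (Nat.div t 648)) true) n

/-- The transformation `t` is not `I` or `-I`. -/
def nontrivialT (n t : ℕ) : Bool := nontrivialFrom (Nat.mod t 3) n 0 t

/-- A column of the matrix by which the automorphism `t` of the graph code of `G` acts on the
extensions of this code; the column is scaled by `b`. -/
def actCol (k : ℕ) (G : List ℕ) : ℕ → ℕ → ℕ :=
  @List.rec ℕ (fun _ => ℕ → ℕ → ℕ) (fun _ _ => 0)
    (fun g _ ih t b => Nat.add
      (cond (Nat.beq (Nat.div (Nat.mod t 648) 81) k)
        (Nat.add (Nat.mul (Nat.mod (Nat.div (Nat.mod t 648) 27) 3) b)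
          (Nat.mul 2 (Nat.mul (Nat.mod (Nat.div (Nat.mod t 648) 3) 3) g))) 0)
      (ih (Nat.div t 648) (Nat.mul b 4096))) G

/-- The columns `k, …, k + n - 1` of the actions of the given automorphisms. -/
def actCols (G gens : List ℕ) (n : ℕ) : ℕ → List (List ℕ) :=
  @Nat.rec (fun _ => ℕ → List (List ℕ)) (fun _ => [])
    (fun _ ih k => gens.map (fun t => actCol k G t 1) :: ih (Nat.succ k)) n

/-- Entrywise addition. -/
def addl (l : List ℕ) : List ℕ → List ℕ :=
  @List.rec ℕ (fun _ => List ℕ → List ℕ) (fun _ => [])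
    (fun x _ ih l' => @List.rec ℕ (fun _ => List ℕ) [] (fun y ys _ => Nat.add x y :: ih ys) l') l

/-- The digits of `x` modulo `3` precede those of `y` lexicographically, or they are equal and
`b` holds. -/
def lexCmp (b : Bool) (n : ℕ) : ℕ → ℕ → Bool :=
  @Nat.rec (fun _ => ℕ → ℕ → Bool) (fun _ _ => b)
    (fun _ ih x y =>
      cond (Nat.beq (Nat.mod (Nat.mod x 4096) 3) (Nat.mod y 4096))
        (ih (Nat.div x 4096) (Nat.div y 4096))
        (Nat.ble (Nat.mod (Nat.mod x 4096) 3) (Nat.mod y 4096))) n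

/-- One of the vectors `± x`, for `x` in the list, precedes `y`. -/
def reducible (b : Bool) (n y : ℕ) (xs : List ℕ) : Bool :=
  @List.rec ℕ (fun _ => Bool) false
    (fun x _ ih => cond (lexCmp b n x y) true (cond (lexCmp b n (Nat.mul 2 x) y) true ih)) xs

/-- The vectors that are not reducible, for a given initial part `y` with images `xs`. -/
def coverFrom (b : Bool) (n : ℕ) (cols : List (List ℕ)) :
    ℕ → ℕ → List ℕ → List ℕ → List ℕ :=
  @List.rec (List ℕ) (fun _ => ℕ → ℕ → List ℕ → List ℕ → List ℕ)
    (fun _ y xs acc => cond (reducible b n y xs) acc (y :: acc))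
    (fun cs _ ih e y xs acc =>
      ih (Nat.mul e 4096) y xs
        (ih (Nat.mul e 4096) (Nat.add y e) (addl xs cs)
          (ih (Nat.mul e 4096) (Nat.add y (Nat.mul 2 e)) (addl (addl xs cs) cs) acc))) cols

/-- The vectors, normalized up to sign, that are not reducible. -/
def cover (b : Bool) (n : ℕ) (cols : List (List ℕ)) : ℕ → List ℕ :=
  @List.rec (List ℕ) (fun _ => ℕ → List ℕ) (fun _ => [0])
    (fun cs rest ih e => coverFrom b n rest (Nat.mul e 4096) e cs (ih (Nat.mul e 4096))) cols

/-- The rows of an extended matrix below the first. -/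
def extTail (G : List ℕ) : ℕ → List ℕ :=
  @List.rec ℕ (fun _ => ℕ → List ℕ) (fun _ => [])
    (fun g _ ih y => Nat.add (Nat.mod y 4096) (Nat.mul 4096 g) :: ih (Nat.div y 4096)) G

/-- The rows of the matrix that extends `G` by the vector `y`. -/
def extRows (G : List ℕ) (y : ℕ) : List ℕ := Nat.mul 4096 y :: extTail G y

/-- The vector `y` is settled by the certificate `c`. -/
def checkCert (b : Bool) (n : ℕ) (G : List ℕ) (R : List (List ℕ)) (y c : ℕ) : Bool :=
  @Nat.rec (fun _ => Bool)
    (cond b (cond (nontrivialT n (Nat.div c 128))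
      (checkT n (extRows G y) (extRows G y) (Nat.div c 128)) false) false)
    (fun k _ => atIndex (fun H => checkT n (extRows G y) H (Nat.div c 128)) R k) (Nat.mod c 128)

/-- All vectors of a list are settled by the corresponding certificates. -/
def checkCerts (b : Bool) (n : ℕ) (G : List ℕ) (R : List (List ℕ)) (ys : List ℕ) :
    List ℕ → Bool :=
  @List.rec ℕ (fun _ => List ℕ → Bool) (fun _ => true)
    (fun y _ ih cs => @List.rec ℕ (fun _ => Bool) false
      (fun c cs _ => cond (checkCert b n G R y c) (ih cs) false) cs) ys

/-- The numbers in the list are nontrivial automorphisms of the graph code of `G`. -/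
def checkGens (n : ℕ) (G gens : List ℕ) : Bool :=
  @List.rec ℕ (fun _ => Bool) true
    (fun t _ ih => cond (nontrivialT n t) (cond (checkT n G G t) ih false) false) gens

/-- All extensions of `G` are settled, and `G` has a nontrivial automorphism if `n ≠ 0`. -/
def checkRep (b : Bool) (n : ℕ) (R : List (List ℕ)) (G : List ℕ) (d : List ℕ × List ℕ) : Bool :=
  cond (Nat.ble n (Nat.mul n d.1.length))
    (cond (checkGens n G d.1)
      (checkCerts b (Nat.succ n) G R (cover b n (actCols G d.1 n 0) 1) d.2) false) false

/-- All extensions of the matrices in `S` are settled. -/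
def checkReps (b : Bool) (n : ℕ) (R S : List (List ℕ)) : List (List ℕ × List ℕ) → Bool :=
  @List.rec (List ℕ) (fun _ => List (List ℕ × List ℕ) → Bool) (fun _ => true)
    (fun G _ ih ds => @List.rec (List ℕ × List ℕ) (fun _ => Bool) false
      (fun d ds _ => cond (checkRep b n R G d) (ih ds) false) ds) S

/-- The vector with the last `n` digits of a number in base `3`. -/
def vec3 (n : ℕ) : ℕ → ℕ :=
  @Nat.rec (fun _ => ℕ → ℕ) (fun _ => 0)
    (fun _ ih v => Nat.add (Nat.mod v 3) (Nat.mul 4096 (ih (Nat.div v 3)))) n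

/-- The extension of the matrix in `S` with number `c / 3 ^ n` by the vector `c % 3 ^ n`. -/
def extCode (n : ℕ) (S : List (List ℕ)) (c : ℕ) : List ℕ :=
  extRows (nth [] S (Nat.div c (Nat.pow 3 n))) (vec3 n c)

/-! ### Correctness of the packed encodings. -/

/-- The number with given digits in base `4096`. -/
def pk (z : Fin n → ℕ) : ℕ := ∑ i, z i * 4096 ^ (i : ℕ)

theorem pk_succ (z : Fin (n + 1) → ℕ) : pk z = z 0 + 4096 * pk fun i => z i.succ := by
  rw [pk, pk, Fin.sum_univ_succ, Finset.mul_sum]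
  simp only [Fin.val_zero, pow_zero, mul_one, Fin.val_succ, pow_succ]
  congr 1
  exact Finset.sum_congr rfl fun i _ => by ring

theorem pk_add (z w : Fin n → ℕ) : (pk fun i => z i + w i) = pk z + pk w := by
  simp [pk, add_mul, Finset.sum_add_distrib]

theorem pk_mul (c : ℕ) (z : Fin n → ℕ) : (pk fun i => c * z i) = c * pk z := by
  simp [pk, mul_assoc, Finset.mul_sum]

theorem pk_sum {ι : Type*} (s : Finset ι) (z : ι → Fin n → ℕ) :
    (pk fun i => ∑ k ∈ s, z k i) = ∑ k ∈ s, pk (z k) := by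
  simp only [pk, Finset.sum_mul]
  exact Finset.sum_comm

theorem pk_ite (j : Fin n) : (pk fun i => if j = i then 1 else 0) = 4096 ^ (j : ℕ) := by
  simp [pk]

theorem pk_mod {z : Fin (n + 1) → ℕ} (h : z 0 < 4096) : pk z % 4096 = z 0 := by
  rw [pk_succ, Nat.add_mul_mod_self_left, Nat.mod_eq_of_lt h]

theorem pk_div {z : Fin (n + 1) → ℕ} (h : z 0 < 4096) : pk z / 4096 = pk fun i => z i.succ := by
  rw [pk_succ, Nat.add_mul_div_left _ _ (by norm_num), Nat.div_eq_of_lt h, zero_add]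

theorem pk_injective {z w : Fin n → ℕ} (hz : ∀ i, z i < 4096) (hw : ∀ i, w i < 4096)
    (h : pk z = pk w) : z = w := by
  induction n with
  | zero => exact Subsingleton.elim _ _
  | succ n ih =>
    have h0 : z 0 = w 0 := by rw [← pk_mod (hz 0), h, pk_mod (hw 0)]
    have hs := ih (fun i => hz i.succ) (fun i => hw i.succ)
      (by rw [← pk_div (hz 0), h, pk_div (hw 0)])
    ext i
    cases i using Fin.cases with
    | zero => exact h0
    | succ i => exact congrFun hs i

theorem ones_eq : ∀ n, ones n = pk fun _ : Fin n => 1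
  | 0 => by simp [pk, ones]
  | n + 1 => by
    rw [pk_succ, ← ones_eq n]
    rfl

theorem nth_ofFn {α : Type} (d : α) (f : Fin n → α) (i : Fin n) :
    nth d (List.ofFn f) i = f i := by
  induction n with
  | zero => exact i.elim0
  | succ n ih =>
    rw [List.ofFn_succ]
    cases i using Fin.cases with
    | zero => rfl
    | succ i => exact ih (fun i => f i.succ) i

theorem dotp_ofFn (W z : Fin n → ℕ) (h : ∀ i, z i < 4096) :
    dotp (List.ofFn W) (pk z) = ∑ i, z i * W i := by
  induction n with
  | zero => rfl
  | succ n ih =>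
    rw [List.ofFn_succ, Fin.sum_univ_succ]
    change pk z % 4096 * W 0 + dotp (List.ofFn fun i => W i.succ) (pk z / 4096) = _
    rw [pk_mod (h 0), pk_div (h 0), ih (fun i => W i.succ) (fun i => z i.succ) fun i => h i.succ]

theorem cond_false_eq_true {a b : Bool} : (cond a b false = true) ↔ a = true ∧ b = true := by
  cases a <;> simp

theorem cond_true_eq_true {a b : Bool} : (cond a true b = true) ↔ a = true ∨ b = true := by
  cases a <;> simp

theorem dvd_of_lanes3 {z : Fin n → ℕ} (hz : ∀ i, z i < 4096) (h : lanes3 n (pk z) = true)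
    (i : Fin n) : ((z i : ℕ) : ZMod 3) = 0 := by
  induction n with
  | zero => exact i.elim0
  | succ n ih =>
    have h' : cond (Nat.beq (pk z % 4096 % 3) 0) (lanes3 n (pk z / 4096)) false = true := h
    rw [cond_false_eq_true, pk_mod (hz 0), pk_div (hz 0)] at h'
    cases i using Fin.cases with
    | zero => exact (ZMod.natCast_eq_zero_iff _ _).2 (Nat.dvd_of_mod_eq_zero (Nat.eq_of_beq_eq_true h'.1))
    | succ i => exact ih (fun i => hz i.succ) h'.2 i

/-- The digits of a number in base `648`. -/
def dg (t i : ℕ) : ℕ := t / 648 ^ i % 648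

theorem dg_zero (t : ℕ) : dg t 0 = t % 648 := by simp [dg]

theorem dg_succ (t i : ℕ) : dg t (i + 1) = dg (t / 648) i := by
  rw [dg, dg, Nat.div_div_eq_div_mul, pow_succ']

/-- The coordinate `m` from which the transformation `t` takes coordinate `i`. -/
def dgσ (t i : ℕ) : ℕ := dg t i / 81

/-- Upper left entry of a matrix of the transformation `t`. -/
def dgp (t i : ℕ) : ℕ := dg t i / 27 % 3

/-- Upper right entry of a matrix of the transformation `t`. -/
def dgq (t i : ℕ) : ℕ := dg t i / 9 % 3

/-- Lower left entry of a matrix of the transformation `t`. -/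
def dgr (t i : ℕ) : ℕ := dg t i / 3 % 3

/-- Lower right entry of a matrix of the transformation `t`. -/
def dgs (t i : ℕ) : ℕ := dg t i % 3

/-- The number `t` encodes the transformation given by `A` and `σ`. -/
def Encodes (t : ℕ) (A : Fin n → SL) (σ : Equiv.Perm (Fin n)) : Prop :=
  ∀ i : Fin n, dgσ t i = σ i ∧ A i 0 0 = dgp t i ∧ A i 0 1 = dgq t i ∧ A i 1 0 = dgr t i ∧
    A i 1 1 = dgs t i

theorem digitsValid_iff {N n t : ℕ} (h : digitsValid N n t = true) (i : Fin n) :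
    dgσ t i < N ∧ (dgp t i * dgs t i + 2 * (dgq t i * dgr t i)) % 3 = 1 := by
  induction n generalizing t with
  | zero => exact i.elim0
  | succ n ih =>
    have h' : cond (Nat.ble (t % 648 / 81 + 1) N)
        (cond (Nat.beq ((t % 648 / 27 % 3 * (t % 648 % 3) +
          2 * (t % 648 / 9 % 3 * (t % 648 / 3 % 3))) % 3) 1) (digitsValid N n (t / 648)) false)
          false = true := h
    rw [cond_false_eq_true, cond_false_eq_true] at h'
    cases i using Fin.cases with
    | zero =>
      simp only [dgσ, dgp, dgq, dgr, dgs, Fin.val_zero, dg_zero]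
      exact ⟨Nat.le_of_ble_eq_true h'.1, Nat.eq_of_beq_eq_true h'.2.1⟩
    | succ i =>
      simpa only [dgσ, dgp, dgq, dgr, dgs, Fin.val_succ, dg_succ] using ih h'.2.2 i

theorem positions_eq (n t : ℕ) : positions n t = ∑ i : Fin n, 4096 ^ dgσ t i := by
  induction n generalizing t with
  | zero => rfl
  | succ n ih =>
    rw [Fin.sum_univ_succ]
    change 4096 ^ (t % 648 / 81) + positions n (t / 648) = _
    rw [ih]
    simp only [dgσ, Fin.val_zero, dg_zero, Fin.val_succ, dg_succ]

/-- A digit in base `648 = 8 · 81` is `81 m + 27 p + 9 q + 3 r + s` for the source coordinate `m`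
and the matrix with rows `(p, q)` and `(r, s)`. The sum of the powers `4096 ^ m` equals the number
with all digits 1 exactly when every source occurs once. -/
theorem exists_encodes {t : ℕ} (hn : n ≤ 8) (h : digitsValid n n t = true)
    (hp : positions n t = ones n) :
    ∃ (A : Fin n → SL) (σ : Equiv.Perm (Fin n)), Encodes t A σ := by
  have hv := digitsValid_iff h
  let f : Fin n → Fin n := fun i => ⟨dgσ t i, (hv i).1⟩
  -- Each multiplicity is at most `n ≤ 8`, so the multiplicities are the base `4096` digits of
  -- `positions n t`.
  have hf : (fun k : Fin n => ∑ i, if f i = k then 1 else 0) = fun _ => 1 := by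
    refine pk_injective (fun k => ?_) (fun _ => by norm_num) ?_
    · calc ∑ i, (if f i = k then 1 else 0) ≤ ∑ _i : Fin n, 1 :=
            Finset.sum_le_sum fun i _ => by split <;> simp
        _ = n := by simp
        _ < 4096 := by omega
    · rw [pk_sum]
      simp only [pk_ite, f]
      rw [← positions_eq, hp, ones_eq]
  have hs : Function.Surjective f := fun k => by
    by_contra! hk
    have := congrFun hf k
    simp [hk] at this
  have hdet : ∀ i : Fin n, (!![(dgp t i : ZMod 3), dgq t i; dgr t i, dgs t i]).det = 1 :=
    fun i => by
      have h1 := congrArg (Nat.cast : ℕ → ZMod 3) (hv i).2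
      rw [ZMod.natCast_mod] at h1
      push_cast at h1
      rw [Matrix.det_fin_two_of, ← h1]
      have h3 : (3 : ZMod 3) = 0 := rfl
      linear_combination -(dgq t i : ZMod 3) * dgr t i * h3
  exact ⟨fun i => ⟨_, hdet i⟩, Equiv.ofBijective f ⟨Finite.injective_iff_surjective.2 hs, hs⟩,
    fun i => ⟨rfl, rfl, rfl, rfl, rfl⟩⟩

/-- The packed rows of a matrix. -/
def enc (Γ : Matrix (Fin n) (Fin n) (ZMod 3)) : List ℕ :=
  List.ofFn fun i => pk fun j => (Γ i j).val

theorem val_le_two (x : ZMod 3) : x.val ≤ 2 := Nat.le_of_lt_succ (ZMod.val_lt x)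

theorem rowsW_eq (G : List ℕ) (n t : ℕ) :
    rowsW G n t = List.ofFn fun i : Fin n => rowW G (dg t i) := by
  induction n generalizing t with
  | zero => rfl
  | succ n ih =>
    rw [List.ofFn_succ]
    change rowW G (t % 648) :: rowsW G n (t / 648) = _
    rw [ih]
    simp only [Fin.val_zero, dg_zero, Fin.val_succ, dg_succ]

theorem lanes3_of_checkRows {N m t : ℕ} {G W : List ℕ} {h : Fin m → ℕ}
    (hc : checkRows N G W (List.ofFn h) t = true) (i : Fin m) :
    lanes3 N (rowU G (dg t i) + 2 * dotp W (h i)) = true := by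
  induction m generalizing t with
  | zero => exact i.elim0
  | succ m ih =>
    rw [List.ofFn_succ] at hc
    have h' : cond (lanes3 N (rowU G (t % 648) + 2 * dotp W (h 0)))
      (checkRows N G W (List.ofFn fun i => h i.succ) (t / 648)) false = true := hc
    rw [cond_false_eq_true] at h'
    cases i using Fin.cases with
    | zero => simpa only [Fin.val_zero, dg_zero] using h'.1
    | succ i => simpa only [Fin.val_succ, dg_succ] using ih h'.2 i

/-- The check compares `a` with `Γ' b` for the images of all generators at once: the base `4096`
digits are indexed by the generators, and subtraction modulo 3 is addition of the double. Since
generators are mapped into the target code, linearity and the equality of dimensions finish the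
argument. -/
theorem map_wreath_of_checkRows {Γ Γ' : Matrix (Fin n) (Fin n) (ZMod 3)} {t : ℕ} (hn : n ≤ 8)
    {A : Fin n → SL} {σ : Equiv.Perm (Fin n)} (ht : Encodes t A σ)
    (h : checkRows n (enc Γ) (rowsW (enc Γ) n t) (enc Γ') t = true) :
    (graphCode Γ).map (wreath A σ).toLinearMap = graphCode Γ' := by
  let U : Fin n → Fin n → ℕ := fun i j => dgp t i * (Γ (σ i) j).val +
    dgq t i * if σ i = j then 1 else 0
  let W : Fin n → Fin n → ℕ := fun i j => dgr t i * (Γ (σ i) j).val +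
    dgs t i * if σ i = j then 1 else 0
  have hU : ∀ i : Fin n, rowU (enc Γ) (dg t i) = pk (U i) := fun i => by
    change dgp t i * nth 0 (enc Γ) (dgσ t i) + dgq t i * 4096 ^ dgσ t i = _
    rw [(ht i).1, enc, nth_ofFn, pk_add, pk_mul, pk_mul, pk_ite]
  have hW : ∀ i : Fin n, rowW (enc Γ) (dg t i) = pk (W i) := fun i => by
    change dgr t i * nth 0 (enc Γ) (dgσ t i) + dgs t i * 4096 ^ dgσ t i = _
    rw [(ht i).1, enc, nth_ofFn, pk_add, pk_mul, pk_mul, pk_ite]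
  have b3 : ∀ x y, x % 3 * y ≤ 2 * y := fun x y =>
    Nat.mul_le_mul_right _ (Nat.le_of_lt_succ (Nat.mod_lt _ (by norm_num)))
  have hb : ∀ (a b : ℕ) (i j : Fin n),
      a % 3 * (Γ (σ i) j).val + b % 3 * (if σ i = j then 1 else 0) ≤ 6 := fun a b i j => by
    have h1 := b3 a (Γ (σ i) j).val
    have h2 := b3 b (if σ i = j then 1 else 0)
    have h3 := val_le_two (Γ (σ i) j)
    have h4 : (if σ i = j then 1 else 0) ≤ 1 := by split <;> simp
    omega
  -- The equation `a = Γ' b` at coordinate `i` for the image of the generator with `b` the unit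
  -- vector at `j`.
  have key : ∀ i j : Fin n,
      (A i 0 0 * Γ (σ i) j + A i 0 1 * (if σ i = j then 1 else 0) : ZMod 3) =
        ∑ k, Γ' i k * (A k 1 0 * Γ (σ k) j + A k 1 1 * if σ k = j then 1 else 0) := by
    intro i j
    have h1 := lanes3_of_checkRows h i
    rw [hU, rowsW_eq, dotp_ofFn _ _ fun k => (val_le_two _).trans_lt (by norm_num)] at h1
    simp only [hW] at h1
    simp only [← pk_mul, ← pk_sum, ← pk_add] at h1
    have h2 := dvd_of_lanes3 (fun j => ?_) h1 j
    · push_cast [U, W, ZMod.natCast_zmod_val] at h2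
      simp only [← (ht _).2.1, ← (ht _).2.2.1, ← (ht _).2.2.2.1, ← (ht _).2.2.2.2] at h2
      have h3 : (3 : ZMod 3) = 0 := rfl
      linear_combination h2 - (∑ k, Γ' i k * (A k 1 0 * Γ (σ k) j +
        A k 1 1 * if σ k = j then 1 else 0)) * h3
    -- No carries occur: each digit is at most `6 + 2 · 8 · 12 = 198`.
    · have h5 : ∑ k, (Γ' i k).val * W k j ≤ ∑ _k : Fin n, 12 :=
        Finset.sum_le_sum fun k _ => Nat.mul_le_mul (val_le_two _) (hb _ _ k j)
      have h6 : U i j ≤ 6 := hb _ _ i j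
      simp only [Finset.sum_const, Finset.card_univ, Fintype.card_fin, smul_eq_mul] at h5
      omega
  refine map_graphCode_eq _ fun u hu i => ?_
  have hs : ∀ m : Fin n, cb u m = ∑ j, (if m = j then 1 else 0) * cb u j := fun m => by simp
  have hl : ∀ (x y : ZMod 3) (m : Fin n), x * ca u m + y * cb u m =
      ∑ j, (x * Γ m j + y * if m = j then 1 else 0) * cb u j := fun x y m => by
    rw [hu m, hs m]
    simp only [add_mul, Finset.sum_add_distrib, Finset.mul_sum, mul_assoc]
  simp only [ca_wreath, cb_wreath, hl, key, Finset.mul_sum, Finset.sum_mul]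
  rw [Finset.sum_comm]
  exact Finset.sum_congr rfl fun k _ => Finset.sum_congr rfl fun j _ => by ring

theorem exists_of_checkT {Γ Γ' : Matrix (Fin n) (Fin n) (ZMod 3)} {t : ℕ} (hn : n ≤ 8)
    (h : checkT n (enc Γ) (enc Γ') t = true) :
    ∃ (A : Fin n → SL) (σ : Equiv.Perm (Fin n)), Encodes t A σ ∧
      (graphCode Γ).map (wreath A σ).toLinearMap = graphCode Γ' := by
  rw [checkT, cond_false_eq_true, cond_false_eq_true] at h
  obtain ⟨A, σ, ht⟩ := exists_encodes hn h.1 (Nat.eq_of_beq_eq_true h.2.1)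
  exact ⟨A, σ, ht, map_wreath_of_checkRows hn ht h.2.2⟩

theorem exists_of_nontrivialFrom {p n k t : ℕ} (h : nontrivialFrom p n k t = true) :
    ∃ i : Fin n, dg t i ≠ 81 * (k + i) + 28 * p := by
  induction n generalizing k t with
  | zero => cases h
  | succ n ih =>
    have h' : cond (Nat.beq (t % 648) (81 * k + 28 * p)) (nontrivialFrom p n (k + 1) (t / 648))
      true = true := h
    cases hb : Nat.beq (t % 648) (81 * k + 28 * p) with
    | false =>
      exact ⟨0, by simpa [dg_zero] using Nat.ne_of_beq_eq_false hb⟩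
    | true =>
      rw [hb] at h'
      obtain ⟨i, hi⟩ := ih h'
      refine ⟨i.succ, ?_⟩
      rwa [Fin.val_succ, dg_succ, add_comm (i : ℕ), ← add_assoc]

theorem natCast_eq_of_lt {a b : ℕ} (ha : a < 3) (hb : b < 3) (h : (a : ZMod 3) = b) : a = b := by
  rw [ZMod.natCast_eq_natCast_iff'] at h
  rwa [Nat.mod_eq_of_lt ha, Nat.mod_eq_of_lt hb] at h

/-- If all three alternatives fail, each digit of `t` is `81 i + 27 p + p` with one common `p`,
which is what `nontrivialFrom` compares with. -/
theorem nontrivialData_of_nontrivialT {t : ℕ} {A : Fin n → SL} {σ : Equiv.Perm (Fin n)}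
    (ht : Encodes t A σ) (h : nontrivialT n t = true) : NontrivialData A σ := by
  obtain ⟨i, hi⟩ := exists_of_nontrivialFrom h
  by_contra hd
  simp only [NontrivialData, not_or, not_exists, not_not] at hd
  obtain ⟨h1, h2, h3⟩ := hd
  have hi' : dg t i ≠ 81 * (0 + i) + 28 * (t % 3) := hi
  have hn : 0 < n := i.pos
  have m3 : ∀ x, x % 3 < 3 := fun x => Nat.mod_lt _ (by norm_num)
  have hσ : dgσ t i = i := by rw [(ht i).1, h1]
  have hq : dgq t i = 0 := natCast_eq_of_lt (m3 _) (by norm_num)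
    (by rw [← (ht i).2.2.1, (h2 i).1, Nat.cast_zero])
  have hr : dgr t i = 0 := natCast_eq_of_lt (m3 _) (by norm_num)
    (by rw [← (ht i).2.2.2.1, (h2 i).2, Nat.cast_zero])
  -- In `GF(3)`, `x y = 1` forces `x = y`.
  have hinv : ∀ j, A j 1 1 = A j 0 0 := fun j => by
    have hdet := det_eq (A j)
    rw [(h2 j).1, zero_mul, sub_zero] at hdet
    revert hdet
    generalize A j 0 0 = x
    generalize A j 1 1 = y
    revert x y
    decide
  have hs : dgs t i = dgp t i := natCast_eq_of_lt (m3 _) (m3 _)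
    (by rw [← (ht i).2.2.2.2, ← (ht i).2.1, hinv])
  -- As 3 divides 648, the residue `t % 3` is the lower right entry of the matrix at coordinate `0`.
  have hp : dgs t i = t % 3 := by
    have h0 : dgs t i = dgs t (⟨0, hn⟩ : Fin n) := natCast_eq_of_lt (m3 _) (m3 _)
      (by rw [← (ht i).2.2.2.2, ← (ht ⟨0, hn⟩).2.2.2.2, hinv, hinv, h3])
    rw [h0, dgs, dg_zero, Nat.mod_mod_of_dvd _ (by norm_num)]
  simp only [dgσ, dgp, dgq, dgr, dgs] at hσ hq hr hs hp
  have e1 : dg t i / 81 = dg t i / 27 / 3 := by rw [Nat.div_div_eq_div_mul]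
  have e2 : dg t i / 27 = dg t i / 9 / 3 := by rw [Nat.div_div_eq_div_mul]
  have e3 : dg t i / 9 = dg t i / 3 / 3 := by rw [Nat.div_div_eq_div_mul]
  omega

/-! ### The action on extension vectors and the lexicographic sieve. -/

theorem actCol_ofFn (k : ℕ) (g : Fin n → ℕ) (t b : ℕ) :
    actCol k (List.ofFn g) t b = ∑ i : Fin n,
      if dgσ t i = k then dgp t i * (b * 4096 ^ (i : ℕ)) + 2 * (dgr t i * g i) else 0 := by
  induction n generalizing t b with
  | zero => rfl
  | succ n ih =>
    rw [List.ofFn_succ, Fin.sum_univ_succ]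
    change (cond (Nat.beq (t % 648 / 81) k)
      (t % 648 / 27 % 3 * b + 2 * (t % 648 / 3 % 3 * g 0)) 0) +
        actCol k (List.ofFn fun i => g i.succ) (t / 648) (b * 4096) = _
    rw [ih]
    congr 1
    · simp only [dgσ, dgp, dgr, Fin.val_zero, dg_zero, pow_zero, mul_one]
      cases h : Nat.beq (t % 648 / 81) k with
      | true => rw [if_pos (Nat.eq_of_beq_eq_true h), cond_true]
      | false => rw [if_neg (Nat.ne_of_beq_eq_false h), cond_false]
    · simp only [dgσ, dgp, dgr, Fin.val_succ, dg_succ, pow_succ', mul_assoc]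

/-- The matrix by which the automorphism `t` of the graph code of `Γ` acts on extensions. -/
def actMat (t : ℕ) (Γ : Matrix (Fin n) (Fin n) (ZMod 3)) (k m : Fin n) : ℕ :=
  ∑ i : Fin n, if dgσ t i = k then
    dgp t i * (if i = m then 1 else 0) + 2 * (dgr t i * (Γ i m).val) else 0

theorem actCol_enc (k : Fin n) (Γ : Matrix (Fin n) (Fin n) (ZMod 3)) (t : ℕ) :
    actCol k (enc Γ) t 1 = pk (actMat t Γ k) := by
  rw [enc, actCol_ofFn]
  unfold actMat
  rw [pk_sum]
  refine Finset.sum_congr rfl fun i _ => ?_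
  split
  · rw [pk_add, pk_mul, pk_ite, pk_mul, pk_mul, one_mul]
  · simp [pk]

theorem actMat_le (hn : n ≤ 8) (t : ℕ) (Γ : Matrix (Fin n) (Fin n) (ZMod 3)) (k m : Fin n) :
    actMat t Γ k m ≤ 80 := by
  -- A summand is at most `2 + 2 · (2 · 2) = 10`.
  have h : actMat t Γ k m ≤ ∑ _i : Fin n, 10 := by
    refine Finset.sum_le_sum fun i _ => ?_
    have h1 : dgp t i ≤ 2 := Nat.le_of_lt_succ (Nat.mod_lt _ (by norm_num))
    have h2 : dgr t i ≤ 2 := Nat.le_of_lt_succ (Nat.mod_lt _ (by norm_num))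
    have h3 := Nat.mul_le_mul h2 (val_le_two (Γ i m))
    split <;> [split <;> omega; omega]
  simp only [Finset.sum_const, Finset.card_univ, Fintype.card_fin, smul_eq_mul] at h
  omega

/-- This identifies the matrix that the program assembles from rows of `Γ` with the action of
`extM_map`, where columns of `Γ` occur; the symmetry of `Γ` makes them agree. The factor 2 in
`actMat` is the sign `-1` of `extAct`. -/
theorem sum_actMat {Γ : Matrix (Fin n) (Fin n) (ZMod 3)} (hΓ : Γ.IsSymm) {t : ℕ} {A : Fin n → SL}
    {σ : Equiv.Perm (Fin n)} (ht : Encodes t A σ) (v : Fin n → ZMod 3) (m : Fin n) :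
    ∑ k, v k * (actMat t Γ k m : ZMod 3) = extAct A σ Γ v m := by
  have h1 : ∀ k, (actMat t Γ k m : ZMod 3) = ∑ i : Fin n, if σ i = k then
      A i 0 0 * (if i = m then 1 else 0) + 2 * (A i 1 0 * Γ i m) else 0 := fun k => by
    rw [actMat]
    push_cast
    refine Finset.sum_congr rfl fun i _ => ?_
    simp only [(ht i).1, (ht i).2.1, (ht i).2.2.2.1, ZMod.natCast_zmod_val, Fin.ext_iff]
  simp only [h1, Finset.mul_sum, mul_ite, mul_zero]
  rw [Finset.sum_comm]
  have h3 : (2 : ZMod 3) = -1 := rfl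
  simp only [Finset.sum_ite_eq, Finset.mem_univ, if_true, mul_add, Finset.sum_add_distrib, mul_ite,
    mul_one, mul_zero, Finset.sum_ite_eq', extAct, h3, sub_eq_add_neg, ← Finset.sum_neg_distrib]
  congr 1
  · rw [mul_comm]
  · refine Finset.sum_congr rfl fun i _ => ?_
    rw [hΓ.apply i m]
    ring

/-- The rank of a word in the lexicographic order. -/
def rk : ∀ {n : ℕ}, (Fin n → ℕ) → ℕ
  | 0, _ => 0
  | n + 1, z => z 0 * 3 ^ n + rk fun i : Fin n => z i.succ

theorem rk_lt : ∀ {n : ℕ} {z : Fin n → ℕ}, (∀ i, z i < 3) → rk z < 3 ^ n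
  | 0, _, _ => by simp [rk]
  | n + 1, z, h => by
    have h1 := rk_lt fun i : Fin n => h i.succ
    have h2 := Nat.mul_le_mul_right (3 ^ n) (Nat.le_of_lt_succ (h 0))
    rw [rk, pow_succ]
    omega

theorem rk_lt_rk {z w : Fin n → ℕ} (hz : ∀ i, z i < 3) {i : Fin n} (h : ∀ j < i, z j = w j)
    (hi : z i < w i) : rk z < rk w := by
  induction n with
  | zero => exact i.elim0
  | succ n ih =>
    rw [rk, rk]
    cases i using Fin.cases with
    | zero =>
      have h1 := rk_lt fun i : Fin n => hz i.succ
      have h2 := Nat.mul_le_mul_right (3 ^ n) (Nat.succ_le_of_lt hi)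
      rw [Nat.succ_mul] at h2
      omega
    | succ i =>
      rw [h 0 (Fin.succ_pos i)]
      exact Nat.add_lt_add_left (ih (fun j => hz j.succ)
        (fun j hj => h j.succ (Fin.succ_lt_succ_iff.2 hj)) hi) _

/-- The digit at position `0` is compared first and so carries the largest weight in `rk`. Equality
of all digits counts as success only if `b` holds. -/
theorem rk_lt_of_lexCmp {b : Bool} {z w : Fin n → ℕ} (hz : ∀ i, z i < 4096) (hw : ∀ i, w i < 3)
    (h : lexCmp b n (pk z) (pk w) = true) :
    (rk (fun i => z i % 3) < rk w) ∨ (b = true ∧ ∀ i, z i % 3 = w i) := by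
  induction n with
  | zero => exact Or.inr ⟨h, fun i => i.elim0⟩
  | succ n ih =>
    have h' : cond (Nat.beq (pk z % 4096 % 3) (pk w % 4096)) (lexCmp b n (pk z / 4096) (pk w / 4096))
      (Nat.ble (pk z % 4096 % 3) (pk w % 4096)) = true := h
    have hw0 : w 0 < 4096 := (hw 0).trans (by norm_num)
    rw [pk_mod (hz 0), pk_mod hw0, pk_div (hz 0), pk_div hw0] at h'
    cases hb : Nat.beq (z 0 % 3) (w 0) with
    | true =>
      have h0 := Nat.eq_of_beq_eq_true hb
      rw [hb] at h'
      rcases ih (fun i => hz i.succ) (fun i => hw i.succ) h' with h1 | h1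
      · left
        rw [rk, rk, h0]
        exact Nat.add_lt_add_left h1 _
      · refine Or.inr ⟨h1.1, fun i => ?_⟩
        cases i using Fin.cases with
        | zero => exact h0
        | succ i => exact h1.2 i
    | false =>
      rw [hb] at h'
      left
      exact rk_lt_rk (i := 0) (fun i => Nat.mod_lt _ (by norm_num))
        (fun j hj => absurd hj (Fin.not_lt_zero j))
        (lt_of_le_of_ne (Nat.le_of_ble_eq_true h') (Nat.ne_of_beq_eq_false hb))

theorem addl_map (l : List ℕ) (f g : ℕ → ℕ) :
    addl (l.map f) (l.map g) = l.map fun t => f t + g t := by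
  induction l with
  | nil => rfl
  | cons t l ih =>
    change (f t + g t) :: addl (l.map f) (l.map g) = _
    rw [ih]
    rfl

theorem subset_coverFrom (b : Bool) (n : ℕ) (cols : List (List ℕ)) (e y : ℕ)
    (xs acc : List ℕ) : acc ⊆ coverFrom b n cols e y xs acc := by
  induction cols generalizing e y xs acc with
  | nil =>
    change acc ⊆ cond (reducible b n y xs) acc (y :: acc)
    cases reducible b n y xs
    · exact List.subset_cons_self _ _
    · exact List.Subset.refl _
  | cons cs rest ih => exact fun a ha => ih _ _ _ _ (ih _ _ _ _ (ih _ _ _ _ ha))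

/-- The enumeration runs depth first through the remaining digits. It carries along the image of the
current initial part under every listed automorphism, to which each unit added to digit `k` adds
column `k`; at the leaves these are the images of the whole vector. -/
theorem reducible_or_mem_coverFrom (b : Bool) (N : ℕ) {m : ℕ} (gens : List ℕ)
    (C : ℕ → Fin m → ℕ) (e y : ℕ) (x : ℕ → ℕ) (acc : List ℕ) {v : Fin m → ℕ}
    (hv : ∀ i, v i < 3) :
    reducible b N (y + e * pk v) (gens.map fun t => x t + ∑ k, v k * C t k) = true ∨
      y + e * pk v ∈ coverFrom b N (List.ofFn fun k => gens.map (C · k)) e y (gens.map x) acc := by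
  induction m generalizing e y x acc with
  | zero =>
    have h0 : pk v = 0 := rfl
    simp only [h0, mul_zero, add_zero, Finset.univ_eq_empty, Finset.sum_empty]
    change _ ∨ y ∈ cond (reducible b N y (gens.map x)) acc (y :: acc)
    cases reducible b N y (gens.map x)
    · exact Or.inr List.mem_cons_self
    · exact Or.inl rfl
  | succ m ih =>
    have hs : ∀ i : Fin m, v i.succ < 3 := fun i => hv i.succ
    rw [List.ofFn_succ, pk_succ]
    simp only [Fin.sum_univ_succ, mul_add]
    let R := List.ofFn fun k : Fin m => gens.map fun t => C t k.succ
    have hc : coverFrom b N (gens.map (C · 0) :: R) e y (gens.map x) acc =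
        coverFrom b N R (e * 4096) y (gens.map x) (coverFrom b N R (e * 4096) (y + e)
          (addl (gens.map x) (gens.map (C · 0))) (coverFrom b N R (e * 4096) (y + 2 * e)
            (addl (addl (gens.map x) (gens.map (C · 0))) (gens.map (C · 0))) acc)) := rfl
    rw [hc, addl_map, addl_map]
    have h3 := hv 0
    obtain h | h | h : v 0 = 0 ∨ v 0 = 1 ∨ v 0 = 2 := by omega
    · have := ih (fun t k => C t k.succ) (e * 4096) y x (coverFrom b N R (e * 4096) (y + e)
        (gens.map fun t => x t + C t 0) (coverFrom b N R (e * 4096) (y + 2 * e)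
          (gens.map fun t => x t + C t 0 + C t 0) acc)) hs
      simpa only [h, mul_zero, zero_mul, zero_add, mul_assoc] using this
    · have := ih (fun t k => C t k.succ) (e * 4096) (y + e) (fun t => x t + C t 0)
        (coverFrom b N R (e * 4096) (y + 2 * e) (gens.map fun t => x t + C t 0 + C t 0) acc) hs
      simp only [h, one_mul, mul_one, ← mul_assoc, ← add_assoc]
      exact this.imp_right fun h => subset_coverFrom _ _ _ _ _ _ _ h
    · have := ih (fun t k => C t k.succ) (e * 4096) (y + 2 * e) (fun t => x t + C t 0 + C t 0)
        acc hs
      simp only [h, two_mul, mul_comm e 2, ← mul_assoc, ← add_assoc] at this ⊢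
      exact this.imp_right fun h =>
        subset_coverFrom _ _ _ _ _ _ _ (subset_coverFrom _ _ _ _ _ _ _ h)

/-- The leading nonzero digit is required to be 1, which selects one vector from each pair `± v`.
The zero vector is always put on the list. -/
theorem reducible_or_mem_cover (b : Bool) (N : ℕ) {m : ℕ} (gens : List ℕ) (C : ℕ → Fin m → ℕ)
    (e : ℕ) {v : Fin m → ℕ} (hv : ∀ i, v i < 3)
    (hnorm : ∀ i, (∀ j < i, v j = 0) → v i ≤ 1) :
    reducible b N (e * pk v) (gens.map fun t => ∑ k, v k * C t k) = true ∨
      e * pk v ∈ cover b N (List.ofFn fun k => gens.map (C · k)) e := by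
  induction m generalizing e with
  | zero =>
    right
    have h0 : pk v = 0 := rfl
    rw [h0]
    exact List.mem_singleton.2 rfl
  | succ m ih =>
    rw [List.ofFn_succ, pk_succ]
    simp only [Fin.sum_univ_succ, mul_add]
    let R := List.ofFn fun k : Fin m => gens.map fun t => C t k.succ
    have hc : cover b N (gens.map (C · 0) :: R) e =
        coverFrom b N R (e * 4096) e (gens.map (C · 0)) (cover b N R (e * 4096)) := rfl
    rw [hc]
    have h3 := hnorm 0 fun j hj => absurd hj (Fin.not_lt_zero j)
    obtain h | h : v 0 = 0 ∨ v 0 = 1 := by omega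
    · have := ih (fun t k => C t k.succ) (e * 4096) (fun i => hv i.succ) fun i hi =>
        hnorm i.succ fun j hj => by
          cases j using Fin.cases with
          | zero => exact h
          | succ j => exact hi j (Fin.succ_lt_succ_iff.1 hj)
      simp only [h, mul_zero, zero_mul, zero_add, mul_assoc] at this ⊢
      exact this.imp_right fun h => subset_coverFrom _ _ _ _ _ _ _ h
    · have := reducible_or_mem_coverFrom b N gens (fun t k => C t k.succ) (e * 4096) e
        (fun t => C t 0) (cover b N R (e * 4096)) (v := fun i => v i.succ) fun i => hv i.succ
      simpa only [h, one_mul, mul_one, mul_assoc] using this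

theorem exists_of_reducible {b : Bool} {N y : ℕ} {xs : List ℕ} (h : reducible b N y xs = true) :
    ∃ x ∈ xs, lexCmp b N x y = true ∨ lexCmp b N (2 * x) y = true := by
  induction xs with
  | nil => cases h
  | cons x xs ih =>
    have h' : cond (lexCmp b N x y) true (cond (lexCmp b N (2 * x) y) true (reducible b N y xs)) =
      true := h
    rw [cond_true_eq_true, cond_true_eq_true] at h'
    rcases h' with h | h | h
    · exact ⟨x, List.mem_cons_self, Or.inl h⟩
    · exact ⟨x, List.mem_cons_self, Or.inr h⟩
    · obtain ⟨x', hx', h⟩ := ih h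
      exact ⟨x', List.mem_cons_of_mem _ hx', h⟩

theorem actCols_eq (G gens : List ℕ) (n k : ℕ) :
    actCols G gens n k = List.ofFn fun i : Fin n => gens.map fun t => actCol (k + i) G t 1 := by
  induction n generalizing k with
  | zero => rfl
  | succ n ih =>
    rw [List.ofFn_succ]
    change gens.map (fun t => actCol k G t 1) :: actCols G gens n (k + 1) = _
    rw [ih]
    simp only [Fin.val_zero, add_zero, Fin.val_succ, add_assoc, add_comm 1]

theorem actCols_enc (Γ : Matrix (Fin n) (Fin n) (ZMod 3)) (gens : List ℕ) :
    actCols (enc Γ) gens n 0 =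
      List.ofFn fun k : Fin n => gens.map fun t => pk (actMat t Γ k) := by
  simp only [actCols_eq, zero_add, actCol_enc]

/-- Induction over the vectors that extend a graph code, up to sign and given automorphisms. -/
theorem forall_of_cover (hn : n ≤ 8) (Γ : Matrix (Fin n) (Fin n) (ZMod 3)) (gens : List ℕ)
    (act : ℕ → (Fin n → ZMod 3) → Fin n → ZMod 3)
    (hact : ∀ t ∈ gens, ∀ v m, ∑ k, v k * (actMat t Γ k m : ZMod 3) = act t v m) (b : Bool)
    {P : (Fin n → ZMod 3) → Prop} (hneg : ∀ v, P (-v) → P v)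
    (hgen : ∀ t ∈ gens, ∀ v, P (act t v) → P v)
    (hfix : b = true → ∀ t ∈ gens, ∀ v, act t v = v ∨ act t v = -v → P v)
    (hunc : ∀ v, pk (fun i => (v i).val) ∈ cover b n (actCols (enc Γ) gens n 0) 1 → P v)
    (v : Fin n → ZMod 3) : P v := by
  -- Descent on the lexicographic rank: a reducible vector inherits `P` from an image, or the
  -- negative of an image, of smaller rank.
  induction hr : rk (fun i => (v i).val) using Nat.strong_induction_on generalizing v with
  | _ r ih =>
  subst hr
  have hv3 : ∀ i, (v i).val < 3 := fun i => ZMod.val_lt _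
  have step : ∀ w, rk (fun i => (w i).val) < rk (fun i => (v i).val) → P w :=
    fun w hw => ih _ hw w rfl
  -- Normalized means that the first nonzero entry is 1.
  by_cases hnorm : ∀ i, (∀ j < i, (v j).val = 0) → (v i).val ≤ 1
  · have h := reducible_or_mem_cover b n gens (fun t k => pk (actMat t Γ k)) 1 hv3 hnorm
    rw [one_mul, ← actCols_enc] at h
    rcases h with h | h
    · obtain ⟨x, hx, hc⟩ := exists_of_reducible h
      obtain ⟨t, ht, rfl⟩ := List.mem_map.1 hx
      let z : Fin n → ℕ := fun m => ∑ k, (v k).val * actMat t Γ k m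
      -- Here `1280 = 8 · 2 · 80`; even the doubled digits, which represent the negative vector,
      -- stay below 4096.
      have hz : ∀ m, z m ≤ 1280 := fun m => by
        have h1 : z m ≤ ∑ _k : Fin n, 160 := Finset.sum_le_sum fun k _ =>
          Nat.mul_le_mul (val_le_two _) (actMat_le hn t Γ k m)
        simp only [Finset.sum_const, Finset.card_univ, Fintype.card_fin, smul_eq_mul] at h1
        omega
      have hzc : ∀ m, ((z m : ℕ) : ZMod 3) = act t v m := fun m => by
        rw [← hact t ht]
        push_cast [z, ZMod.natCast_zmod_val]
        rfl
      have hz1 : ∀ m, z m % 3 = (act t v m).val := fun m => by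
        rw [← hzc, ZMod.val_natCast]
      have hz2 : ∀ m, 2 * z m % 3 = ((-act t v) m).val := fun m => by
        rw [Pi.neg_apply, ← hzc, ← ZMod.val_natCast]
        congr 1
        have h3 : (2 : ZMod 3) = -1 := rfl
        push_cast
        rw [h3, neg_one_mul]
      have hpk : ∑ k, (v k).val * pk (actMat t Γ k) = pk z := by
        simp only [z, ← pk_mul, pk_sum]
      rw [hpk, ← pk_mul] at hc
      rcases hc with hc | hc
      · rcases rk_lt_of_lexCmp (fun m => (hz m).trans_lt (by norm_num)) hv3 hc with h | ⟨hb, h⟩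
        · simp only [hz1] at h
          exact hgen t ht v (step _ h)
        -- A tie in the comparison means that the automorphism fixes the vector, which is admissible
        -- only under `b`.
        · refine hfix hb t ht v (Or.inl (funext fun m => ZMod.val_injective 3 ?_))
          rw [← hz1, h]
      · rcases rk_lt_of_lexCmp
          (fun m => (Nat.mul_le_mul_left 2 (hz m)).trans_lt (by norm_num)) hv3 hc with h | ⟨hb, h⟩
        · simp only [hz2] at h
          exact hgen t ht v (hneg _ (step _ h))
        · refine hfix hb t ht v (Or.inr (neg_eq_iff_eq_neg.1 (funext fun m => ZMod.val_injective 3 ?_)))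
          rw [← hz2, h]
    · exact hunc v h
  -- The leading entry is 2, so `-v` has leading entry 1 and smaller rank.
  · push Not at hnorm
    obtain ⟨i, hi, hi1⟩ := hnorm
    refine hneg v (step _ (rk_lt_rk (fun j => ZMod.val_lt _) (i := i) (fun j hj => ?_) ?_))
    · have h0 : v j = 0 := (ZMod.val_eq_zero _).1 (hi j hj)
      simp [h0]
    · rw [Pi.neg_apply]
      revert hi1
      generalize v i = x
      revert x
      decide

/-! ### Certificates and the inductive classification. -/

theorem extTail_ofFn (g : Fin n → ℕ) {w : Fin n → ℕ} (hw : ∀ i, w i < 4096) :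
    extTail (List.ofFn g) (pk w) = List.ofFn fun i => w i + 4096 * g i := by
  induction n with
  | zero => rfl
  | succ n ih =>
    rw [List.ofFn_succ, List.ofFn_succ]
    change (pk w % 4096 + 4096 * g 0) :: extTail (List.ofFn fun i => g i.succ) (pk w / 4096) = _
    rw [pk_mod (hw 0), pk_div (hw 0), ih _ fun i => hw i.succ]

theorem extRows_enc (Γ : Matrix (Fin n) (Fin n) (ZMod 3)) (v : Fin n → ZMod 3) :
    extRows (enc Γ) (pk fun i => (v i).val) = enc (extM Γ v) := by
  rw [extRows, enc, extTail_ofFn _ fun i => (ZMod.val_lt (v i)).trans (by norm_num), enc,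
    List.ofFn_succ]
  simp only [pk_succ, extM_zero_zero, extM_zero_succ, extM_succ_zero, extM_succ_succ,
    ZMod.val_zero, zero_add]
  rfl

/-- Every list in `R` consists of the packed rows of a symmetric matrix. -/
def IsEncodedList (n : ℕ) (R : List (List ℕ)) : Prop :=
  ∀ G ∈ R, ∃ Γ : Matrix (Fin n) (Fin n) (ZMod 3), Γ.IsSymm ∧ enc Γ = G

/-- The graph code of `Γ` is equivalent to one in the list, or `b` holds and it has nontrivial
automorphisms. -/
def Settled (b : Bool) (R : List (List ℕ)) (Γ : Matrix (Fin n) (Fin n) (ZMod 3)) : Prop :=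
  (b = true ∧ HasNontrivialAut (graphCode Γ)) ∨
    ∃ Γ' : Matrix (Fin n) (Fin n) (ZMod 3), Γ'.IsSymm ∧ enc Γ' ∈ R ∧
      CodeEq (graphCode Γ) (graphCode Γ')

theorem Settled.of_codeEq {b : Bool} {R : List (List ℕ)} {Γ Γ' : Matrix (Fin n) (Fin n) (ZMod 3)}
    (h : CodeEq (graphCode Γ) (graphCode Γ')) (hs : Settled b R Γ') : Settled b R Γ := by
  rcases hs with ⟨hb, hs⟩ | ⟨Γ'', h1, h2, h3⟩
  · exact Or.inl ⟨hb, hs.of_codeEq h⟩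
  · exact Or.inr ⟨Γ'', h1, h2, h.trans h3⟩

theorem exists_of_atIndex {α : Type} {p : α → Bool} {l : List α} {k : ℕ}
    (h : atIndex p l k = true) : ∃ x ∈ l, p x = true := by
  induction l generalizing k with
  | nil => cases h
  | cons x l ih =>
    cases k with
    | zero => exact ⟨x, List.mem_cons_self, h⟩
    | succ k =>
      obtain ⟨y, hy, h⟩ := ih (k := k) h
      exact ⟨y, List.mem_cons_of_mem _ hy, h⟩

/-- A certificate is `128 t + k`. For `k = 0` the transformation `t` is a nontrivial automorphism of
the extended code; otherwise it maps this code to the listed code with number `k - 1`. No list has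
more than 127 members. -/
theorem settled_of_checkCert {b : Bool} (hn : n + 1 ≤ 8) {Γ : Matrix (Fin n) (Fin n) (ZMod 3)}
    {R : List (List ℕ)} (hR : IsEncodedList (n + 1) R) {v : Fin n → ZMod 3} {c : ℕ}
    (h : checkCert b (n + 1) (enc Γ) R (pk fun i => (v i).val) c = true) :
    Settled b R (extM Γ v) := by
  rw [checkCert, extRows_enc] at h
  generalize Nat.mod c 128 = k at h
  cases k with
  | zero =>
    have h' : cond b (cond (nontrivialT (n + 1) (c / 128))
      (checkT (n + 1) (enc (extM Γ v)) (enc (extM Γ v)) (c / 128)) false) false = true := h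
    rw [cond_false_eq_true, cond_false_eq_true] at h'
    obtain ⟨A, σ, ht, hm⟩ := exists_of_checkT hn h'.2.2
    exact Or.inl ⟨h'.1, .of_data (nontrivialData_of_nontrivialT ht h'.2.1) hm⟩
  | succ k =>
    obtain ⟨H, hH, h'⟩ := exists_of_atIndex (k := k) h
    obtain ⟨Γ', hs, rfl⟩ := hR H hH
    obtain ⟨A, σ, -, hm⟩ := exists_of_checkT hn h'
    exact Or.inr ⟨Γ', hs, hH, _, wreath_mem A σ, hm⟩

theorem exists_of_checkCerts {b : Bool} {G : List ℕ} {R : List (List ℕ)} {ys cs : List ℕ}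
    (h : checkCerts b n G R ys cs = true) {y : ℕ} (hy : y ∈ ys) :
    ∃ c, checkCert b n G R y c = true := by
  induction ys generalizing cs with
  | nil => cases hy
  | cons x ys ih =>
    cases cs with
    | nil => cases h
    | cons c cs =>
      have h' : cond (checkCert b n G R x c) (checkCerts b n G R ys cs) false = true := h
      rw [cond_false_eq_true] at h'
      rcases List.mem_cons.1 hy with rfl | hy
      · exact ⟨c, h'.1⟩
      · exact ih h'.2 hy

theorem checkT_of_checkGens {G gens : List ℕ} (h : checkGens n G gens = true) {t : ℕ}
    (ht : t ∈ gens) : nontrivialT n t = true ∧ checkT n G G t = true := by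
  induction gens with
  | nil => cases ht
  | cons s gens ih =>
    have h' : cond (nontrivialT n s) (cond (checkT n G G s) (checkGens n G gens) false) false =
      true := h
    rw [cond_false_eq_true, cond_false_eq_true] at h'
    rcases List.mem_cons.1 ht with rfl | ht
    · exact ⟨h'.1, h'.2.1⟩
    · exact ih h'.2.2 ht

theorem extAct_negSL (Γ : Matrix (Fin n) (Fin n) (ZMod 3)) (v : Fin n → ZMod 3) :
    extAct (fun _ => negSL) 1 Γ v = -v := by
  ext i
  simp [extAct]

theorem map_negSL_graphCode (Γ : Matrix (Fin n) (Fin n) (ZMod 3)) :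
    (graphCode Γ).map (wreath (fun _ => negSL) 1).toLinearMap = graphCode Γ :=
  map_graphCode_eq _ fun u hu i => by simp [hu i]

@[simp] theorem negSL_mul_apply (M : SL) (i j : Fin 2) : (negSL * M) i j = -M i j := by
  fin_cases i <;> fin_cases j <;> simp [Matrix.mul_apply]

theorem wreath_negSL_mul (A : Fin n → SL) (σ : Equiv.Perm (Fin n)) (u : Fin n → GF9) :
    wreath (fun i => negSL * A i) σ u = -wreath A σ u :=
  vec_ext (fun i => by
      simp only [ca_wreath, negSL_mul_apply, ca_neg]
      ring)
    (fun i => by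
      simp only [cb_wreath, negSL_mul_apply, cb_neg]
      ring)

theorem extAct_negSL_mul (A : Fin n → SL) (σ : Equiv.Perm (Fin n))
    (Γ : Matrix (Fin n) (Fin n) (ZMod 3)) (v : Fin n → ZMod 3) :
    extAct (fun i => negSL * A i) σ Γ v = -extAct A σ Γ v := by
  ext i
  simp only [extAct, negSL_mul_apply, Pi.neg_apply, neg_mul, mul_neg, Finset.sum_neg_distrib]
  ring

theorem NontrivialData.neg {A : Fin n → SL} {σ : Equiv.Perm (Fin n)} (h : NontrivialData A σ) :
    NontrivialData (fun i => negSL * A i) σ := by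
  simpa only [NontrivialData, negSL_mul_apply, ne_eq, neg_eq_zero, neg_inj] using h

/-- Being settled depends only on the equivalence class, so by `extM_map` it passes along the orbits
of the listed automorphisms and from `-v` to `v`. Hence the vectors left by the sieve suffice. -/
theorem settled_of_checkRep {b : Bool} (hn : n + 1 ≤ 8) {R : List (List ℕ)}
    (hR : IsEncodedList (n + 1) R) {Γ : Matrix (Fin n) (Fin n) (ZMod 3)} (hΓ : Γ.IsSymm)
    {d : List ℕ × List ℕ} (h : checkRep b n R (enc Γ) d = true) (v : Fin n → ZMod 3) :
    Settled b R (extM Γ v) := by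
  rw [checkRep, cond_false_eq_true, cond_false_eq_true] at h
  have hgens : ∀ t ∈ d.1, ∃ (A : Fin n → SL) (σ : Equiv.Perm (Fin n)), NontrivialData A σ ∧
      (graphCode Γ).map (wreath A σ).toLinearMap = graphCode Γ ∧
        ∀ v m, ∑ k, v k * (actMat t Γ k m : ZMod 3) = extAct A σ Γ v m := fun t ht => by
    obtain ⟨h1, h2⟩ := checkT_of_checkGens h.2.1 ht
    obtain ⟨A, σ, he, hm⟩ := exists_of_checkT (by omega) h2
    exact ⟨A, σ, nontrivialData_of_nontrivialT he h1, hm, sum_actMat hΓ he⟩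
  have hneg : ∀ v, CodeEq (graphCode (extM Γ v)) (graphCode (extM Γ (-v))) := fun v => by
    obtain ⟨S, hS⟩ := extM_map hΓ (map_negSL_graphCode Γ) v
    rw [extAct_negSL] at hS
    exact ⟨_, wreath_mem _ _, hS⟩
  -- The action is given by `actMat`, which makes sense for every number `t`; for the listed
  -- automorphisms it agrees with `extAct`.
  refine forall_of_cover (P := fun v => Settled b R (extM Γ v)) (by omega) Γ d.1 (fun t v m => ∑ k, v k * (actMat t Γ k m : ZMod 3))
    (fun _ _ _ _ => rfl) b (fun v hv => hv.of_codeEq (hneg v)) (fun t ht v hv => ?_)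
    (fun hb t ht v hv => ?_) (fun v hv => ?_) v
  · obtain ⟨A, σ, -, hm, ha⟩ := hgens t ht
    obtain ⟨S, hS⟩ := extM_map hΓ hm v
    rw [show (fun m => ∑ k, v k * (actMat t Γ k m : ZMod 3)) = extAct A σ Γ v from
      funext fun m => ha v m] at hv
    exact hv.of_codeEq ⟨_, wreath_mem _ _, hS⟩
  · obtain ⟨A, σ, hd, hm, ha⟩ := hgens t ht
    rw [show (fun m => ∑ k, v k * (actMat t Γ k m : ZMod 3)) = extAct A σ Γ v from
      funext fun m => ha v m] at hv
    obtain ⟨S, hS⟩ := extM_map hΓ hm v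
    refine Or.inl ⟨hb, ?_⟩
    rcases hv with hv | hv
    · rw [hv] at hS
      exact .of_data (hd.cons S) hS
    -- An automorphism that negates `v` is composed with `-I`; the product fixes `v`, so it extends
    -- to an automorphism of the extended code, and it is still nontrivial.
    · have hm' : (graphCode Γ).map (wreath (fun i => negSL * A i) σ).toLinearMap =
          graphCode Γ := map_graphCode_eq _ fun u hu => by
        rw [wreath_negSL_mul]
        exact neg_mem (hm ▸ ⟨u, hu, rfl⟩)
      obtain ⟨S, hS⟩ := extM_map hΓ hm' v
      rw [extAct_negSL_mul, hv, neg_neg] at hS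
      exact .of_data (hd.neg.cons S) hS
  · obtain ⟨c, hc⟩ := exists_of_checkCerts h.2.2 hv
    exact settled_of_checkCert hn hR hc

/-- The first test in `checkRep` forces at least one automorphism to be listed when `n ≠ 0`, and
every listed automorphism has been checked to be nontrivial. -/
theorem hasNontrivialAut_of_checkRep {b : Bool} (h0 : 1 ≤ n) (hn : n ≤ 8) {R : List (List ℕ)}
    {Γ : Matrix (Fin n) (Fin n) (ZMod 3)} {d : List ℕ × List ℕ}
    (h : checkRep b n R (enc Γ) d = true) : HasNontrivialAut (graphCode Γ) := by
  rw [checkRep, cond_false_eq_true, cond_false_eq_true] at h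
  have h1 : n ≤ n * d.1.length := Nat.le_of_ble_eq_true h.1
  have h2 : d.1 ≠ [] := fun hd => by
    rw [hd, List.length_nil, mul_zero] at h1
    omega
  obtain ⟨h3, h4⟩ := checkT_of_checkGens h.2.1 (List.head_mem h2)
  obtain ⟨A, σ, he, hm⟩ := exists_of_checkT hn h4
  exact .of_data (nontrivialData_of_nontrivialT he h3) hm

/-- There are certificates for the extensions of all matrices in `S`. -/
def Certified (b : Bool) (n : ℕ) (R S : List (List ℕ)) : Prop :=
  ∀ G ∈ S, ∃ d, checkRep b n R G d = true

theorem Certified.of_checkReps {b : Bool} {R S : List (List ℕ)}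
    (h : ∃ ds, checkReps b n R S ds = true) : Certified b n R S := by
  obtain ⟨ds, h⟩ := h
  induction S generalizing ds with
  | nil => exact fun G hG => absurd hG List.not_mem_nil
  | cons H S ih =>
    cases ds with
    | nil => cases h
    | cons d ds =>
      have h' : cond (checkRep b n R H d) (checkReps b n R S ds) false = true := h
      rw [cond_false_eq_true] at h'
      intro G hG
      rcases List.mem_cons.1 hG with rfl | hG
      · exact ⟨d, h'.1⟩
      · exact ih ds h'.2 G hG

/-- Splits a long list into blocks that are checked separately. -/
theorem Certified.drop {b : Bool} {R S : List (List ℕ)} {i k : ℕ}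
    (h : ∃ ds, checkReps b n R (List.take k (List.drop i S)) ds = true)
    (h' : Certified b n R (List.drop (i + k) S)) : Certified b n R (List.drop i S) := by
  intro G hG
  rw [← List.take_append_drop k (List.drop i S), List.drop_drop, List.mem_append] at hG
  exact hG.elim (Certified.of_checkReps h G) (h' G)

/-- The graph code of every symmetric matrix with zero diagonal is settled by the list. -/
def Covers (b : Bool) (n : ℕ) (R : List (List ℕ)) : Prop :=
  ∀ Γ : Matrix (Fin n) (Fin n) (ZMod 3), Γ.IsSymm → (∀ i, Γ i i = 0) → Settled b R Γ

/-- Delete the first vertex, move the remaining graph to its representative, and transport the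
deleted row by `extM_map`; the outcome is an extension of a representative, which is certified.
Lower lengths need full coverage, without discarding codes with nontrivial automorphisms, because a
code with trivial group may extend a code with a large one. -/
theorem covers_succ {b : Bool} (hn : n + 1 ≤ 8) {R S : List (List ℕ)}
    (hR : IsEncodedList (n + 1) R) (hS : Covers false n S) (h : Certified b n R S) :
    Covers b (n + 1) R := by
  intro Γ hΓ h0
  obtain ⟨Γ₁, v, h1, h2, rfl⟩ := exists_eq_extM hΓ h0
  rcases hS Γ₁ h1 h2 with ⟨hb, -⟩ | ⟨Γ₂, h3, h4, T, hT, h5⟩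
  · cases hb
  · obtain ⟨A, σ, rfl⟩ := (mem_codeTransformations_iff T).1 hT
    obtain ⟨s, hs⟩ := extM_map h3 h5 v
    obtain ⟨d, hd⟩ := h _ h4
    exact (settled_of_checkRep hn hR h3 hd _).of_codeEq ⟨_, wreath_mem _ _, hs⟩

/-- The certificates for the passage from `n` to `n + 1` contain nontrivial automorphisms of the
representatives of length `n`, so they prove the first claim at length `n`. -/
theorem hasNontrivialAut_of_covers {b : Bool} (h0 : 1 ≤ n) (hn : n ≤ 8) {R S : List (List ℕ)}
    (hS : Covers false n S) (h : Certified b n R S) {C : AdditiveCode n} (hC : IsSelfDual C) :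
    HasNontrivialAut C := by
  obtain ⟨Γ, h1, h2, h3⟩ := codeEq_graphCode hC
  rcases hS Γ h1 h2 with ⟨hb, -⟩ | ⟨Γ', h4, h5, h6⟩
  · cases hb
  · obtain ⟨d, hd⟩ := h _ h5
    exact (hasNontrivialAut_of_checkRep h0 hn hd).of_codeEq (h3.trans h6)

theorem vec3_eq (n v : ℕ) : ∃ w : Fin n → ZMod 3, vec3 n v = pk fun i => (w i).val := by
  induction n generalizing v with
  | zero => exact ⟨Fin.elim0, rfl⟩
  | succ n ih =>
    obtain ⟨w, hw⟩ := ih (v / 3)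
    refine ⟨Fin.cons (v : ZMod 3) w, ?_⟩
    rw [pk_succ]
    simp only [Fin.cons_zero, Fin.cons_succ, ← hw, ZMod.val_natCast]
    rfl

theorem nth_mem {α : Type} (d : α) {l : List α} {k : ℕ} (h : k < l.length) : nth d l k ∈ l := by
  induction l generalizing k with
  | nil => cases h
  | cons x l ih =>
    cases k with
    | zero => exact List.mem_cons_self
    | succ k => exact List.mem_cons_of_mem _ (ih (Nat.lt_of_succ_lt_succ h))

theorem IsEncodedList.map_extCode {S : List (List ℕ)} (hS : IsEncodedList n S) {cs : List ℕ}
    (h : ∀ c ∈ cs, c / 3 ^ n < S.length) : IsEncodedList (n + 1) (cs.map (extCode n S)) := by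
  intro G hG
  obtain ⟨c, hc, rfl⟩ := List.mem_map.1 hG
  obtain ⟨Γ, hΓ, hG⟩ := hS _ (nth_mem [] (h c hc))
  obtain ⟨w, hw⟩ := vec3_eq n c
  refine ⟨extM Γ w, extM_isSymm hΓ w, ?_⟩
  rw [← extRows_enc, ← hw, hG]
  rfl

/-! ### Packed codewords and the second order invariant: the computation. -/

/-- Application of a function to the value of a numeral. -/
def force {α : Type} (f : ℕ → α) (x : ℕ) : α :=
  @Nat.rec (fun _ => α) (f 0) (fun m _ => f (Nat.succ m)) x

/-- Addition of words. The entry `a + b ω` at position `i` is the digit `a + 8 b` of weight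
`4096 ^ i`, and `o` is the number with all digits `1`. -/
def addw (o x y : ℕ) : ℕ :=
  force (fun z => Nat.sub z
    (Nat.mul 3 (Nat.div (Nat.land (Nat.add z (Nat.mul 9 o)) (Nat.mul 36 o)) 4))) (Nat.add x y)

/-- The number of nonzero entries of a word. -/
def wtw (o S : ℕ) : ℕ :=
  Nat.mod (Nat.div (Nat.land (Nat.add S (Nat.mul 31 o)) (Nat.mul 32 o)) 32) 4095

/-- The sum of the values of `f` at the words `X + c`, for `c` in the span of the list. -/
def sumw (o : ℕ) (f : ℕ → ℕ) (rows : List ℕ) : ℕ → ℕ :=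
  @List.rec ℕ (fun _ => ℕ → ℕ) f
    (fun r _ ih X => Nat.add (ih X)
      (force (fun Y => Nat.add (ih Y) (force ih (addw o Y r))) (addw o X r))) rows

/-- The words generating the graph code of `G`, for `p = 8`. -/
def genw (G : List ℕ) : ℕ → List ℕ :=
  @List.rec ℕ (fun _ => ℕ → List ℕ) (fun _ => [])
    (fun h _ ih p => Nat.add h p :: ih (Nat.mul 4096 p)) G

/-- The number with digits `1` in base `2 ^ 64` at the positions `19 i + l`, where `l` is the
entry of the word at position `i`. -/
def hot (n : ℕ) : ℕ → ℕ :=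
  @Nat.rec (fun _ => ℕ → ℕ) (fun _ => 0)
    (fun _ ih S => Nat.add (Nat.pow 18446744073709551616 (Nat.mod S 4096))
      (Nat.mul (Nat.pow 18446744073709551616 19) (ih (Nat.div S 4096)))) n

/-- A digit in base `2 ^ 64`. -/
def slot (F l : ℕ) : ℕ :=
  Nat.mod (Nat.div F (Nat.pow 18446744073709551616 l)) 18446744073709551616

/-- The sum of the digits of `F` at the positions in which `hot n S` has digits `1`. -/
def valw (n : ℕ) : ℕ → ℕ → ℕ :=
  @Nat.rec (fun _ => ℕ → ℕ → ℕ) (fun _ _ => 0)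
    (fun _ ih F S => Nat.add (slot F (Nat.mod S 4096))
      (ih (Nat.div F (Nat.pow 18446744073709551616 19)) (Nat.div S 4096))) n

/-- The table of the sums of `f` over the words of weight at most `5` with a given entry at a
given position. -/
def tallyw (n o : ℕ) (rows : List ℕ) (f : ℕ → ℕ) : ℕ :=
  sumw o (fun S => cond (Nat.ble (wtw o S) 5) (Nat.mul (f S) (hot n S)) 0) rows 0

/-- The table of the second order invariants of the graph code of `G`. -/
def tablew (n : ℕ) (G : List ℕ) : ℕ :=
  force (fun o => force (fun F => tallyw n o (genw G 8)
    (fun S => force (fun v => Nat.mul v v) (valw n F S)))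
    (tallyw n o (genw G 8) (wtw o))) (ones n)

/-- Some of the digits of `F` differ from the corresponding digits of `F'`. -/
def differ (F F' : ℕ) (l : List (ℕ × ℕ)) : Bool :=
  @List.rec (ℕ × ℕ) (fun _ => Bool) false
    (fun p _ ih => cond (Nat.beq (slot F p.1) (slot F' p.2)) ih true) l

/-- `differ` holds for all members of a list. -/
def allDiffer (F F' : ℕ) (l : List (List (ℕ × ℕ))) : Bool :=
  @List.rec (List (ℕ × ℕ)) (fun _ => Bool) true
    (fun p _ ih => cond (differ F F' p) ih false) l

/-- The action of the matrices of determinant `1`, apart from `±I`, on some of the lanes. -/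
def slRest : List (List (ℕ × ℕ)) :=
  [[(0, 0), (1, 16), (8, 1), (9, 17), (10, 9)],
   [(0, 0), (1, 16), (8, 9), (9, 1), (10, 17)],
   [(0, 0), (1, 16), (8, 17), (9, 9), (10, 1)],
   [(0, 0), (1, 8), (8, 2), (9, 10), (10, 18)],
   [(0, 0), (1, 8), (8, 10), (9, 18), (10, 2)],
   [(0, 0), (1, 8), (8, 18), (9, 2), (10, 10)],
   [(0, 0), (1, 9), (8, 8), (9, 17), (10, 2)],
   [(0, 0), (1, 17), (8, 8), (9, 1), (10, 18)],
   [(0, 0), (1, 1), (8, 9), (9, 10), (10, 8)],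
   [(0, 0), (1, 9), (8, 17), (9, 2), (10, 8)],
   [(0, 0), (1, 17), (8, 1), (9, 18), (10, 8)],
   [(0, 0), (1, 1), (8, 10), (9, 8), (10, 9)],
   [(0, 0), (1, 9), (8, 2), (9, 8), (10, 17)],
   [(0, 0), (1, 17), (8, 18), (9, 8), (10, 1)],
   [(0, 0), (1, 10), (8, 16), (9, 2), (10, 9)],
   [(0, 0), (1, 18), (8, 16), (9, 10), (10, 1)],
   [(0, 0), (1, 2), (8, 17), (9, 16), (10, 18)],
   [(0, 0), (1, 10), (8, 9), (9, 16), (10, 2)],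
   [(0, 0), (1, 18), (8, 1), (9, 16), (10, 10)],
   [(0, 0), (1, 2), (8, 18), (9, 17), (10, 16)],
   [(0, 0), (1, 10), (8, 2), (9, 9), (10, 16)],
   [(0, 0), (1, 18), (8, 10), (9, 1), (10, 16)]]

/-- The action of the matrices of determinant `1` on some of the lanes. -/
def slAll : List (List (ℕ × ℕ)) :=
  [(0, 0), (1, 1), (8, 8), (9, 9), (10, 10)] ::
  [(0, 0), (1, 2), (8, 16), (9, 18), (10, 17)] :: slRest

/-- The entries of a table from position `i` on. -/
def shiftw (F i : ℕ) : ℕ := Nat.div F (Nat.pow 18446744073709551616 (Nat.mul 19 i))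

/-- A bounded universal quantifier. -/
def allBelow (p : ℕ → Bool) (n : ℕ) : Bool :=
  @Nat.rec (fun _ => Bool) true (fun m ih => cond (p m) ih false) n

/-- The table `F` admits no symmetries other than `±I` in each position. -/
def rigid (n F : ℕ) : Bool :=
  allBelow (fun i => allBelow (fun j =>
    force (fun X => force (fun Y => allDiffer X Y (cond (Nat.beq i j) slRest slAll)) (shiftw F i))
      (shiftw F j)) n) n

/-- No position of the table `F` matches position `0` of the table `F'`. -/
def distinct (n F F' : ℕ) : Bool :=
  allBelow (fun j => force (fun X => allDiffer X F' slAll) (shiftw F j)) n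

/-- The table `F` is distinct from all tables in a list. -/
def allDistinct (n F : ℕ) (l : List ℕ) : Bool :=
  @List.rec ℕ (fun _ => Bool) true (fun F' _ ih => cond (distinct n F F') ih false) l

/-- Every table in a list is rigid, and they are pairwise distinct. -/
def allRigid (n : ℕ) (l : List ℕ) : Bool :=
  @List.rec ℕ (fun _ => Bool) true
    (fun F l ih => cond (rigid n F) (cond (allDistinct n F l) ih false) false) l

/-- A function applied to the list of the tables of the members of a list. -/
def withTables {α : Type} (n : ℕ) (R : List (List ℕ)) : (List ℕ → α) → α :=
  @List.rec (List ℕ) (fun _ => (List ℕ → α) → α) (fun k => k [])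
    (fun G _ ih k => force (fun F => ih fun l => k (F :: l)) (tablew n G)) R

/-- The number of words of weight less than `d`. -/
def countw (n d : ℕ) (G : List ℕ) : ℕ :=
  force (fun o => sumw o (fun S => cond (Nat.ble d (wtw o S)) 0 1) (genw G 8) 0) (ones n)

/-! ### Correctness of the arithmetic of packed codewords. -/

theorem force_eq {α : Type} (f : ℕ → α) (x : ℕ) : force f x = f x := by cases x <;> rfl

/-- The digit that encodes the element `a + b ω`. -/
def lab (a b : ZMod 3) : ℕ := a.val + 8 * b.val

theorem lab_lt : ∀ a b : ZMod 3, lab a b < 19 := by decide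

theorem lab_inj : ∀ a b c d : ZMod 3, lab a b = lab c d ↔ a = c ∧ b = d := by decide

/-- Adding `9 = 1 + 8` raises both partial sums by 1, so the bits of weight 4 and 32, selected by
the mask 36, are set exactly when the sum of the coordinates `a`, respectively `b`, is at least 3.
Divided by 4, the bits become 1 and 8, and three times this is what has to be subtracted. -/
theorem lab_add : ∀ a b c d : ZMod 3,
    lab a b + lab c d = lab (a + c) (b + d) + 3 * (Nat.land (lab a b + lab c d + 9) 36 / 4) ∧
      Nat.land (lab a b + lab c d + 9) 36 = 4 * (Nat.land (lab a b + lab c d + 9) 36 / 4) := by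
  decide

/-- A label is at most 18, so adding 31 sets the bit of weight 32 exactly for nonzero labels. -/
theorem lab_add_land : ∀ a b : ZMod 3,
    Nat.land (lab a b + 31) 32 = 32 * (if lab a b = 0 then 0 else 1) := by decide

/-- The number that encodes an entry of a vector. -/
def lane (u : Fin n → GF9) (i : Fin n) : ℕ := lab (ca u i) (cb u i)

theorem lane_lt (u : Fin n → GF9) (i : Fin n) : lane u i < 19 := lab_lt _ _

/-- The number that encodes a vector. -/
def word (u : Fin n → GF9) : ℕ := pk (lane u)

/-- The number of nonzero entries of a vector. -/
def wt (u : Fin n → GF9) : ℕ := ∑ i, if lane u i = 0 then 0 else 1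

theorem land_eq (x y : ℕ) :
    Nat.land x y = Nat.land (x % 4096) (y % 4096) + 4096 * Nat.land (x / 4096) (y / 4096) := by
  have h1 : (x &&& y) % 2 ^ 12 = x % 2 ^ 12 &&& y % 2 ^ 12 := Nat.and_mod_two_pow
  have h2 : (x &&& y) / 2 ^ 12 = x / 2 ^ 12 &&& y / 2 ^ 12 := Nat.and_div_two_pow
  have h3 := Nat.mod_add_div (x &&& y) (2 ^ 12)
  rw [h1, h2] at h3
  exact h3.symm

theorem pk_land {z w : Fin n → ℕ} (hz : ∀ i, z i < 4096) (hw : ∀ i, w i < 4096) :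
    Nat.land (pk z) (pk w) = pk fun i => Nat.land (z i) (w i) := by
  induction n with
  | zero => simp [pk]
  | succ n ih =>
    rw [land_eq, pk_mod (hz 0), pk_mod (hw 0), pk_div (hz 0), pk_div (hw 0), pk_succ,
      ih (fun i => hz i.succ) (fun i => hw i.succ)]

/-- The base 4096 is congruent to 1, so a residue modulo 4095 adds the digits. -/
theorem pk_mod_4095 (z : Fin n → ℕ) : pk z % 4095 = (∑ i, z i) % 4095 := by
  induction n with
  | zero => rfl
  | succ n ih =>
    have := ih fun i => z i.succ
    rw [pk_succ, Fin.sum_univ_succ]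
    omega

theorem mul_ones (c n : ℕ) : c * ones n = pk fun _ : Fin n => c := by
  rw [ones_eq, ← pk_mul]
  simp

/-- All coordinates are added and reduced modulo 3 at once, since the digits stay far below 4096 and
do not interact. -/
theorem addw_word (u v : Fin n → GF9) : addw (ones n) (word u) (word v) = word (u + v) := by
  have hl := fun i => lane_lt u i
  have hl' := fun i => lane_lt v i
  rw [addw, force_eq]
  change word u + word v - 3 * (Nat.land (word u + word v + 9 * ones n) (36 * ones n) / 4) = _
  have h := fun i => lab_add (ca u i) (cb u i) (ca v i) (cb v i)
  set k : Fin n → ℕ := fun i => Nat.land (lane u i + lane v i + 9) 36 / 4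
  have h1 : word u + word v = word (u + v) + 3 * pk k := by
    rw [word, word, word, ← pk_add, ← pk_mul, ← pk_add]
    congr 1
    ext i
    rw [lane, lane, lane, (h i).1, ca_add, cb_add]
    rfl
  have h2 : Nat.land (word u + word v + 9 * ones n) (36 * ones n) = 4 * pk k := by
    rw [word, word, mul_ones, mul_ones, ← pk_add, ← pk_add,
      pk_land (fun i => by have := hl i; have := hl' i; omega) (fun _ => by norm_num), ← pk_mul]
    congr 1
    ext i
    exact (h i).2
  rw [h2, Nat.mul_div_cancel_left _ (by norm_num), h1, Nat.add_sub_cancel]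

theorem wt_le (u : Fin n → GF9) : wt u ≤ n := by
  refine (Finset.sum_le_card_nsmul _ _ 1 fun i _ => ?_).trans (by simp)
  split_ifs <;> norm_num

theorem wtw_word (hn : n ≤ 8) (u : Fin n → GF9) : wtw (ones n) (word u) = wt u := by
  change Nat.land (word u + 31 * ones n) (32 * ones n) / 32 % 4095 = _
  rw [word, mul_ones, mul_ones, ← pk_add,
    pk_land (fun i => by have := lane_lt u i; omega) (fun _ => by norm_num)]
  have h : (fun i => Nat.land (lane u i + 31) 32) =
      fun i => 32 * if lane u i = 0 then 0 else 1 := funext fun i => lab_add_land _ _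
  rw [h, pk_mul, Nat.mul_div_cancel_left _ (by norm_num), pk_mod_4095]
  exact Nat.mod_eq_of_lt ((wt_le u).trans_lt (by omega))

/-- The recursion runs through the multiples `0`, `1`, `2` of each generator by repeated addition,
so every word is reached from an earlier one by one call of `addw`. -/
theorem sumw_word {m : ℕ} (f : ℕ → ℕ) (g : Fin m → Fin n → GF9) (u : Fin n → GF9) :
    sumw (ones n) f (List.ofFn fun j => word (g j)) (word u) =
      ∑ x : Fin m → ZMod 3, f (word (u + ∑ j, x j • g j)) := by
  induction m generalizing u with
  | zero => simp [sumw]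
  | succ m ih =>
    have hs : sumw (ones n) f (List.ofFn fun j => word (g j)) (word u) =
        ∑ c : ZMod 3, sumw (ones n) f (List.ofFn fun j : Fin m => word (g j.succ))
          (word (u + c • g 0)) := by
      rw [List.ofFn_succ]
      change Nat.add (sumw (ones n) f (List.ofFn fun j : Fin m => word (g j.succ)) _)
        (force (fun Y => Nat.add (sumw (ones n) f (List.ofFn fun j : Fin m => word (g j.succ)) Y)
          (force (sumw (ones n) f (List.ofFn fun j : Fin m => word (g j.succ)))
            (addw (ones n) Y (word (g 0))))) (addw (ones n) (word u) (word (g 0)))) = _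
      rw [force_eq, force_eq, addw_word, addw_word]
      refine Eq.trans ?_ (Fin.sum_univ_three _).symm
      have h0 : u + (0 : ZMod 3) • g 0 = u := by rw [zero_smul, add_zero]
      have h1 : u + (1 : ZMod 3) • g 0 = u + g 0 := by rw [one_smul]
      have h2 : u + (2 : ZMod 3) • g 0 = u + g 0 + g 0 := by rw [two_smul, add_assoc]
      refine Eq.trans ?_ (congrArg₂ _ (congrArg₂ _ (congrArg _ (congrArg word h0.symm))
        (congrArg _ (congrArg word h1.symm))) (congrArg _ (congrArg word h2.symm)))
      exact (add_assoc _ _ _).symm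
    rw [hs, ← (Fin.consEquiv fun _ => ZMod 3).sum_comp, Fintype.sum_prod_type]
    refine Finset.sum_congr rfl fun c _ => ?_
    rw [ih]
    refine Finset.sum_congr rfl fun x _ => ?_
    rw [Fin.sum_univ_succ, ← add_assoc]
    rfl

theorem graphWord_eq_sum (Γ : Matrix (Fin n) (Fin n) (ZMod 3)) (x : Fin n → ZMod 3) :
    graphWord Γ x = ∑ j, x j • graphWord Γ (Pi.single j 1) := by
  have h := congrArg Subtype.val (map_sum (graphCodeEquiv Γ) (fun j => x j • Pi.single j (1 : ZMod 3))
    Finset.univ)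
  simp only [map_smul, AddSubmonoidClass.coe_finsetSum, SetLike.val_smul] at h
  rw [← show ∑ j, x j • Pi.single j (1 : ZMod 3) = x by
    ext i; simp [Finset.sum_apply, Pi.single_apply]]
  refine h.trans (Finset.sum_congr rfl fun j _ => ?_)
  simp [Pi.single_apply, Finset.sum_apply]
  rfl

theorem genw_ofFn {m : ℕ} (h : Fin m → ℕ) (p : ℕ) :
    genw (List.ofFn h) p = List.ofFn fun j : Fin m => h j + p * 4096 ^ (j : ℕ) := by
  induction m generalizing p with
  | zero => rfl
  | succ m ih =>
    rw [List.ofFn_succ, List.ofFn_succ]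
    change (h 0 + p) :: genw (List.ofFn fun j : Fin m => h j.succ) (4096 * p) = _
    rw [ih]
    simp only [Fin.val_zero, pow_zero, mul_one, Fin.val_succ, pow_succ]
    congr 2
    ext j
    ring

/-- The generator over the unit vector at `j` has column `j` of `Γ` as coordinates `a`, which by
symmetry is the packed row `j`. Its single coordinate `b = 1` contributes `8 · 4096 ^ j`. -/
theorem genw_enc {Γ : Matrix (Fin n) (Fin n) (ZMod 3)} (hΓ : Γ.IsSymm) :
    genw (enc Γ) 8 = List.ofFn fun j => word (graphWord Γ (Pi.single j 1)) := by
  rw [enc, genw_ofFn]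
  congr 1
  ext j
  rw [word, ← pk_ite, ← pk_mul, ← pk_add]
  congr 1
  ext i
  have h1 : Γ j i = Γ i j := hΓ.apply i j
  have h2 : ∑ k, Γ i k * (Pi.single j 1 : Fin n → ZMod 3) k = Γ i j := by simp [Pi.single_apply]
  rw [lane, lab, graphWord, ca_ofAB, cb_ofAB, h1, h2]
  by_cases h : j = i
  · rw [h, if_pos rfl, Pi.single_eq_same]; rfl
  · rw [if_neg h, Pi.single_eq_of_ne' h]; rfl

theorem sumw_enc {Γ : Matrix (Fin n) (Fin n) (ZMod 3)} (hΓ : Γ.IsSymm) (f : ℕ → ℕ) :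
    sumw (ones n) f (genw (enc Γ) 8) 0 = ∑ x, f (word (graphWord Γ x)) := by
  have h := sumw_word f (fun j => graphWord Γ (Pi.single j 1)) 0
  have h0 : word (0 : Fin n → GF9) = 0 := by simp [word, pk, lane, lab]
  rw [h0, ← genw_enc hΓ] at h
  rw [h]
  simp only [zero_add, ← graphWord_eq_sum]

section

local notation "B" => 18446744073709551616

theorem hot_pk {z : Fin n → ℕ} (hz : ∀ i, z i < 4096) :
    hot n (pk z) = ∑ i : Fin n, B ^ (19 * (i : ℕ) + z i) := by
  induction n with
  | zero => rfl
  | succ n ih =>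
    change B ^ (pk z % 4096) + B ^ 19 * hot n (pk z / 4096) = _
    rw [pk_mod (hz 0), pk_div (hz 0), ih fun i => hz i.succ, Fin.sum_univ_succ, Finset.mul_sum]
    congr 1
    · simp
    · refine Finset.sum_congr rfl fun i _ => ?_
      rw [← pow_add, Fin.val_succ]
      congr 1
      ring

theorem slot_div (F k l : ℕ) : slot (F / B ^ k) l = slot F (k + l) := by
  change F / B ^ k / B ^ l % B = F / B ^ (k + l) % B
  rw [Nat.div_div_eq_div_mul, pow_add]

theorem valw_pk {z : Fin n → ℕ} (hz : ∀ i, z i < 4096) (F : ℕ) :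
    valw n F (pk z) = ∑ i : Fin n, slot F (19 * (i : ℕ) + z i) := by
  induction n generalizing F with
  | zero => rfl
  | succ n ih =>
    change slot F (pk z % 4096) + valw n (F / B ^ 19) (pk z / 4096) = _
    rw [pk_mod (hz 0), pk_div (hz 0), ih fun i => hz i.succ, Fin.sum_univ_succ]
    congr 1
    · simp
    · refine Finset.sum_congr rfl fun i _ => ?_
      rw [slot_div, Fin.val_succ]
      congr 1
      ring

/-- If all coefficients together stay below the base, no digit overflows, and a digit of the sum
collects exactly the coefficients placed at it. -/
theorem slot_sum {κ : Type*} (s : Finset κ) (h e : κ → ℕ) (hB : ∑ k ∈ s, h k < B) (m : ℕ) :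
    slot (∑ k ∈ s, h k * B ^ e k) m = ∑ k ∈ s, if e k = m then h k else 0 := by
  set t := ∑ k ∈ s, if e k = m then h k else 0 with ht
  have ht' : t < B := lt_of_le_of_lt (Finset.sum_le_sum fun k _ => by split_ifs <;> simp) hB
  -- The sum is split into the terms below position `m`, at `m`, and above `m`.
  obtain ⟨a, q, ha, hq⟩ : ∃ a q, a < B ^ m ∧ ∑ k ∈ s, h k * B ^ e k = a + B ^ m * (t + B * q) := by
    refine ⟨∑ k ∈ s, if e k < m then h k * B ^ e k else 0,
      ∑ k ∈ s, if m < e k then h k * B ^ (e k - m - 1) else 0, ?_, ?_⟩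
    · cases m with
      | zero => simp
      | succ m =>
        refine lt_of_le_of_lt (b := (∑ k ∈ s, h k) * B ^ m) ?_ ?_
        · rw [Finset.sum_mul]
          refine Finset.sum_le_sum fun k _ => ?_
          split_ifs with hk
          · exact Nat.mul_le_mul_left _ (Nat.pow_le_pow_right (by norm_num) (by omega))
          · simp
        · rw [pow_succ, mul_comm]
          exact Nat.mul_lt_mul_of_pos_left hB (by positivity)
    · rw [ht, Finset.mul_sum, ← Finset.sum_add_distrib, Finset.mul_sum, ← Finset.sum_add_distrib]
      refine Finset.sum_congr rfl fun k _ => ?_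
      rcases lt_trichotomy (e k) m with hk | hk | hk
      · simp [hk, hk.ne, hk.le]
      · simp [hk, mul_comm]
      · obtain ⟨d, hd⟩ := Nat.exists_eq_add_of_lt hk
        rw [if_neg hk.not_gt, if_neg hk.ne', if_pos hk, hd,
          show m + d + 1 - m - 1 = d by omega]
        ring
  change (∑ k ∈ s, h k * B ^ e k) / B ^ m % B = t
  rw [hq, Nat.add_mul_div_left _ _ (by positivity), Nat.div_eq_of_lt ha, zero_add,
    Nat.add_mul_mod_self_left, Nat.mod_eq_of_lt ht']

end

/-! ### The invariants and their behaviour under equivalence. -/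

/-- The restriction of a function to the vectors of weight at most `5`. -/
def low (H : (Fin n → GF9) → ℕ) (u : Fin n → GF9) : ℕ := if wt u ≤ 5 then H u else 0

/-- The sum of `H` over the codewords whose entry at position `i` is `a + b ω`. -/
def tally (Γ : Matrix (Fin n) (Fin n) (ZMod 3)) (H : (Fin n → GF9) → ℕ) (i : Fin n)
    (a b : ZMod 3) : ℕ :=
  ∑ x, if lane (graphWord Γ x) i = lab a b then H (graphWord Γ x) else 0

/-- The sum over all positions of the weights of the codewords of low weight that agree with a
vector at that position. -/
def val (Γ : Matrix (Fin n) (Fin n) (ZMod 3)) (u : Fin n → GF9) : ℕ :=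
  ∑ i, tally Γ (low wt) i (ca u i) (cb u i)

/-- The second order invariant of a graph code. -/
def inv2 (Γ : Matrix (Fin n) (Fin n) (ZMod 3)) (i : Fin n) (a b : ZMod 3) : ℕ :=
  tally Γ (low fun u => val Γ u * val Γ u) i a b

theorem low_le {H : (Fin n → GF9) → ℕ} {c : ℕ} (hc : ∀ u, H u ≤ c) (u : Fin n → GF9) :
    low H u ≤ c := by
  rw [low]
  split_ifs
  · exact hc u
  · exact Nat.zero_le c

theorem tally_le {H : (Fin n → GF9) → ℕ} {c : ℕ} (hc : ∀ u, H u ≤ c)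
    (Γ : Matrix (Fin n) (Fin n) (ZMod 3)) (i : Fin n) (a b : ZMod 3) : tally Γ H i a b ≤ 3 ^ n * c := by
  refine (Finset.sum_le_card_nsmul _ _ c fun x _ => ?_).trans (by simp)
  split_ifs
  · exact hc _
  · exact Nat.zero_le c

theorem val_le (hn : n ≤ 8) (Γ : Matrix (Fin n) (Fin n) (ZMod 3)) (u : Fin n → GF9) :
    val Γ u ≤ 419904 := by
  have h : ∀ i, tally Γ (low wt) i (ca u i) (cb u i) ≤ 3 ^ 8 * 8 := fun i =>
    (tally_le (low_le fun u => (wt_le u).trans hn) Γ i _ _).trans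
      (Nat.mul_le_mul_right _ (Nat.pow_le_pow_right (by norm_num) hn))
  refine (Finset.sum_le_card_nsmul _ _ _ fun i _ => h i).trans ?_
  rw [Finset.card_univ, Fintype.card_fin, smul_eq_mul]
  exact Nat.mul_le_mul_right _ hn

/-- One pass over the code fills all digits of the table at once. The constant `52488 = 8 · 3⁸`
bounds the number of pairs of a codeword and a position, so `hB` excludes carries. -/
theorem slot_tallyw (hn : n ≤ 8) {Γ : Matrix (Fin n) (Fin n) (ZMod 3)} (hΓ : Γ.IsSymm) {f : ℕ → ℕ}
    {H : (Fin n → GF9) → ℕ} (hf : ∀ u, f (word u) = H u) {c : ℕ} (hc : ∀ u, H u ≤ c)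
    (hB : 52488 * c < 18446744073709551616) (i : Fin n) (a b : ZMod 3) :
    slot (tallyw n (ones n) (genw (enc Γ) 8) f) (19 * i + lab a b) = tally Γ (low H) i a b := by
  have h1 : tallyw n (ones n) (genw (enc Γ) 8) f =
      ∑ p : (Fin n → ZMod 3) × Fin n, low H (graphWord Γ p.1) *
        18446744073709551616 ^ (19 * (p.2 : ℕ) + lane (graphWord Γ p.1) p.2) := by
    rw [tallyw, sumw_enc hΓ, Fintype.sum_prod_type]
    refine Finset.sum_congr rfl fun x _ => ?_
    simp only [← Finset.mul_sum]
    rw [← hot_pk fun i => (lane_lt _ i).trans (by norm_num), wtw_word hn, low]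
    by_cases h : wt (graphWord Γ x) ≤ 5
    · rw [if_pos h, Nat.ble_eq_true_of_le h, ← hf]
      rfl
    · rw [if_neg h, zero_mul, Bool.eq_false_iff.2 fun h' => h (Nat.le_of_ble_eq_true h')]
      rfl
  rw [h1, slot_sum, Fintype.sum_prod_type]
  · refine Finset.sum_congr rfl fun x _ => ?_
    rw [Finset.sum_eq_single i]
    · simp
    -- Labels are below 19, so different positions occupy disjoint ranges of digits.
    · intro j _ hj
      have h2 := lane_lt (graphWord Γ x) j
      have h3 := lab_lt a b
      have h4 : (j : ℕ) ≠ i := fun h => hj (Fin.ext h)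
      exact if_neg (by dsimp only; omega)
    · simp
  · refine lt_of_le_of_lt ?_ hB
    refine (Finset.sum_le_card_nsmul _ _ c fun p _ => low_le hc _).trans ?_
    rw [Finset.card_univ, Fintype.card_prod, Fintype.card_fun, Fintype.card_fin, ZMod.card,
      smul_eq_mul]
    refine Nat.mul_le_mul_right _ ?_
    exact (Nat.mul_le_mul (Nat.pow_le_pow_right (by norm_num) hn) hn).trans (by norm_num)

theorem slot_tablew (hn : n ≤ 8) {Γ : Matrix (Fin n) (Fin n) (ZMod 3)} (hΓ : Γ.IsSymm) (i : Fin n)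
    (a b : ZMod 3) : slot (tablew n (enc Γ)) (19 * i + lab a b) = inv2 Γ i a b := by
  rw [tablew, force_eq, force_eq]
  -- The values of `val` are at most `8 · 3⁸ · 8 = 419904`, and their squares are being summed.
  refine slot_tallyw hn hΓ (c := 419904 * 419904) (fun u => ?_)
    (fun u => Nat.mul_le_mul (val_le hn Γ u) (val_le hn Γ u)) (by norm_num) i a b
  have h : valw n (tallyw n (ones n) (genw (enc Γ) 8) (wtw (ones n))) (word u) = val Γ u := by
    rw [word, valw_pk fun i => (lane_lt u i).trans (by norm_num)]
    exact Finset.sum_congr rfl fun i _ =>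
      slot_tallyw hn hΓ (wtw_word hn) (fun u => (wt_le u).trans hn) (by norm_num) i _ _
  rw [force_eq, h]
  rfl

theorem slot_shiftw (F i l : ℕ) : slot (shiftw F i) l = slot F (19 * i + l) := slot_div _ _ _

/-- Codewords are parametrized by their coordinates `b`, so a transformation between graph codes
becomes a bijection of the parameters, along which sums over codewords can be reindexed. -/
theorem exists_equiv_graphWord {Γ Γ' : Matrix (Fin n) (Fin n) (ZMod 3)} {T : LinAut n}
    (h : (graphCode Γ).map T.toLinearMap = graphCode Γ') :
    ∃ e : (Fin n → ZMod 3) ≃ (Fin n → ZMod 3), ∀ x, graphWord Γ' (e x) = T (graphWord Γ x) := by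
  have hm : ∀ x, graphWord Γ' (cb (T (graphWord Γ x))) = T (graphWord Γ x) := fun x =>
    eq_graphWord (h ▸ ⟨_, graphWord_mem Γ x, rfl⟩)
  refine ⟨Equiv.ofBijective (fun x => cb (T (graphWord Γ x)))
    (Finite.injective_iff_bijective.1 fun x y hxy => ?_), hm⟩
  have h1 : T (graphWord Γ x) = T (graphWord Γ y) := by rw [← hm x, ← hm y]; exact congrArg _ hxy
  have h2 := congrArg cb (T.injective h1)
  ext i
  simpa [graphWord] using congrFun h2 i

theorem lab_symp (M : SL) (a b c d : ZMod 3) :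
    lab (M 0 0 * a + M 0 1 * b) (M 1 0 * a + M 1 1 * b) =
      lab (M 0 0 * c + M 0 1 * d) (M 1 0 * c + M 1 1 * d) ↔ lab a b = lab c d := by
  rw [lab_inj, lab_inj]
  have hd := det_eq M
  constructor
  · rintro ⟨h1, h2⟩
    exact ⟨by linear_combination M 1 1 * h1 - M 0 1 * h2 - (a - c) * hd,
      by linear_combination M 0 0 * h2 - M 1 0 * h1 - (b - d) * hd⟩
  · rintro ⟨rfl, rfl⟩
    exact ⟨rfl, rfl⟩

theorem lane_wreath_eq_zero (A : Fin n → SL) (σ : Equiv.Perm (Fin n)) (u : Fin n → GF9) (i : Fin n) :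
    lane (wreath A σ u) i = 0 ↔ lane u (σ i) = 0 := by
  have h := lab_symp (A i) (ca u (σ i)) (cb u (σ i)) 0 0
  simp only [mul_zero, add_zero] at h
  rw [lane, lane, ca_wreath, cb_wreath]
  exact h

theorem wt_wreath (A : Fin n → SL) (σ : Equiv.Perm (Fin n)) (u : Fin n → GF9) :
    wt (wreath A σ u) = wt u := by
  rw [wt, wt, ← Equiv.sum_comp σ fun i => if lane u i = 0 then 0 else 1]
  simp only [lane_wreath_eq_zero]

theorem low_wreath {H H' : (Fin n → GF9) → ℕ} {A : Fin n → SL} {σ : Equiv.Perm (Fin n)}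
    (h : ∀ u, H' (wreath A σ u) = H u) (u : Fin n → GF9) : low H' (wreath A σ u) = low H u := by
  rw [low, low, wt_wreath, h]

/-- Position `i` of an image word comes from position `σ i`, and `A i` permutes the elements of
`GF(9)` there. Hence any function on words that is preserved by the transformation has its tally
carried along; this applies to the weight and then to functions derived from its tally. -/
theorem tally_wreath {Γ Γ' : Matrix (Fin n) (Fin n) (ZMod 3)} {A : Fin n → SL}
    {σ : Equiv.Perm (Fin n)} (hT : (graphCode Γ).map (wreath A σ).toLinearMap = graphCode Γ')
    {H H' : (Fin n → GF9) → ℕ} (hH : ∀ u, H' (wreath A σ u) = H u) (i : Fin n) (a b : ZMod 3) :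
    tally Γ' H' i (A i 0 0 * a + A i 0 1 * b) (A i 1 0 * a + A i 1 1 * b) =
      tally Γ H (σ i) a b := by
  obtain ⟨e, he⟩ := exists_equiv_graphWord hT
  rw [tally, tally, ← e.sum_comp]
  refine Finset.sum_congr rfl fun x _ => ?_
  rw [he, hH, lane, ca_wreath, cb_wreath]
  simp only [lab_symp]
  rfl

theorem val_wreath {Γ Γ' : Matrix (Fin n) (Fin n) (ZMod 3)} {A : Fin n → SL}
    {σ : Equiv.Perm (Fin n)} (hT : (graphCode Γ).map (wreath A σ).toLinearMap = graphCode Γ')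
    (u : Fin n → GF9) : val Γ' (wreath A σ u) = val Γ u := by
  rw [val, val, ← Equiv.sum_comp σ fun i => tally Γ (low wt) i (ca u i) (cb u i)]
  refine Finset.sum_congr rfl fun i _ => ?_
  rw [ca_wreath, cb_wreath, tally_wreath hT (low_wreath (wt_wreath A σ))]

/-- Weights are invariant, hence so is `val`, which adds up their tallies; therefore the tally of
its square obeys the same rule. -/
theorem inv2_wreath {Γ Γ' : Matrix (Fin n) (Fin n) (ZMod 3)} {A : Fin n → SL}
    {σ : Equiv.Perm (Fin n)} (hT : (graphCode Γ).map (wreath A σ).toLinearMap = graphCode Γ')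
    (i : Fin n) (a b : ZMod 3) :
    inv2 Γ' i (A i 0 0 * a + A i 0 1 * b) (A i 1 0 * a + A i 1 1 * b) = inv2 Γ (σ i) a b :=
  tally_wreath hT (low_wreath fun u => by rw [val_wreath hT]) i a b

theorem exists_of_differ {F F' : ℕ} {l : List (ℕ × ℕ)} (h : differ F F' l = true) :
    ∃ p ∈ l, slot F p.1 ≠ slot F' p.2 := by
  induction l with
  | nil => cases h
  | cons p l ih =>
    by_cases hp : slot F p.1 = slot F' p.2
    · have h' : cond (Nat.beq (slot F p.1) (slot F' p.2)) (differ F F' l) true = true := h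
      rw [hp, Nat.beq_refl, cond_true] at h'
      obtain ⟨q, hq, hq'⟩ := ih h'
      exact ⟨q, List.mem_cons_of_mem _ hq, hq'⟩
    · exact ⟨p, List.mem_cons_self, hp⟩

theorem differ_of_allDiffer {F F' : ℕ} {L : List (List (ℕ × ℕ))} (h : allDiffer F F' L = true)
    {l : List (ℕ × ℕ)} (hl : l ∈ L) : differ F F' l = true := by
  induction L with
  | nil => cases hl
  | cons l' L ih =>
    have h' : cond (differ F F' l') (allDiffer F F' L) false = true := h
    rw [cond_false_eq_true] at h'
    rcases List.mem_cons.1 hl with rfl | hl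
    · exact h'.1
    · exact ih h'.2 hl

theorem of_allBelow {p : ℕ → Bool} {m : ℕ} (h : allBelow p m = true) {i : ℕ} (hi : i < m) :
    p i = true := by
  induction m with
  | zero => cases hi
  | succ m ih =>
    have h' : cond (p m) (allBelow p m) false = true := h
    rw [cond_false_eq_true] at h'
    rcases Nat.lt_succ_iff_lt_or_eq.1 hi with hi | rfl
    · exact ih h'.2 hi
    · exact h'.1

/-! ### Rigidity and inequivalence from the tables. -/

/-- The action of a matrix on some of the lanes, given by its entries. -/
def lanePairs (p q r s : ZMod 3) : List (ℕ × ℕ) :=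
  [(0, 0), (1, 0), (0, 1), (1, 1), (2, 1)].map fun c : ZMod 3 × ZMod 3 =>
    (lab c.1 c.2, lab (p * c.1 + q * c.2) (r * c.1 + s * c.2))

/-- The lists `slAll` and `slRest` are complete: the first accounts for all 24 elements of `SL₂(3)`,
the second for those other than `±I`. The five test points are `0` and one vector from each of the
four pairs `± x`. -/
theorem lanePairs_mem : ∀ p q r s : ZMod 3, p * s - q * r = 1 →
    lanePairs p q r s ∈ slAll ∧ (lanePairs p q r s ∈ slRest ∨ q = 0 ∧ r = 0) := by
  decide +kernel

theorem allDiffer_eq_false {X Y : ℕ} {M : SL} {L : List (List (ℕ × ℕ))}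
    (h : ∀ a b, slot X (lab a b) =
      slot Y (lab (M 0 0 * a + M 0 1 * b) (M 1 0 * a + M 1 1 * b)))
    (hL : lanePairs (M 0 0) (M 0 1) (M 1 0) (M 1 1) ∈ L) : allDiffer X Y L ≠ true := by
  intro h'
  obtain ⟨p, hp, hp'⟩ := exists_of_differ (differ_of_allDiffer h' hL)
  obtain ⟨c, -, rfl⟩ := List.mem_map.1 hp
  exact hp' (h c.1 c.2)

theorem slot_tablew_wreath (hn : n ≤ 8) {Γ Γ' : Matrix (Fin n) (Fin n) (ZMod 3)} (hΓ : Γ.IsSymm)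
    (hΓ' : Γ'.IsSymm) {A : Fin n → SL} {σ : Equiv.Perm (Fin n)}
    (hT : (graphCode Γ).map (wreath A σ).toLinearMap = graphCode Γ') (i : Fin n) (a b : ZMod 3) :
    slot (shiftw (tablew n (enc Γ)) (σ i)) (lab a b) =
      slot (shiftw (tablew n (enc Γ')) i)
        (lab (A i 0 0 * a + A i 0 1 * b) (A i 1 0 * a + A i 1 1 * b)) := by
  rw [slot_shiftw, slot_shiftw, slot_tablew hn hΓ, slot_tablew hn hΓ', inv2_wreath hT]

/-- An equivalence takes position `0` of the target from some position of the source, and the two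
tables there would match under a matrix of determinant 1. Testing the single target position `0`
therefore suffices. -/
theorem not_codeEq_of_distinct (hn : n + 1 ≤ 8) {Γ Γ' : Matrix (Fin (n + 1)) (Fin (n + 1)) (ZMod 3)}
    (hΓ : Γ.IsSymm) (hΓ' : Γ'.IsSymm)
    (h : distinct (n + 1) (tablew (n + 1) (enc Γ)) (tablew (n + 1) (enc Γ')) = true) :
    ¬ CodeEq (graphCode Γ) (graphCode Γ') := by
  rintro ⟨T, hT, hT'⟩
  obtain ⟨A, σ, rfl⟩ := (mem_codeTransformations_iff T).1 hT
  have h1 := of_allBelow h (σ 0).isLt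
  rw [force_eq] at h1
  refine allDiffer_eq_false (M := A 0) (fun a b => ?_) (lanePairs_mem _ _ _ _ (det_eq _)).1 h1
  rw [slot_tablew_wreath hn hΓ hΓ' hT', slot_shiftw]
  simp

/-- An automorphism matches the table at `σ i` with the table at `i` through `A i`. Rigidity forbids
this for `σ i ≠ i`, and for `σ i = i` it permits only `±I`, that is, vanishing entries off the
diagonal. -/
theorem of_rigid (hn : n ≤ 8) {Γ : Matrix (Fin n) (Fin n) (ZMod 3)} (hΓ : Γ.IsSymm)
    (h : rigid n (tablew n (enc Γ)) = true) {A : Fin n → SL} {σ : Equiv.Perm (Fin n)}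
    (hT : (graphCode Γ).map (wreath A σ).toLinearMap = graphCode Γ) (i : Fin n) :
    σ i = i ∧ A i 0 1 = 0 ∧ A i 1 0 = 0 := by
  have h1 := of_allBelow (of_allBelow h i.isLt) (σ i).isLt
  rw [force_eq, force_eq] at h1
  have h2 := fun a b => slot_tablew_wreath hn hΓ hΓ hT i a b
  have h3 := lanePairs_mem _ _ _ _ (det_eq (A i))
  by_cases hi : σ i = i
  · rw [hi, Nat.beq_refl, cond_true] at h1
    rw [hi] at h2
    exact ⟨hi, h3.2.resolve_left fun h4 => allDiffer_eq_false h2 h4 h1⟩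
  · have h4 : Nat.beq i (σ i) = false :=
      Bool.eq_false_iff.2 fun h' => hi (Fin.ext (Nat.eq_of_beq_eq_true h').symm)
    rw [h4, cond_false] at h1
    exact absurd h1 (allDiffer_eq_false h2 h3.1)

theorem eq_and_eq_or_of_mul_eq_one : ∀ c d : ZMod 3, c * d = 1 → d = c ∧ (c = 1 ∨ c = -1) := by decide

/-- Rigidity leaves one sign for each vertex, and the signs agree along edges. The condition `hc`,
that every vertex but the last has a later neighbour, makes the graph connected in a form that is
easy to check. -/
theorem hasTrivialAut_of_rigid (hn : n + 1 ≤ 8) {Γ : Matrix (Fin (n + 1)) (Fin (n + 1)) (ZMod 3)}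
    (hΓ : Γ.IsSymm) (h : rigid (n + 1) (tablew (n + 1) (enc Γ)) = true)
    (hc : ∀ j, j ≠ Fin.last n → ∃ i, j < i ∧ Γ j i ≠ 0) : HasTrivialAut (graphCode Γ) := by
  rw [hasTrivialAut_iff]
  rintro ⟨T, ⟨hT, hT'⟩, h1, h2⟩
  obtain ⟨A, σ, rfl⟩ := (mem_codeTransformations_iff T).1 hT
  have hA := of_rigid hn hΓ h hT'
  have hd : ∀ i, A i 1 1 = A i 0 0 ∧ (A i 0 0 = 1 ∨ A i 0 0 = -1) := fun i => by
    have := det_eq (A i)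
    rw [(hA i).2.1, zero_mul, sub_zero] at this
    exact eq_and_eq_or_of_mul_eq_one _ _ this
  -- The image of the generator at `j` has entry `a = ± Γ i j` at `i` with the sign of `i`, while
  -- membership in the code prescribes the sign of `j`.
  have hadj : ∀ i j, Γ i j ≠ 0 → A i 0 0 = A j 0 0 := fun i j hij => by
    have hm : wreath A σ (graphWord Γ (Pi.single j 1)) ∈ graphCode Γ := by
      rw [← hT']
      exact ⟨_, graphWord_mem Γ _, rfl⟩
    have h3 := mem_graphCode.1 hm i
    simp only [ca_wreath, cb_wreath, (hA _).1, (hA _).2.1, (hA _).2.2, zero_mul, add_zero, zero_add,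
      graphWord, ca_ofAB, cb_ofAB, Pi.single_apply, mul_ite, mul_one, mul_zero,
      Finset.sum_ite_eq', Finset.mem_univ, if_true, ite_self, (hd _).1] at h3
    exact mul_right_cancel₀ hij (h3.trans (mul_comm _ _))
  -- Induction downwards from the last vertex, along later neighbours.
  have hconst : ∀ j, A j 0 0 = A (Fin.last n) 0 0 := fun j => by
    induction j using WellFoundedGT.induction with
    | _ j ih =>
      by_cases hj : j = Fin.last n
      · rw [hj]
      · obtain ⟨i, hi, hji⟩ := hc j hj
        rw [hadj j i hji, ih i hi]
  have hs : ∀ u, wreath A σ u = A (Fin.last n) 0 0 • u := fun u =>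
    vec_ext (fun i => by simp [hA i, hconst i]) (fun i => by simp [hA i, hd i, hconst i])
  rcases (hd (Fin.last n)).2 with hl | hl
  · exact h1 (LinearEquiv.ext fun u => by rw [hs, hl, one_smul]; rfl)
  · exact h2 (LinearEquiv.ext fun u => by rw [hs, hl, neg_one_smul]; rfl)

/-! ### Reading matrix entries, and the minimum distance. -/

theorem pk_digit {z : Fin n → ℕ} (hz : ∀ i, z i < 4096) (i : Fin n) :
    pk z / 4096 ^ (i : ℕ) % 4096 = z i := by
  induction n with
  | zero => exact i.elim0
  | succ n ih =>
    cases i using Fin.cases with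
    | zero => simpa using pk_mod (hz 0)
    | succ i =>
      rw [Fin.val_succ, pow_succ', ← Nat.div_div_eq_div_mul, pk_div (hz 0)]
      exact ih (fun i => hz i.succ) i

theorem nth_enc_digit (Γ : Matrix (Fin n) (Fin n) (ZMod 3)) (j i : Fin n) :
    nth 0 (enc Γ) j / 4096 ^ (i : ℕ) % 4096 = (Γ j i).val := by
  rw [enc, nth_ofFn, pk_digit fun i => (ZMod.val_lt _).trans (by norm_num)]

theorem lane_eq_zero_iff (u : Fin n → GF9) (i : Fin n) : lane u i = 0 ↔ u i = 0 := by
  rw [entry_eq_zero_iff]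
  exact lab_inj _ _ 0 0

theorem wt_eq_zero_iff {u : Fin n → GF9} : wt u = 0 ↔ u = 0 := by
  simp [wt, Finset.sum_eq_zero_iff, lane_eq_zero_iff, funext_iff]

/-- The code is closed under subtraction, so distances between codewords are weights of codewords.
-/
theorem minDist_eq_sInf (C : AdditiveCode n) :
    minDist C = sInf {d | ∃ u ∈ C, u ≠ 0 ∧ wt u = d} := by
  classical
  have hd : ∀ u v : Fin n → GF9, hammingDist u v = wt (u - v) := fun u v => by
    rw [hammingDist, Finset.card_filter, wt]
    refine Finset.sum_congr rfl fun i _ => ?_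
    simp only [lane_eq_zero_iff, Pi.sub_apply, sub_eq_zero, ite_not]
  rw [minDist]
  congr 1
  ext d
  constructor
  · rintro ⟨u, hu, v, hv, huv, h⟩
    refine ⟨u - v, sub_mem hu hv, sub_ne_zero.2 huv, ?_⟩
    rw [← hd, ← h]
  · rintro ⟨u, hu, h0, h⟩
    refine ⟨u, hu, 0, zero_mem C, h0, ?_⟩
    rw [← h, ← sub_zero u, ← hd, sub_zero]

theorem CodeEq.minDist_eq {C D : AdditiveCode n} (h : CodeEq C D) : minDist C = minDist D := by
  obtain ⟨T, hT, rfl⟩ := h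
  obtain ⟨A, σ, rfl⟩ := (mem_codeTransformations_iff T).1 hT
  rw [minDist_eq_sInf, minDist_eq_sInf]
  congr 1
  ext d
  constructor
  · rintro ⟨u, hu, h0, h⟩
    exact ⟨wreath A σ u, ⟨u, hu, rfl⟩, (LinearEquiv.map_ne_zero_iff _).2 h0,
      (wt_wreath A σ u).trans h⟩
  · rintro ⟨_, ⟨u, hu, rfl⟩, h0, h⟩
    exact ⟨u, hu, (LinearEquiv.map_ne_zero_iff _).1 h0, (wt_wreath A σ u).symm.trans h⟩

theorem countw_enc (hn : n ≤ 8) {Γ : Matrix (Fin n) (Fin n) (ZMod 3)} (hΓ : Γ.IsSymm) (d : ℕ) :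
    countw n d (enc Γ) = (Finset.univ.filter fun x => wt (graphWord Γ x) < d).card := by
  rw [countw, force_eq, sumw_enc hΓ, Finset.card_filter]
  refine Finset.sum_congr rfl fun x _ => ?_
  rw [wtw_word hn]
  by_cases h : wt (graphWord Γ x) < d
  · rw [if_pos h, Bool.eq_false_iff.2 fun h' => (Nat.le_of_ble_eq_true h').not_gt h]
    rfl
  · rw [if_neg h, Nat.ble_eq_true_of_le (not_lt.1 h)]
    rfl

theorem graphWord_zero (Γ : Matrix (Fin n) (Fin n) (ZMod 3)) : graphWord Γ 0 = 0 :=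
  vec_ext (by simp [graphWord]) (by simp [graphWord])

theorem graphWord_eq_zero_iff {Γ : Matrix (Fin n) (Fin n) (ZMod 3)} {x : Fin n → ZMod 3} :
    graphWord Γ x = 0 ↔ x = 0 := by
  refine ⟨fun h => ?_, fun h => by rw [h, graphWord_zero]⟩
  ext i
  simpa [graphWord] using congrArg (cb · i) h

/-- The first count says that only the zero word has weight below `d`, the second that another word
appears at weight `d`. -/
theorem minDist_graphCode (hn : n ≤ 8) {Γ : Matrix (Fin n) (Fin n) (ZMod 3)} (hΓ : Γ.IsSymm) {d : ℕ}
    (h1 : countw n d (enc Γ) = 1) (h2 : countw n (d + 1) (enc Γ) ≠ 1) :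
    minDist (graphCode Γ) = d := by
  rw [countw_enc hn hΓ, Finset.card_eq_one] at h1
  rw [countw_enc hn hΓ] at h2
  obtain ⟨y, hy⟩ := h1
  have hd : 0 < d := by
    have : y ∈ Finset.univ.filter fun x => wt (graphWord Γ x) < d := by simp [hy]
    exact (Nat.zero_le _).trans_lt (Finset.mem_filter.1 this).2
  have hz : ∀ x, wt (graphWord Γ x) < d → x = 0 := fun x hx => by
    have h3 : x ∈ Finset.univ.filter fun x => wt (graphWord Γ x) < d := by simpa using hx
    have h4 : (0 : Fin n → ZMod 3) ∈ Finset.univ.filter fun x => wt (graphWord Γ x) < d := by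
      simpa [graphWord_zero, wt_eq_zero_iff.2 rfl] using hd
    rw [hy, Finset.mem_singleton] at h3 h4
    rw [h3, h4]
  rw [minDist_eq_sInf]
  refine IsLeast.csInf_eq ⟨?_, ?_⟩
  -- If no word had weight `d`, the zero word would still be the only one below `d + 1`.
  · by_contra hne
    refine h2 (Finset.card_eq_one.2 ⟨0, ?_⟩)
    ext x
    rw [Finset.mem_filter, Finset.mem_singleton]
    constructor
    · rintro ⟨-, hx⟩
      by_contra h0
      refine hne ⟨graphWord Γ x, graphWord_mem Γ x, fun h => h0 (graphWord_eq_zero_iff.1 h), ?_⟩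
      exact le_antisymm (Nat.lt_succ_iff.1 hx) (not_lt.1 fun h => h0 (hz x h))
    · rintro rfl
      simp [graphWord_zero, wt_eq_zero_iff.2 rfl]
  · rintro _ ⟨u, hu, h0, rfl⟩
    rw [← eq_graphWord hu] at h0 ⊢
    exact not_lt.1 fun h => h0 (graphWord_eq_zero_iff.2 (hz _ h))

/-- The continuation passing form only ensures that each table is evaluated once before all
comparisons; its value is that of a plain `List.map`. -/
theorem withTables_eq {α : Type} (n : ℕ) (R : List (List ℕ)) (k : List ℕ → α) :
    withTables n R k = k (R.map (tablew n)) := by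
  induction R generalizing k with
  | nil => rfl
  | cons G R ih =>
    exact (force_eq (fun F => withTables n R fun l => k (F :: l)) _).trans (ih _)

theorem distinct_of_allDistinct {F : ℕ} {l : List ℕ} (h : allDistinct n F l = true) :
    ∀ F' ∈ l, distinct n F F' = true := by
  induction l with
  | nil => simp
  | cons F' l ih =>
    have h' : cond (distinct n F F') (allDistinct n F l) false = true := h
    rw [cond_false_eq_true] at h'
    exact List.forall_mem_cons.2 ⟨h'.1, ih h'.2⟩

theorem of_allRigid {l : List ℕ} (h : allRigid n l = true) :
    (∀ F ∈ l, rigid n F = true) ∧ l.Pairwise fun F F' => distinct n F F' = true := by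
  induction l with
  | nil => simp
  | cons F l ih =>
    have h' : cond (rigid n F) (cond (allDistinct n F l) (allRigid n l) false) false = true := h
    rw [cond_false_eq_true, cond_false_eq_true] at h'
    have := ih h'.2.2
    exact ⟨List.forall_mem_cons.2 ⟨h'.1, this.1⟩,
      List.pairwise_cons.2 ⟨distinct_of_allDistinct h'.2.1, this.2⟩⟩

/-! ### Lists of representatives and their certificates. -/

set_option maxRecDepth 100000

/-- The matrix with no rows. -/
def reps0 : List (List ℕ) := [[]]

/-- Representatives of the self-dual codes of length 1. -/
def reps1 : List (List ℕ) := List.map (extCode 0 reps0)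
  [0]

/-- Representatives of the self-dual codes of length 2. -/
def reps2 : List (List ℕ) := List.map (extCode 1 reps1)
  [1, 0]

/-- Representatives of the self-dual codes of length 3. -/
def reps3 : List (List ℕ) := List.map (extCode 2 reps2)
  [3, 0, 9]

/-- Representatives of the self-dual codes of length 4. -/
def reps4 : List (List ℕ) := List.map (extCode 3 reps3)
  [7, 3, 9, 0, 28, 27, 54]

/-- Representatives of the self-dual codes of length 5. -/
def reps5 : List (List ℕ) := List.map (extCode 4 reps4)
  [9, 36, 84, 108, 189, 0, 81, 162, 244, 243, 324, 405, 486]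

/-- Representatives of the self-dual codes of length 6. -/
def reps6 : List (List ℕ) := List.map (extCode 5 reps5)
  [1, 82, 10, 166, 175, 174, 9, 27, 108, 81, 418, 333, 489, 522, 603, 684, 513, 567, 756, 810,
  1053, 0, 243, 486, 729, 972, 1216, 1215, 1459, 1458, 1702, 1701, 1947, 1944, 2187, 2431, 2430,
  2673, 2916]

/-- Representatives of the self-dual codes of length 7. -/
def reps7 : List (List ℕ) := List.map (extCode 6 reps6)
  [1, 244, 163, 406, 28, 496, 523, 3, 246, 327, 408, 30, 498, 525, 264, 291, 522, 27, 81, 324,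
  243, 769, 931, 1417, 1282, 778, 1426, 772, 921, 741, 849, 750, 939, 999, 1242, 1053, 972, 1515,
  1539, 2997, 3646, 3978, 4077, 3726, 3888, 4482, 4455, 4698, 4617, 5184, 5427, 5346, 5841, 6084,
  6165, 6840, 8751, 8775, 8856, 9099, 9342, 8991, 9721, 9558, 10287, 11016, 11691, 11745, 11907,
  12636, 13365, 14094, 14823, 0, 729, 1458, 2187, 2916, 3645, 4374, 5103, 5832, 6561, 7290, 8019,
  8748, 9477, 10206, 10935, 11664, 12393, 13122, 13851, 14580, 15310, 15309, 16039, 16038, 16768,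
  16767, 17497, 17496, 18226, 18225, 18957, 18954, 19683, 20415, 20412, 21141, 21873, 21870,
  22599, 23328, 24058, 24057, 24786, 25515, 26244, 26973, 27702]

/-- Representatives of the self-dual codes of length 8 with trivial automorphism group. -/
def reps8 : List (List ℕ) := List.map (extCode 7 reps7)
  [973, 1216, 2278, 3736, 2764, 2359, 3817, 2602, 2305, 3763, 3520, 4249, 3115, 3178, 3097, 3583,
  2395, 3124, 3853, 3367, 4096, 4339, 3151, 3880, 3394, 3010, 3739, 2362, 2308, 3856, 4099, 2608,
  3243, 3972, 3567]

/-- The data consist of one pair for each representative. Its first member lists nontrivial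
automorphisms, in base 648; its second member lists certificates `128 t + k` for the vectors that
survive the sieve, in the order in which `cover` returns them. -/
theorem exists_checkReps0 : ∃ ds, checkReps false 0 reps1 reps0 ds = true :=
  ⟨
  -- Here `3585 = 128 · 28 + 1`: the digit `28 = 27 + 1` is the identity matrix at position `0`, and
  -- the residue 1 points to the first code in `reps1`.
  [([], [3585])],
    by decide +kernel⟩

theorem exists_checkReps1 : ∃ ds, checkReps false 1 reps2 reps1 ds = true :=
  ⟨
  -- The digit `34 = 27 + 3 · 2 + 1` is the matrix with rows `(1, 0)` and `(2, 1)`, which fixes the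
  -- code generated by `ω` pointwise. Both certificates contain the identity of length 2, with
  -- digits `28` and `81 + 28`.
  [([34], [9044481, 9044482])],
    by decide +kernel⟩

theorem exists_checkReps2 : ∃ ds, checkReps false 2 reps3 reps2 ds = true :=
  ⟨
  [([24088], [10221109761, 10221109762]), ([20203], [9524711041, 9522387841, 9515100802,
  10221109763])],
    by decide +kernel⟩

theorem exists_checkReps3 : ∃ ds, checkReps false 3 reps4 reps3 ds = true :=
  ⟨
  [([65527233, 83633500], [9448749318657, 9448749318658, 9448749318659, 9448749318660]),
  ([49673767], [9448749318661, 9444026236802, 9443703751298, 9654127536770, 9448742610564,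
  9448749318662]), ([47051473, 79800019], [8997485850243, 8995978591107, 8997476240004,
  8995970806404, 8986901958278, 9448749318663])],
    by decide +kernel⟩

theorem exists_checkReps4 : ∃ ds, checkReps false 4 reps5 reps4 ds = true :=
  ⟨
  [([61001595979, 74642217367, 9373646047, 29772471674], [7953694248714753, 7953694248714754,
  6760364380548609, 7953694248714758]), ([76271015263, 5827962421, 35120938570],
  [8154485328930562, 8358545612236674, 7953694248714755, 7953694242006657, 712223416954499,
  1344466997820547, 7953694248714756, 7953694248714759]), ([57188993143, 42529577084,
  13109110242], [482951159225987, 6760364373840513, 6895779100586625, 7953694242006660,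
  8156918641642116, 7953694248714757, 7953694248714760]), ([49841093695, 27835184764,
  27862856959], [7953694248714761, 7947812575066884, 7947603604460292, 6128431415508867,
  6128431093023363, 6264472733082243, 7654416782950273, 7659845341106822, 7953694242006663,
  7953694242006664, 7953694248714762]), ([56712678232, 62429695802, 34570885066],
  [644198491943555, 1276128616153219, 7953685547235081, 7953694248714763]), ([62429717764,
  54262536448], [3999464292691977, 4142370423612292, 4006958652991108, 3998488771719177,
  4006957148054404, 4142371928548996, 7660054312708747, 7950633684963975, 7950424714357383,
  7657028907747975, 7953685548314250, 7953694248714764]), ([51711775171, 31407684586],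
  [7661275524083333, 7660298818337669, 7661274016824197, 7661275514473096, 7660298810552968,
  7660300315986568, 7661264940191370, 7660289419218570, 7651596049288844, 7953694248714765])],
    by decide +kernel⟩

theorem exists_checkReps5 : ∃ ds, checkReps false 5 reps6 reps5 ds = true :=
  ⟨
  [([62597523159194, 62150715909062, 25225251710160, 63201054076663, 24237253288496],
  [6340420112437789185, 6340420112437789186, 6341048979804700674, 6340420112437789187,
  6340420112437789188, 6340420112437789189, 6142829121072616577, 6340420112437789190,
  6340420112437789191, 6340420112437789192, 6340420112437789193, 6340420112437789194,
  6340420112437789206]), ([22807123182912, 2740668542040, 3094067444002, 40805188861366,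
  3784129614699], [6340420112437789195, 3471898747054792454, 6600845018767092354,
  2009841503696761861, 6340420112437789196, 2788466608624616450, 6178560220313893250,
  6340420112431081097, 1690199078447670147, 5157651017017788041, 6340420112437789207]),
  ([62140688979295, 62121057157266, 62099527565193, 62140685200156], [3968210864382052994,
  5289588195376069388, 2682281248512456578, 6340420112437789197, 6336605979851321357,
  5157650027273826945, 3458582548676387593, 5359573567966978441, 5607365986780003974,
  6340420112437789198, 6340420112437789199, 6340420112437789200, 6340420103737388679,
  4644375343048727690, 6340420112437789201, 6464797215228588813, 6597050849195065613,
  6340420112437789202, 6340420112437789208]), ([32294210466147, 63727560782812, 3737888578349,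
  65311986223687, 63725110641031], [4382541372378955521, 4052302495624226691,
  5157650040314365585, 5157650027273826952, 4178003992972418825, 6340420112431081106,
  3773642714736901773, 5567142349159022858, 6340420112437789203, 463351678876749457,
  873045519277948561, 6340420112437789204, 6340420112437789209]), ([22798644872165,
  65268756739468, 65312801257351, 41863076090395], [5563334094912769671, 4380566839552396935,
  316901450788987537, 5567142349165727368, 6340420103737388692, 6340420112437789205,
  6340420112437789210]), ([52767710451319, 62672099746210, 45582681358042, 56818525955431,
  40097023970362, 21566357391772], [6340420112437789211, 5567142357865545601,
  5567142357865048705, 5822781182472318086, 6466264645627627142, 5822916595747378310,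
  5237800594055770886, 6340420112431081111, 5567142357859419798, 6340420112437789212]),
  ([63727560782815, 22843534812007, 32345223250420, 63725111900740], [6340420112437789213,
  6340414226410587026, 6340414017439980434, 2276806265147975568, 2145388656419857807,
  1735694816018659088, 6338594849604583309, 6148307725888975629, 1412555657287627402,
  5282413390179327113, 6470532732410924695, 6340420112431081112, 6340420103737388694,
  463351678876749464, 873045519277948568, 6340420112431081113, 6340420112437789214]),
  ([46600970768884, 41880252221959, 63726709271938, 27559269298687, 32341141783540],
  [6340420112437789215, 6334780704340392724, 6334645291387321108, 5157646975403768593,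
  5157646766433162001, 2011240772057883278, 5157646767952093831, 5245801750710248071,
  5201725669886124679, 314783255868673688, 5567142349165727382, 5654891092097207958,
  6340420103737388697, 6340420112431081114, 6340420112437789216]), ([56123032949464,
  41863204010692, 63725111843784, 63725926946074], [6340420112437789217, 419268706353052561,
  828759426840914833, 5148518103210521229, 5149150033334730893, 3963922768636835469,
  6143622064122331277, 6142990138344967809, 6150006015953213211, 6340420103736309533,
  6340420103736309535, 6340420112437789218]), ([56123032947523, 32341142619466, 37119423813154,
  62139870168439], [6340420111741390497, 6336608788612686739, 6336473376842065555,
  5152016275142189969, 5151880863371568785, 6146488314623482760, 6340420111739067297,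
  6336473375337128851, 5151880861866632081, 5152016276647126673, 6146352901347924872,
  6340420111731780258, 6336608783560413849, 6336473370607342233, 5157649796513665688,
  5157649587543059096, 3973054466286826136, 6146488314615698070, 6150006015954292380,
  6340420103737388702, 6340420103737388704, 6340420112437789219]), ([49466106339364,
  49466101730140, 36705829039234], [6340420112437789220, 6334780704339313565,
  6334645291386241949, 6423003080601076637, 1501494425728286610, 1413747598367584914,
  1501495400929095570, 1413746623166775954, 419271527469657752, 828762247957520024,
  6340411652769059490, 6340420112437789221]), ([49466066508751, 64440999881323, 65313584850706,
  51053789827036], [3778080298494057631, 3870682273772469140, 3782935446411767444,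
  3777447394353814687, 3782934471210957716, 3870683248973278868, 3778076279825128098,
  3870682273764684441, 3782935446402157209, 3777444142234753698, 3782934471203173017,
  4572732401378284185, 6150141429552336549, 6338436862773726878, 6338301449820655262,
  6340411653468360355, 6340420112437789222]), ([33508414173067, 20374253650111, 62117862997852,
  47791029985990], [6150932778879528597, 6150299873554512789, 6150931802173782933,
  6150932778869918362, 6150299873546728090, 6150300850250648218, 6150931802165998234,
  6150932768295636640, 6150299864155393696, 6150300839676366496, 6150923099404734115,
  6150290961814359715, 6142832399989771942, 6340420112437789223])],
    by decide +kernel⟩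

/-- All extensions of the 39 codes of length 6 are matched with the 121 codes in `reps7`. As `b` is
false, no extension may be discarded for having automorphisms. -/
theorem exists_checkReps6 : ∃ ds, checkReps false 6 reps7 reps6 ds = true :=
  ⟨
  [([49883811576515414, 24974695125168222, 50228155958283102, 30457176921475588,
  49539445154730059, 49880475629785032, 25661819054562176], [4877396435907059958273,
  4877396435907059958274, 4877803941960818606082, 4877803941954265197058, 4877396435902335803394,
  4877396435907059958275, 4877396435907059958276, 4877803941960818606084, 4877396435907059958277,
  4877396435907059958278, 4877396435907059958279, 3238046746522288767495, 4877396435907059958280,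
  4877396435907059958281, 4905827130272763474561, 4877396435907059958282, 4934257215288772653185,
  4877396435907059958283, 4877396435907059958284, 4877396435907059958285, 4877396435907059958286,
  4877396435907059958287, 4877396435907059958288, 4748172878167847718017, 4877396435907059958289,
  4877396435907059958290, 4877396435907059958291, 4877396435907059958292, 4877396435907059958293,
  4877396435907059958346]), ([11692560582364371, 2447232395399916, 49534486070506887,
  40294148570451469], [4877396435907059958294, 4477753013759098005270, 4877396435907059958295,
  4877396435907059958296, 4877396435907059958297, 4877396435907059958298, 2570799207716143841814,
  4877396435907059958299, 4877396435907059958300, 3282011591814649592455, 2758610443096349298564,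
  4877396435907059958301, 1331409014887593768583, 4876213669731867354013, 3014524947620896679940,
  4877396435907059958302, 4474835954003579799709, 4232390806644691420573, 4477749767749812349978,
  4877396435907059958303, 4401935662191481116822, 3400464870381572540701, 5006724193541114122139,
  4230973764967372821020, 4139520128024024107165, 4345882846091594799641, 3228696693422803749142,
  4877396435907059958304, 2601923076951198169754, 2867681289921340344988, 2658944843689452100758,
  4877396435907059958305, 1228886746556100373793, 4877655859087272109834, 5045741738556109650818,
  4877524237386761205508, 405680737728907527815, 4376309580489581960066, 4877524237383375345035,
  4877392615682382867842, 4376572823896837006852, 2745117254767980295431, 4877396435907059958306,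
  4877396435907059958307, 2573360962685302213637, 4274480227897252819714, 4189599662619693142786,
  4110957608943813532041, 4962683479769287146370, 5048382166781500715394, 4877396435907059958308,
  4963358049451738839844, 4877396435907059958309, 4877396435907059958347]), ([25672032242198996,
  49855972471182458, 50221651161654532, 39496849220193872, 22461045727277406, 49880475629841988,
  49883804229365796, 25303159679643669], [1679534003084954855833, 4049908771361008770055,
  5048183039357406385307, 1472287847815125372825, 4877396435907053250188, 4874927335424023504797,
  4876619214101630519173, 2765299219832783663905, 2573771368123902159109, 4877396435907059958310,
  4369013729003355918594, 3601483068073556495490, 3607915771560017887108, 4877396435907059958311,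
  4544522117986975974308, 2599875208104103502864, 4877396435907059958348]), ([45519141994894300,
  51596587975227151, 50226588103932444, 34165985006278477, 23332813531293401, 8622474876605726,
  30230422863443166, 50166110560505811, 49828285096574510, 22462682049496092],
  [4877392612858385908894, 4748172878167847718019, 3272161906351082353053,
  4873734798702755295517, 3778542228426016051359, 3427902009402130311327, 5007265770208236478751,
  3997604371914349285126, 3987585888388535643014, 2451239785329854831646, 1681358073286389631261,
  1739212086274520931741, 3985801683081849221389, 4877396435907059958349]), ([21773755274958771,
  1879133802706389, 49832159226119560, 50162910444676009, 25615968671427005, 2440187193793547,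
  50223238035979438, 22059439651473072, 29613769634921041, 49823326685788408, 29504282652019864,
  12837387721075791, 22457745107218198], [4904634523982852536358, 4477749767749819058074,
  4477753172123934957849, 5044331454253307567382, 4878065820197974024086, 4192908461515925132955,
  4761674366899918623383, 3636959330323598965144, 4429988399403368752796, 3601483068073556495492,
  1804368878209357538311, 2701225411103957448068, 981668061561644122375, 2962999596384541000734,
  5009891953856319161118, 2896880007359380150813, 4877396435907059958312, 3234649720708669363101,
  1682467876225816660001, 4052138122441547657486, 4877396435907059958350]), ([29614842243364429,
  23835210869101434, 49536119002745116, 33886473263967895, 32009493674027915, 5505979211545525,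
  9091454046742871], [4877396435907059958313, 3665549015765523969674, 2602973402180247100200,
  2867540045739480496908, 3005816561659158971147, 4877396435907053250183, 1095581210581537131655,
  4754883255031641703327, 4877396435907053250193, 5045741741377212839810, 4111222833230903547524,
  4960152393327431995030, 3826846046784854960022, 4374349876755315536644, 2450574140126450607638,
  4403043814524360469254, 5007906795907396054166, 2459629760409427888144, 3601400796043818097812,
  4877396435907059958314, 2450837382663266089739, 3513408865903826670634, 4903276433315040487818,
  981631780310757756174, 4877396435907059958315, 4877396435907059958316, 4875694791741614245769,
  4960450877287924286857, 4877396435907059958317, 4877396435907059958351]), ([21734965012681399,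
  50161727075517904, 22118220195796988, 49480885067506539, 22068206172879223, 50166414776277413,
  49828410546750052, 50180689288098331, 49476131791177444], [4874837762326054756229,
  4110962062070545657504, 4874920918588720901765, 4874837762361044516997, 2506825572576682422942,
  4754093118568761426846, 2762712857499904920222, 4877396435907053250194, 3336133711736555159205,
  4376305000611036101513, 3336148336997229221541, 4546886775809112767369, 4461595888210074434441,
  2839251219533955135655, 4376392794492209831561, 2839250813295579733159, 4546974499162538811017,
  2839251016416944341159, 4461683614384610385545, 4376348898962903514377, 4546930603633232493833,
  4461639783740831939849, 4110959589820475800461, 4052136294362346687656, 4369106320859092377877,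
  4194293417739561016109, 4877396435907059958318, 4877396435907059958319, 4877396435907059958320,
  4877396435907059958321, 4877396435907059958352]), ([49841671247208922, 49541032029051062,
  25605396856417235, 50228155958366003, 49537705877070004, 29719568603151917],
  [4877396435908564311939, 148487905074017370373, 2895979767650477690534, 4877396435907053250195,
  4110962062070545657509, 4376312450937430289573, 4877396435907053250215, 4196296935788348229285,
  4751053931017103350669, 4877396435907053250216, 3238046746522282059432, 4873740277457620342913,
  4933068603690481617804, 4748172878167847718024, 4877396435907053250220, 4877396435907053250223,
  4877396435907059958322, 4877396435907059958323, 4877396435907059958324,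
  4877396435907059958353]), ([2469593681684124, 33046249097667292, 49536119002745116,
  49490452286265268, 24011537576266843], [3783023853314288308875, 3006104833606140952458,
  3631205799683547239054, 2528529079695143756432, 983668429652817440907, 1229866837905584237712,
  926851995431530231050, 4878064000370265627435, 3475237602093987925162, 5043532343457167164299,
  3601488543846379605649, 4958151703361419404042, 1171982125271962463146, 2919760975198981658004,
  3724870968462237362068, 2698145237580483149483, 3514286203166093945998, 2659340448138071567883,
  3785876055057148080138, 2746392091781822510350, 2660100600924259771051, 4006978150210857044743,
  4006847747191666284678, 3823036227520200430745, 4162928554213705815323, 4877396435907053250196,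
  4877396435907053250212, 4194289009844511852964, 2516860738154568249756, 3662364155447824522778,
  2574670904125743143938, 4278982007087315192194, 1681358073286382923165, 3513001438458316512900,
  2194183865515570847393, 4373940824262677046434, 1684911850773618339458, 4372653722679159849891,
  2964269333598319368093, 4877396435907059958325, 4877396435907059958326, 3601400796043818094220,
  4108998145748938303269, 4877396435907059958327, 970506101287459464073, 5048107847235203787191,
  4107214008450612123429, 971822948025960022793, 4194420631553141633829, 4544446403818724945197,
  5046150958379373621257, 4278585466869772931877, 4962101359383899279753, 3579482015165974717736,
  3692804457263292284343, 4540238304565220868389, 4274480227897252819749, 2508340766746641385143,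
  4877396435907053250227, 1067741488679295639335, 3513155953957838731952,
  4877396435907059958354]), ([44523181106369348, 51592708125280546, 5551288922716909,
  50517665015269351, 42353911441636675, 50562826689687943], [4877396435907053250178,
  4876619214023858180893, 4876663134944121622433, 4877396435907053250197, 4877396435907053250213,
  2599875208104110210960, 1994449408932281518731, 1995634048778190853386, 2574539282443473118217,
  3985801680260746032397, 2603234032635395893386, 3238453646088152863499, 4052136294362334344462,
  215370522032480856757, 4877396435907059958328, 4877396435907053250221, 4461596049731697478957,
  3476150820929301046569, 168763140258844259126, 4877396435907053250225, 3343343656159274499381,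
  3608696502420354690358, 3212940079385722331410, 4454539663024237363477, 4189599662619693142805,
  3513155951136735542960, 4376312450940263169332, 4877396435907059958355]), ([9093207182190628,
  35486042025723776, 34223178499421293, 23356878428203123, 52371341351568425, 48058143977317010,
  7686362286333131, 45612425689119453, 2479254537776079, 44478791029487838, 23328912364826100,
  36864516399722260, 16956557037295283], [4935003908052208108577, 5048018228020255607713,
  4542360904663479861019, 4877307893528931075734, 5065657828176309181465, 2173991046331907127702,
  1703707260371556152217, 5114764442806419451158, 4232390332768373776666, 5044923153447236333211,
  4773557092536192444705, 4480640842218105414428, 5010523277842693311643, 2898197990201975188267,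
  4877396435907059958356]), ([44467976769900458, 35232325784058876, 40615223327036042,
  49520272311139789, 7732566629603320, 1736689880062706, 50975090211778341, 31345987581763154,
  33086802586501180], [5000779181996270973974, 3219220568673397981601, 269316933882258449799,
  2158883472225324728711, 1977397659489897990806, 2661384466009432945695, 4960577770248438083876,
  3011924688849805970210, 2926368953576327520644, 2926633621640103525667, 3011791439357510656772,
  3512741654567142729730, 1937356167649677162017, 913154190519076805890, 1937600406051186192554,
  2176707074748883531546, 4476006745819481649948, 3779099874941901544480, 537715922843447327749,
  4281676333237908261303, 4877396435907059958357]), ([40294102309724995, 49534534577302300,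
  49534486095701123, 40294094884562058], [2157560899504886272418, 3531691690731242550051,
  4871469647457562162306, 2765260340153690672931, 4871882946161989398658, 4871882946161989398660,
  4877396435907059958329, 3343341813016740844161, 2243532510299393352468, 3475372865541586346388,
  3635944178190537842321, 2573769836426610848421, 4960581485323211997111, 4039777852188683452041,
  4192192129322364765067, 3273714826272086809898, 4050044548208293628938, 4277351371709818864010,
  4458177948979420834730, 3993096856064013623051, 5009017139334996359600, 4241807875089967886518,
  2744207265296619496109, 299480552302408039605, 2573761731144984267437, 4961504593586922739369,
  5045872209332683862960, 4298805414189920534709, 2839382823721298871469, 3510785378711443586861,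
  5112211511283069680937, 328036511549159957686, 4877396435907059958330, 4962680055395797594937,
  5047971551415710908729, 4877396435907059958331, 4877396435907059958332, 4877396435907059958333,
  4877396427448083821330, 3778359422521829179669, 3693477776446741819669, 301438314151404277433,
  566919922731381300409, 4877396435907059958334, 4877396435907059958358]), ([22473926938868596,
  49863039568113130, 39720595981590725, 38873144503722724, 50223189602667055, 3241002656201329,
  49520240974326916, 12520804199282466, 12523970603805450, 22407235397256292],
  [4877396435907059958335, 4752906692580499360015, 5108890402872558936125,
  4878063992120260429609, 4995125375876358565180, 3694280145440946588856, 4107406452205502704544,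
  2506920326187732356254, 4192741190196572564640, 4192741325609848205344, 2763158579422173744183,
  4110961417899702529673, 4196252350009586069129, 4877396427448090529454, 4877396435907059958336,
  5113264984637721957296, 4963360027513466058544, 3214124682196871491387,
  4877396435907059958359]), ([5540193814997437, 23268235647604199, 44754516429567731,
  49536123901767028, 11838441168397304, 3241000207319257, 48142145754402744, 40980229167727609,
  5538652379666341, 49495234978032076], [4962687299996849809343, 4928788037139855929149,
  3010974787709662227098, 4591093776952388726682, 2812211390274078599962, 4495887411173148831386,
  4430295928758419042074, 4108850567853967573418, 4110961417899702529674, 3213334952078310905659,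
  4876016927770044164879, 4906090365230016992049, 4877396435907059958337, 659595262359608231350,
  4279841500325825800109, 3574256288856531283004, 4877396435907059958360]), ([8618540608423358,
  26243103652855370, 27041646465256476, 20341520663930035, 51103255689058486, 26168465493128834,
  49523448465522532, 46048887144504682, 11959983648822020, 48243159846500979, 15347310129040810],
  [5047978164086639660351, 4900401623986407791676, 2925640049406586816156,
  4477197061104363852956, 2470989435067875624732, 2698314742237231220636, 5047459289602519523242,
  4110961417899702529675, 3213729817294325581627, 4876104043851450255631, 4934388828540676645169,
  4877396435907059958338, 4108861274105360303021, 403855981952374653877, 3820666743396472269117,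
  4877396435907059958361]), ([49504695450469037, 49534534579821727, 49480885057008291,
  49476170479775590, 49476170418469757], [2839886809310283767553, 1033386403281582192908,
  1304654912052420059397, 1304787752510570864901, 4876213665834936534714, 3343341813016740844168,
  2243532510299393352499, 3475372865541586346419, 3635944178190530554540, 4106638021823701387941,
  5067471112016576212023, 2506922452083447827337, 4110961429166727900862, 2509382759204203683001,
  4110961417899702529685, 3020624099347243311280, 3020623557972754812214, 4279431867364149189293,
  2744483186320935961904, 2764623265481630745397, 4374073626655047560365, 4877396435907059958339,
  4956810028443374685882, 5042510383253651652282, 4877396435907053250240, 5067341812090526680257,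
  5010481236030667775170, 4877396427448090529455, 3778359422521829179700, 3693477776446741819700,
  4877396435907059958340, 301438314151404277434, 566919922731381300410, 4877396435907059958341,
  4877396435907059958362]), ([50528292611570599, 50564413565270599, 49504734217588420,
  51578448263593234, 50562831587452087, 8610951625013510], [972970213130043300543,
  206531256859117923769, 4376306958252347493781, 4752818019002624731919, 1173297460077908493076,
  158469715212616854672, 4957760762549970161316, 5043446491751286066980, 4873259628683234660260,
  4871884777066679579301, 2661282499029638368439, 4871471478362252342949, 4877396435907053250238,
  4110961417899702529683, 3009965694589665013430, 4241807875089967882933, 4961504818962261167789,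
  3212940086862297805627, 3573071693521957597244, 3819482148061898583357, 4877396427448090529457,
  4376445102418901165496, 4877396435907053250245, 4956808203180917715646, 5042508557991194682046,
  4877396435907059958342, 4877396435907059958363]), ([24071481474411781, 33252007883263253,
  50509226418999675, 41297398084032540, 51570846219068167, 8591918356382028, 41322435503745064],
  [3343338795404338352806, 3371769083538753606310, 3608691009527825846920,
  4750454312780095115400, 1808102615501721607052, 1864963191770552114060, 1836532903636136860556,
  708296956674496299830, 622871114003874428725, 4877396435898352849733, 3212940086862304517306,
  4877396427448083821364, 301438314151404277443, 566919922731381300419, 4877396435907059958343,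
  4877396435907059958364]), ([30226988978823156, 49534532944713610, 50564415197857354,
  17885910631572998, 5521339425263244, 51561279260388463], [4871372917249758002878,
  3212940086862297809214, 4373844693725377153457, 3608691009527825846931, 3603857726261188514450,
  4592600371751051806768, 1808102615501735023271, 1864963191770565530279, 4110961429166727900868,
  4110961417899702529714, 3476150790493500456755, 4877396435898359557830, 203981383524356154042,
  4376312442481293740468, 4877396435907053250247, 301438314151404277444, 566919922731381296836,
  4877396435907059958344, 4877396435907059958365]), ([11687581229284358, 8603710565720246,
  20957063410488157, 20971364327501599, 2448247921872254], [4754006270491284905646,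
  4754402354322291728046, 4754008098566151372462, 206538569167290896068, 4376310614410787532466,
  205165976037826650819, 4376312442481307153071, 4433173627900906566319, 4404743949230716875439,
  206538566350534553284, 4376312442485653999282, 4404743949235063721650, 4877396427448090529480,
  4877396435907059958345, 4877396435907059958366]), ([30419444576612407, 24924620424524650,
  49877301881198047, 50220064287335482, 49542618903373978, 22457745107218186],
  [4877396435907059958367, 4376312450939885857045, 4376312450939563868437,
  4877396435902322383635, 4540781813950500738349, 4190228101428585390893, 4876213669622160497426,
  4749869335684036924047, 4877396435907059376041, 4877396435907059376001, 4110962062074508483337,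
  4376312450939563868425, 4196252926165748776073, 4546894179122044453897, 4461603315030804161161,
  4876213669622160497420, 2839119191377283521292, 4754008107018875971853, 4929416258309451631528,
  4877396435907053250250, 4877396435907053250251, 4877803941960811894475, 2839251219533955132108,
  4754095854825791531725, 4877396435907053250254, 4748172878167847714506, 4877396435907053250255,
  4877396435907053250256, 4877396435907053250257, 4877396435907053250258, 4376312450935925350099,
  4877396435907059958368]), ([40272079867104778, 49489370737436836, 40597268827199503,
  11721070984626751, 40294148570503882, 49878314401650874, 33086802586501183, 33266642673685354],
  [4877396435907059958369, 4110962062074508483348, 4110962062074186494740,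
  2099977401340237977872, 4759627013385837418538, 4875286906147622694666, 3513969326261301776907,
  4759144400472071591978, 4876500818769496037643, 3018594591137627133841, 3994964313862399328526,
  4427936784643639092779, 4554673591141772536532, 3018594591134524519119, 2071181497442867541710,
  4877396435907053250261, 2575730565436117317323, 4772511225810768683723, 1864053203060352923340,
  4110962062070545657554, 4877396435907059958370]), ([49536121452884962, 49499995601420818,
  49504739115352564, 49504688233158130, 49490443063495114], [4877396435907059958371,
  1304656906812553580223, 1039307551866542536383, 4110957615025434320830, 1476556886055165257661,
  1391398275599342630332, 4110957479612481249214, 1211339784743121185084, 1125916667019365611325,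
  3276819840638626357563, 3712780174912475549116, 3466369719745621250237, 973379711344529629105,
  4105333658692956206520, 3338024827273355369016, 3276819840847596964155, 3466369720894961825981,
  3712780174181076186556, 4110961429170705219513, 2509391899580685910713, 974156478117636374421,
  4190623484544642585910, 3015420973789800634165, 1427079048045028635309, 4276313022697104528181,
  2759939437680814252342, 1228070101203088756653, 917293042871229019813, 2759544595138166711351,
  974156478117636374437, 1429038363450152515237, 2503277137757272514615, 1230029093896252915621,
  1173165703160690767525, 3015812052519060908087, 1485901709674869456805, 3340204843166936197835,
  4196457353651058814677, 4877396435907053250262, 4110961417899702529738, 3009965694589665013458,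
  4241807875089967882962, 4402377362480808430287, 4877396435907053250263, 5067341812090526676696,
  5010481236030667771609, 4877396427448090529488, 3778359422521838206675, 4877396435907053250266,
  4956808203180917715670, 5042508557991194682070, 4877396435907053250267,
  4877396435907059958372]), ([36365370743972620, 51592709759125066, 17865634784066308,
  14804241241665202, 49534532944717495], [4877396435907059958373, 4877390793677859372870,
  4877390658264906301254, 4110957615025434320837, 1476556886055152089922, 1391398275599331781441,
  4110957479612481249221, 1211339784743108265793, 1125916667019355010882, 4876213662770025937726,
  1303285854014971262651, 4110957480596749081521, 4876213662561055331134, 4110957616010024141745,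
  1037936499068960715707, 4107413118710917192506, 2508019296579517608762, 974156478117636374452,
  4243764389237822183600, 4276313022697097323184, 4275918564034368299696, 3343339698159508727442,
  3394096610227701131943, 3608691009527825846986, 3393511624877291067084, 4110961429166727900890,
  4110961417899702529745, 3476150790493493251794, 4877396435898359557851, 3212940086862304513750,
  4376312442481309475539, 4877396435907053250268, 301438314151404277466, 566919922731381296858,
  4877396435907053250269, 4877396435907059958374]), ([33311365840649908, 49520758879575031,
  51591122849582674, 24012873513452050, 20971324874832010, 30197368237453882, 49534532130941599,
  20971853832939004], [4877396435907059958375, 4872557501304256748360, 4872469753710666341192,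
  4110957615025441028932, 4110957479612487957316, 1305843036841135665984, 4110957480601102635823,
  4110957616014377696047, 1040493681895124622144, 1303285854020820722350, 1332111210282190561966,
  4373844693729737412304, 4431100134901123616464, 206538566350534553306, 4376312442485653999313,
  4877396427448090529501, 4877396435907053250270, 4877396435907059958376]), ([22473941458242136,
  44976652804089028, 49851211849035937, 25989748125971140, 22105633730781768, 20954264454324026],
  [4877396435907059958377, 4376312450935923027585, 4376312450937430289537,
  4877396435898359557761, 4540196828610663630097, 4957174112735304892177, 4877396435899866819713,
  4539787338863869318417, 4044435796426157862017, 4556195673619230903425, 4877396435898358478687,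
  4877396435898358478689, 4376312450935921948511, 4877396435907059958378]), ([24643559483361823,
  49851211849022989, 40251315531093154, 51818571613057570, 49883811576487519, 35267494748057533,
  36832690044369034, 33857473738009786, 35250526273781191, 44152724146539130],
  [4754008107022917144297, 4376312450944247192456, 4376312450943927029384,
  4541966409291315851948, 4754008107022914821097, 4376312450943924706184, 4376312450944249515656,
  4542054157093877363372, 4754008107022907534058, 4376312450944239407818, 4376312450943917419210,
  4541966409285081128655, 4958945518667830359759, 4877396435898359557858, 4376312450935923027680,
  4877396435907059958379]), ([42353905446304942, 50542550841870024, 42320933784298756,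
  30200448621971407, 49536119003945928], [4877396435907059958380, 4871475284496621667390,
  4871884775217109529662, 4293526414128713595197, 4236797662892609796284, 4294067526553043724605,
  3343338170950789624505, 4752904878595273097401, 4104268831152400313237, 4189278018248091581716,
  4189410858741070904596, 4189147005938817842452, 4961709413645297121121, 4877396435898358478691,
  4877396427448089450335, 301438314151403198307, 566919922731380217699, 4877396435898358478693,
  4877396435907059958381]), ([50564414381511571, 40273864275955999, 30200448621969460,
  50566001257150522, 40297314691175644, 36365455910330173], [4877396435906363559660,
  4873742099908343008325, 4873654353080980481093, 4296056472948140257218, 4239590965119720909761,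
  4296363591232304034498, 3343341669122721293242, 4752907609425309935290, 4106038411833027607476,
  4191808079884253799731, 4192204163784917656883, 4877396435906361236460, 4873654352105781496901,
  4296363590257105547202, 4239108352205632596929, 3343341533709445735354, 4106126159635589118900,
  4192115197193219089715, 4191721550870829344051, 4877396435906353949421, 4877392621757079394011,
  4877392486344126322395, 2244174662863254016729, 2159016052407433708248, 1893534443827456937689,
  4876213665591135834838, 4752907609419075211990, 1684140268969748409043, 4191808079879222976210,
  4192204163779886833362, 4277493809080539130578, 4276705297646622583506, 4961709413645298200290,
  4877396435898359557860, 4877396427448090529504, 301438314151404277476, 566919922731381296868,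
  4877396435898359557862, 4877396435907059958382]), ([27152552285672152, 33282316407412538,
  49520272299412922, 20971323370931642, 36396311467790472, 42577124132622991],
  [4877396435907059958383, 272870719872475113412, 538220706748609865668, 4103859335772093316026,
  4104268826492581178298, 4748686702442946227131, 4104268831152400313234, 4132699119391301118866,
  205165976042170095459, 4376312442485652920159, 4433173627905252333407, 4877396427448089450341,
  4877396435898358478695, 4877396435907059958384]), ([39465855637368802, 51592179167172898,
  33311366656047181, 49520801260061959, 36407180482177204, 27141131764387984],
  [4877396435906363559663, 4873742099912696562631, 4873654353085334035399,
  4110959443109713322947, 4110959307697942701763, 4750456280306837882560, 4106038411833048311471,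
  4877396435906361236463, 4873654352110135051207, 4110959307696437765059, 4139522436149689754563,
  4750544028109399393984, 4106126159635609822895, 4877396435906353949424, 4873742096638837142237,
  4873654349045246735069, 4110959443104661050074, 4139521962198173029082, 4110959307691707978458,
  2072088223340874214103, 4110959308680322656976, 4110959305863566314192, 205165976042171174628,
  4376312442485653999328, 4877396427448090529510, 4877396435898359557864,
  4877396435907059958385]), ([45661855121219626, 51577391196373282, 21713407520867638,
  49535062670869819, 22755962701894450, 5504033747136157, 11685399283223479],
  [4748277217359632011907, 4748278436288083137155, 271686127367711725241, 357020865672238241465,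
  442355603976764757689, 537036114243846481081, 622414726763110409401, 707661716638162101433,
  441171008642191071929, 708641565602472731833, 4748277217355984466561, 4748278436284435591809,
  4748277826820210029185, 621230131428536723641, 4748686707102778781825, 4748687316567004344449,
  4748687926031229907073, 358000714636548871865, 272872547956048688835, 538222534832183444675,
  271687955442578192058, 537037942318712947898, 622416554837976876218, 4748277217360331312776,
  4754008098564644114153, 4877396427448090529516, 4877396427448090529519,
  4877396435907059958386]), ([50549626379325988, 39492264091090780, 49535590835359474,
  36407577093302692, 30226015386142447, 39465855099473719], [4877396435907059958387,
  4872557501304255669221, 4872469753710665262053, 4110957615025439949795, 4110957479612486878179,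
  4749359440244836189151, 2569698686651011429484, 974152986027647977413, 917293041897912781509,
  972968393514177480638, 916108449384442284734, 4749359440258589941651, 2569610939057421022316,
  974153617957772183493, 917292409967788575429, 972969025444301686718, 916107817454318078654,
  4749359440260097200019, 4877396435907053250290, 272872547956048688858, 538222534832183441114,
  4103859338593209921238, 4104268829313697783510, 4748277217360331312842, 4754008098563944813290,
  4877396427447391228653, 4877396427447391228656, 4877396435907059958388]), ([39466913212254709,
  30226544063763943, 30237635075823388, 51577919340705031, 49535590863448327, 36395782439199958],
  [2448196033429208953967, 2509386711560278255559, 2452526767430543059655,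
  4107310749339512732612, 4107223002512152030916, 4751728630923390466994, 2447785911546331526255,
  2452526135500418852807, 2509387343490402462407, 4107223001536951221188, 4136443222909847862212,
  4107310750314713542340, 4751640883120828955570, 4877396435455786879730, 4874926698068386853596,
  4874838951241024326364, 4107310749339504947930, 4136136105600874787546, 4107223002512142420698,
  4751728630923382682321, 4877396435454281446130, 4874838950265825342172, 4107223001536943436506,
  4136443222909840077530, 4751640883120821170897, 4877396435445212598004, 4874926691973410828006,
  4874838944379820420838, 4110961271183874363108, 4139523790277386342116, 4110961135770921291492,
  4751728630913991347936, 4754008098564644114155, 4877396427448090529518, 4877396427448090529521,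
  4877396435907059958389]), ([51592167778540495, 40982798338221715, 41322990272086059,
  31685418792035592, 20954176147038326, 26214471639272722, 39611104159695038, 20954266082711738],
  [1741772590919305677759, 1684912646789568159423, 1684722526306885263039,
  1684912014859443953343, 1684721894376761056959, 272874376039607768931, 538224362915742521187,
  538034242433059624803, 4877389125962501994355, 4877396435907059958390]), ([51133032141098140,
  40638514673996170, 32025533954980072, 24039304889991943, 40982866402078906, 33054333558357562],
  [1679391060009483227251, 1741767106667902955621, 1684907162536985309285,
  1741772590919303355334, 1684912646789570481862, 1684912014859446275782, 1678981434850920616051,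
  1684906530608043552869, 1741767738596844712037, 1684912014859443952582, 1741773222849429884614,
  4754095855034440149750, 4873742096638137841389, 4873654349044547434221, 1741772590919295570651,
  1684912646789560871643, 1684912014859436665563, 272874376039608848100, 538224362915743600356,
  4877389125962503073524, 4877396435907059958391]), ([51026658465543016, 42577103727858556,
  48047963155761268, 38926629918279970, 41322987214877773, 52399877824229218],
  [3217000237664727370087, 3277006316451933633480, 3220146372322200760008,
  3216590115015300073831, 3220145740392074230728, 3277006948382060162760, 3216999604760587127143,
  3220146372320693500872, 3277006316453440892616, 3217000233650411994864, 3277006316451925848797,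
  3220146372322191149789, 3216590111767534567152, 3220145740392066446045, 3277006948382050552541,
  3276816827899367656157, 3731934799145538482909, 3219955619909383549661, 3216995804294835531508,
  3277006316442534514406, 3220146372311616868070, 3216586179136272920308, 3220145740382675111654,
  3277006948371476270822, 4754095846576176729847, 4876111287303637667566, 4876023539710047260398,
  4877389126415650033397, 4877396435907059958392]), ([22056262101442123, 31382762513418895,
  40936803003612826, 31382785367065396, 40980729313211893, 40608409742744161],
  [4754608643761309986505, 4754198521110697917385, 4754608010855984970697,
  4754608642784604240841, 4754608643759802727369, 4754608643761300376286, 4754198521110690132702,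
  4754608010855977186014, 4754198522087394052830, 4754608643750726094568, 4754198521101298798312,
  4754199154005439041256, 4754608010846585851624, 4754198522076819771112, 4754608634081835192049,
  4754198512198957764337, 4754600543382420229877, 4754190918223857618677, 4748175002906164367096,
  4877396435907059958393])],
    by decide +kernel⟩

/-- In the step to length 8 the flag is true, so an extension may also be settled by a nontrivial
automorphism, and vectors fixed up to sign by a listed automorphism are dropped. Every member of
`reps8` extends one of the first two members of `reps7`, as all its codes are below `2 · 3⁷ = 4374`.
-/
theorem exists_checkReps7_0 : ∃ ds,
    checkReps true 7 reps8 (List.take 11 (List.drop 0 reps7)) ds = true :=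
  ⟨
  -- The first certificate is divisible by 128 and so gives an automorphism of the extended code;
  -- the certificate `3658738014042472280801793` has residue 1 and leads to the first code in
  -- `reps8`.
  [([38104659655523911759, 22189885277467804544, 38549912789059734916, 38107843296568816350,
  25592397713223137668, 38328831044445206404, 25224236053162048900], [3162088539793581196877696,
  3162088539794557902626176, 3658738014042472280801793, 3659002077965307884584961,
  3658738014042472280801794, 3659002077965307884584962, 2375634307090114975353088,
  1664462185202987730645248, 1664728819991025577864960, 2633373820657912338095360]),
  ([32116891109926085542], [3334120882642545428092289, 3162259121522845557858178,
  462564883507307230283776, 3658738014042472280801795, 139297246710696516478080,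
  3658738014042472280801796, 1171922176661838880318464, 177087842363750944327040,
  177087842363750944327040, 3658738014042472280801797, 327663707733437767754756,
  101730323999361881360256, 3658738014042472280801798, 295886956186674887603072,
  3658738014042472280801799, 3658738014042472280801800, 326772353187999152441351,
  461778855957809362456576, 177089537918511963161984, 177089537918511963161984,
  177089537918511963161984, 3658738014042472280801801, 3657636798242992427554176,
  3658738014042472280801802, 232356337527927784066688, 232356337527927784066688,
  232356337527927784066688, 3658416827070925722670464, 3658738014042472280801803,
  3658738014042472280801804, 3658738014042472280801805, 3654483210976210525685644,
  3654483210976210525685642, 3654482057051982859144192, 960751063823565544863232,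
  287624832692104623802880, 1719759125280455231876096, 1775294298090658280757760,
  3658738014042472280801806, 174781532437394099219840, 132435035071685958842112,
  174781532437394099219840, 3693983690192712475248512, 1484343795785167830939008,
  463790042041247493019648, 174517263182900145966464, 174517263182900145966464,
  174517263182900145966464, 192304740911000618763392, 3658738014042472280801807,
  3587782140859727088811399, 210786252714249794899712, 107927980386715874326663,
  346462975208165277977999, 3694495567043779514500352, 3658738014042472280801808,
  96659261382374373234448, 794887478024078009273728, 629082038233527507037696,
  794631605431772845984000, 3658738014042472280801809, 3658738014042472280801810,
  3658738014042472280801811, 3676737943533483509419794, 3658738014042472280801812,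
  3658738014042472280801813, 3676652915935370284106132, 3693983812715260998819217,
  3658738014042472280801814, 3658738014042472280801815, 3658738014042472280801816,
  3658738014042472280801817, 3162088539800857344317314, 3655341962093874737368832,
  3658738014041291870662912, 963718765513760249856141, 3658738014042472280801818,
  3658738014042472280801819, 232356322293935735075456, 963128445815246178734464,
  1282459136522206042997760, 631688147962534691032579, 3657079993555115135127040,
  797493587753083742080388, 3658738014042472280801820, 3657971581486061226479104,
  781833907373130533100567, 3655557214694167206174720, 3657138036898430354902554,
  1406668115604526757046026, 1484343795785167833513472, 232358017848696753910400,
  232358017848696753910400, 3658738014042472280801821, 3768173758103359590319882,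
  3657636798242992427467776, 287624817458112574811648, 287624817458112574811648,
  287624817458112574811648, 3768953786931292885436171, 3658416827070925722584064,
  2750730853959476624173213, 3215705186829470453677082, 2701602888607832794513053,
  3655341962477545684780544, 3654396766187965629448960, 960751063823565544863232,
  177087872831739396123008, 3334035591781797743762304, 1721711597730843749851904,
  3714006493973278176727168, 1290806124602433312225664, 3272710790518734720500096,
  3658738014040351446200704, 3658908595763831328871424, 3658738014035606128741888,
  3769709619554052898974478, 1684692934791643783739154, 1664899533403945779607057,
  1684863384943257278196116, 631253502311311077737728, 962864381892412082213248,
  797058942101861579977216, 2618570715257162025184000, 3657079993555115135127040,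
  2784376169875465717196416, 1664548265837773199522456, 3657971581486061226479104,
  457265897259796934899353, 457000023222574345114130, 457000023222574345114129,
  457000023222574345114131, 2617803097037461442313344, 2783608551249525307654400,
  488923731093166571842432, 636628003780710049196928, 669982950750978010596370,
  3656368823381313324241664, 96661285179161586712320, 669982950750978010596372,
  3656624695973618487531392, 636798717108024590409216, 708180073730936174966801,
  3656880568565922199632896, 636713557865638643572224, 727370833173509493628288,
  629082038233527507037696, 960437045222323348223488, 794631605431772845984000,
  628826165641223794936192, 3115743336522268058987520, 285054238277261776451072,
  285054238277261776451072, 636798717085455711146112, 670068241615104079404928,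
  3658738014042472280801822, 636628003758141169933824, 2975683954711112977003392,
  3658738014042472280801823, 3128366384548046859109120, 1593841386592303547618944,
  2949414005461589172992000, 296867241891337615907090, 1134310081994247679548288,
  283520730780408359074328, 400196923691449365280788, 1134395636079176273923584,
  2620920959498156523975040, 400196923691449365280789, 2746683645451721400487040,
  283520730780408359074327, 2479034625227481140999040, 174781576514416261268864,
  174781576514416261268864, 455465403621633672709919, 1134480795344131100023680,
  781890387437232717548062, 727553373971549336487680, 2950181623884409669198336,
  2784376169875465717196416, 3768537015711165572565406, 1134480795321562220760576,
  3442983015565698636037504, 1775854083301314135966080, 1134310081949109921022080,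
  401731543292392456909214, 2617803097037461442313344, 3370934844492631377599104,
  2949414005461589172992000, 3655083826565215410031232, 3334035591784680864714113,
  3217527601458222426747008, 631602857098339932645765, 1204282474460685658961028,
  3657971581485085972001792, 631517566234145174258944, 963128445815246178734464,
  287624802224120525820416, 3765628101312072617560333, 963299027543634244316442,
  797493587753083742080411, 3655620152640393689747200, 1247254731342610451591692,
  1140270564419414318563867, 3658738014042472280801824, 953840493510121056259097,
  3657079993554139880649728, 287626497778881544655360, 287626497778881544655360,
  287626497778881544655360, 3657636798242992427640576, 3712905278173176734401545,
  3768173758103359590233501, 177087857597747347131776, 177087857597747347131776,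
  177087857597747347131776, 3713685307001110029517836, 3334033861728686128768413,
  3658416827070925722756864, 3160436721727040787783963, 3655083724192779088275968,
  3767688691072159698033053, 629140184242465991575936, 960751063823565544863232,
  232356352761924186871424, 3658738014042472274591744, 3659002077965307877876864,
  3658738014039411021735040, 3657971581484464048847744, 1788499302762568428788608,
  191856552690968328516232, 600048116902204349068544, 3658738014042472280801825,
  3658738014042472280801826, 629851354438283392151680, 3657079993554488109838720,
  191856552672648845060229, 630572623861993196121856, 3657971581485434201190784,
  210216751055728669626115, 3657079993553517957495680, 299640936975619671955328,
  210216882680497090306310, 635736424046259347873792, 3658738014042472280801827,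
  797495546618759786770722, 2973129002380380576928390, 3328600683767122971707520,
  3654072990505146930972672, 2219333074775791572054048, 139973650645142315505792,
  1954042837164044528872064, 2130496914677544773231744, 2741313294603225023930376,
  2451149177352184004868252, 1588592003310603451121408, 2284583546145681871525638,
  2081989431274376453294989, 96485196350869707935629, 1750926096172024346170880,
  2389050913951738052342408, 3162088539797024551503360, 3334035591783746345948801,
  3654157105592222990019584, 3658738014035436920322304, 3658738014038109435054720,
  3658738014041291870662912, 3659002077955867849145216, 3658738014034979103453568,
  2580362241785738405337505, 3654072990505146930972672, 2716371360553494069553920,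
  2452124113968035158569984, 2132075791558690652410512, 2716456651417549997596032,
  759795334792513214141312, 630572623861505596873088, 2942742792176318634662784,
  2452209404832089635423872, 631517961111977817041280, 3657971581485434201190784,
  490276685050766349413124, 3657079993553517957495680, 3217525488192872776086656,
  1592477099912368548123663, 1133153516560634188253473, 425212356840631317409038,
  1409551594018783218884096, 3159786361927462231985568, 3386555833176158178808333,
  2416252607001471221090192, 2166754410764376300073856, 3441824283653954084439174,
  2628984980500714423769360, 3658733272200129403472000, 3654573061140861316107136,
  3709846283117970727458944, 213386500036223341298432, 3656372274795826225943040,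
  2416252607001471221087894, 2389041437189061409115545, 3331287338621341079084935,
  2444300352811572000518804, 2405339705302680209229833, 1226919425971315319668096,
  2129593841460869844819217, 1227188440401324269192960, 3159976353746287453798924,
  1858296565571006439026071, 3217354906478916831884827, 2975683954711112869501056,
  3654066378544022844333696, 1631394117359280618398720, 1878295322594396452560009,
  1857784951985602667407641, 3658733272201278744544768, 263649368744218370006177,
  1600886659174698382862341, 3213957998284522740047494, 3180682079925097790185507,
  2620920959499096948437248, 3269226478214708981983004, 490950717964933645719330,
  1818468975720333584043011, 2479034625227481033496704, 2375764405050172805519510,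
  3656372304045093746453760, 1227188440401324269192960, 2161833495572189199965587,
  2217083037210385839929487, 2135254654309053574252428, 958379797085526513449600,
  2289302667300102493212171, 261385500222577717890583, 2627002362449996699229589,
  3270763476926968307646985, 2376131113961165395254299, 2585738478194668534885398,
  2131819918978940473906319, 3269226478214708981984135, 792899051719732179572608,
  1226919425971315319668096, 3162088539796711149344640, 3162088539798980358675586,
  3654421432938035024372224, 3658738014033625837425408, 3659002077956838001488256,
  3658738014040351446200704, 3659002077955867849145216, 3658738014034979103453568,
  2163037182741833912366755, 3657971581484464048847744, 3272706718483570209493376,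
  464102497226522689189007, 1140448066337845294740643, 792588115621555714553358,
  1484343795785167831774208, 631517961112186788144768, 3657079993554488109838720,
  1585787807077631964502660, 629851354437691307351168, 3657971581485434201190784,
  2716541942281883102595072, 3656387770431285566679808, 2452038823103700602382720,
  2716456651417758968699520, 3414035639190248254442128, 2452124113967826187466496,
  3272706718484301608359168, 1637271092024767571333251, 3658734381348646571305216,
  429539967844861454453155, 2166754410765316724536064, 3385631831664257180427656,
  3199019747258399652808865, 1744669891303640172938373, 3440900311594441003556000,
  3371052616548931587547170, 3473294535665012128334735, 3389301156860414974512666,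
  2352375886250507869799318, 1282191747103676914480384, 2272351532374876136319751,
  958379797085526513449600, 3443122263899404217363979, 256369487928887988931481,
  2184862423764112663331731, 2774707238773024262765065, 2699450712395311765565322,
  792747423516905887837696, 3656387770431285566679808, 2975683954710799467342336,
  2596590161054234816311702, 3413865057462104472213519, 1282453299716230786014208,
  2616198063200693720642709, 1859526643516581226670349, 2375759228316592404491792,
  3332436490585806468987164, 3269843584584405294624904, 2944409148674518696238224,
  2620920959498156523975040, 3654318210557725924991744, 3764858846784128617444736,
  3658734381347915172439424, 2479034625227167631337984, 3654072990505146930972672,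
  2744587515204945541946266, 1859611144627879082912011, 1877357124962625750965399,
  1593841386592301881436672, 3332665322700087877447178, 1877442284182442818549657,
  1282453299716230786014208, 1282191747103676914480384, 2682270842605559239664276,
  2902351310797603493492747, 3656387770431285566679808, 2889140698196722790600470,
  298227240851391137959808, 2696786602731018120723335, 2745156609070283470844945,
  2910971496577989438645911, 3658738014042785737458560, 298876190181643509959552,
  463846492991173857326080, 3217527601458222425339264, 1952405837919234932989698,
  138888300853039392363648, 3272710790525292681458560, 102802510878324475885440,
  1897222648850080125611393, 1128166971676279258312865, 2716456651417515169075200,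
  2452038823103909573486208, 3658320060019883387241344, 2716541942281674131491584,
  2452209404832124463944704, 1127012837603278328877859, 2716371360553459241033088,
  2452124113967965501528320, 1128074102543741116846241, 2660259187082575033727360,
  3657924790271577035327872, 1127324388004247225938723, 3657491136817177451004928,
  2119794170349731714184320, 3657649913756990299030400, 2714626033806165000452610,
  2248179761545832813362817, 1669066813590479250518144, 1669338487806131139626112,
  3654131021948536556729600, 1170759594630019992440481, 758764565604100235989538,
  1668742768155092072651904, 1281296569318140344982562, 1170122286202359481875875,
  1667664928968234188014336, 1669066813590479250518144, 669531170945270724715427,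
  1668742768132523193388800, 1952320547040802350992910, 3656602080512836368084494,
  3657491136817177451004928, 669530077705972621997217, 1669338487828700018889216,
  3654217102587987157958144, 1669066813590479250518144, 1253509148031994038366242,
  3654301998564396541000064, 896801713101149732688802, 1669338487851268898152320,
  1667920669961368592320384, 3711964247964931158281614, 1670006091367344936295822,
  3654301998564396541000064, 3657971573390699724365184, 3654132307381623669241088,
  3657073661095563098164352, 3654017331265373990790912, 3658690630229089064638080,
  3657329665332105187005824, 3658057127543334956529792, 3654577715227425901227904,
  3657585669568647275843840, 1722687028280876337720064, 2119557894780922518414464,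
  3657073661095563098164352, 3658057127498197198003584, 1664420055582665611816320,
  3657329665332105187005824, 3657971573413268603628288, 2660022269855737139016064,
  3657585669568647275843840, 3658057127520766077266688, 2716058630759143309516288,
  3657073661095563098164352, 3657971573435837482891392, 2451983644375047386697472,
  1720218388116084441489280, 3658142286740583144840576, 1664363195006605752414336,
  1895189043950897176541824, 3658738613652456451129216, 2449910956746789070093569,
  2455198990235722683899266, 3658732091065799378832512, 2394551096033843155877121,
  2916616370926926720449794, 3658732383558474583869056, 3272711966111214890941312,
  3217528366923447434243456, 3658823436663679187731712, 1775372767240147699705216,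
  1719858271134371998610048, 3658738006865568676275584, 3658735538557581031765376,
  3217523051365590926397952, 299642622730218203895680, 3658738014042472280805376]),
  ([38105687950019734130, 25592397713234834142, 38327802749885210071, 38107843296568895360,
  20558901665784978820, 14121801448838673389, 38330992737870191880], [3659087368822884214822400,
  3659002077964326454678016, 1669069177296928178875904, 1669069177296928178875904,
  2166754410766701061460480, 3677331685722099375453056]), ([2125732638666712258,
  38107843296517696852, 2122546522116283138], [2277285360106693620171648,
  2222016895004263954288896, 1587888914170383820820515, 1170569040033094768888609,
  2218952419996890656649344, 2217208783217171440506753, 2745593817752592097317634,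
  2277285345482059859916288, 1483475008643517937117568, 2786726406806264170511104,
  3384781795853171981983630, 901888327712382253201806, 287359380489805674701312,
  3657924789791018212156928, 2659175378361564025569038, 3349470073838662018096290,
  2477369923630883926582818, 132179294101120433796878, 3657490683446918524475264,
  3654217102584717254655488, 3654217102584717254655488, 3654217102584717254655488,
  3654482057055252762446848, 3657868017397207102423168, 3654482057055252762446848,
  823638254630041280072966, 3734196576685561696590600, 462458188402135591174144,
  880313748306137583783194, 2405456864580931046020992, 2253358491248373383121164,
  138831431116831344972681, 2479034625224037411297152, 130939792549171046648843,
  1450687766123432582081930, 2784546751603994119548544, 1790490337761671686145307,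
  1188989419528700532729856, 2783779132978053710006528, 2975683954707669247301504,
  2902106544515094904162944, 3658738014037795869403008, 3162088539794562249472384,
  3588285292118567690710536, 3582144349927059221717536, 3583134254780119911738118,
  3589275065373234867389084, 1226546936570025351176192, 1957375831821997756913024,
  3712092275859883978876160, 2902106544519448720316928, 3691695752211980884323981,
  2413590833686560020237202, 794159046335840536422784, 3588114710401270953709318,
  2118778135603772460295320, 3588815040398444990363676, 631247579331656682664064,
  2405456864580617534120448, 960950068843673000381696, 3582622509605629959088392,
  107610785033670004897944, 2975683954708964077879936, 638187539446089098028941,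
  2221437981065573718041362, 3582242900178541161738016, 631247579331656682664064,
  2479034625224664268623872, 3658738014038109435054720, 3162088539794562249472384,
  3658738014034979103453568, 2579832638053539790772641, 3659002077962001693291392,
  3658738014041291870662912, 1188989419528700529579392, 604705586197025711892489,
  672367542315068184391185, 727635773626787300199315, 1254136425136884941189652,
  1249550937189878736405137, 3696018707887219449056026, 3677331685723980216928411,
  1626085162907655524871936, 1421478133343067245830038, 3180563760679560894724864,
  710316849874086718908815, 1097198669839989961582080, 1097284223970056314483584,
  2912545930990683488461696, 3656798729116658880112128, 1097284223924918555957376,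
  1687489771855787478588800, 914398869141042478286487, 1097369383189873382057472,
  1226919425971315319668096, 2405456864581244501930880, 3658733403911831909807360,
  2590379267403299109388701, 1097369383212442261320576, 2975683954708964077879936,
  1097198669817421082318976, 3734684992284952944219801, 883325735262976876306432,
  3656103474009538421355264, 3655932892281323530896768, 3656018183145379458938880,
  1227271067806256266200329, 628353117265919575692288, 1227185776942233231753373,
  1168009551322011531069440, 3180563760679560894724864, 628182535537704685233792,
  2902106544515094850411776, 3160226517066604047514653, 3654303020799318696781727,
  2455545225294048064324875, 3654303020799318696781726, 210150672354744280854272,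
  3658738014038422837213440, 3162088539794562249472384, 3658738014034979103453568,
  2162003354091943644182179, 3659002077962942117753600, 3162088539797999429826816,
  1626085162907655525368832, 1255756948057084655292950, 3198960025737923493323008,
  1598929342821473595444239, 299642886039378784148123, 416490523238591069631898,
  1420030704091274646406033, 1323002724466760057245076, 1208172109485109215297536,
  641529045131068096885643, 672284894041360608086932, 782821854285088533835285,
  3656018183145658087084032, 3655932892281532502000256, 3656103474009677735417088,
  3214577381215267103581599, 1979314885837775191956638, 2405456864580930938518656,
  628182535537460885609472, 628267826401586470693248, 2699165347751208442796800,
  1133146542566399115048320, 1133402546802941203886336, 3198960026099025561471616,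
  2286472437569736507364736, 3441791308754044617840157, 195537284040732195962752,
  1133658156174371765922944, 2902106544515408252570496, 2455374643575709853425664,
  1133402546802941203886336, 1133658156174371765922944, 2747572840779637004279330,
  2748007165320637056466466, 1289819621467063097484672, 297506282599758770658176,
  3272710790519675679205888, 1455613204739802850799616, 3676072740351663681541893,
  461778855957809362456576, 132491486023736331783940, 194480172529756145863808,
  298041053201598715399040, 464681629971218651886592, 3695250609324636170819971,
  3736264537321071156861572, 295886956186674887603072, 3676072740374232614548872,
  3742025213466370954748687, 296702992496004885421952, 3695251004189747643874054,
  462761939341527329406976, 145029374644070292355983, 3675816999407250341963648,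
  177089537911899604444544, 177089537911899604444544, 2915711169724480129592192,
  1124004719742530427125760, 1774953134431179209512320, 177591293546256037362960,
  3081109868744497303552912, 2276129736104506106843033, 2455374643575711842093440,
  3654217102587987157960599, 232356337521315425349248, 232356337521315425349248,
  232356337521315425349248, 2719176482314599767561216, 2785456900713280767077911,
  3654217102587987157960601, 3331225830655700732828315, 3270974939509030761730460,
  298762473629326355521428, 3215105801408398760702496, 2974871533846975429715482,
  415081704688179344419729, 2131569368395397495091721, 2696383255576617839128075,
  288128283874609716838806, 2338731398317330557037312, 3656018183145449115980544,
  2618646536466548674670464, 2477455214475326341835268, 628267826401795441796736,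
  2455903396029438258310915, 287624832685492265085440, 1586435557026817311480960,
  287624832685492265085440, 2947214285453865286417925, 628353117265849918650624,
  2124292501620584547871364, 2891945790899048186694540, 3654217729935123938397205,
  3198960383980813885632256, 3180569405253400233792896, 3654217729935123938397203,
  2290097926583380892708618, 2836677340015012454379659, 3654217729935123938397206,
  2124292501620584547873673, 3658738014448712107476224, 674408204019847517269377,
  674672473273264950300034, 674501891556561046827394, 3658732690675783549159936,
  3217526190393784974887552, 3658733538230742563238784, 3658735829246958289889920,
  3769359073784601338022400, 3658738007655479450362240, 674501891560706819278209,
  3272706736369144897404416, 3658738145664176123069312, 674501891556269646391810,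
  674237622303723949825665, 3654007839267728970793344, 674501891556269209369856]),
  ([38328831044445206404, 38085369807640828056, 38084670018172250376, 38095419293892116902,
  38549912789059734916, 38107843296517696852, 38309868114508397832, 38321732290280048614,
  38535066210028251912, 38544876970970208742], [2620920951256994222467200,
  2590482072288920225142144, 2627062288336570564765824, 3654217102587987157958144,
  2627062288381917294645120, 3658735132989636552921600, 3654568238461551914108800,
  2620920951302340952346496, 2185171446191516051579264, 2590482072311593590455040,
  2203594272767203860291968, 1721398179524033353184280, 1378090005999302559365528,
  751326584275653602649874, 1776201802989545314072082, 3658142286599736634258560,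
  926191885036693655662627, 1754363021274319986333473, 3657971573272422093046272,
  144973978649826912730243, 708100564604657090888320, 104091482853155034324614,
  138890478053069373723013, 140877132357514360942600, 3656103468525300781416192,
  3764992704219186049207437, 2338702968029614238524192, 2618286413983105861512960,
  2093033038923375541549968, 3580808137495976975129232, 2618115832254890971054464,
  146764163350871015025564, 2618201123118946899096576, 3116733941252482464414364,
  147018074549127691720864, 368047370736028311257229, 3656018177661420447144960,
  3656018177661211476041472, 138888300854219797292160, 2118771191856434374776192,
  3125376326277739887819648, 2618201123119016556138240, 3088587943193146122594432,
  2118828052432494234178176, 3658057127379710595331584, 97259540759853012388482,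
  3658142286644665421431680, 133839757574845246835841, 3677510985221337443992064]),
  ([25148132733566007172, 38076210172770037879, 20116817216350610816, 29480954077735331462,
  38058370902631058401, 20084597320207530554, 19230544024655125294, 25549323596578961885,
  26776272494428315572, 28594066468141919634, 38107843296568895360], [1226546936570025350927744,
  3655563298541811470908928, 3778067168517644270255376, 1459951676945884136217505,
  1167437424078942037568128, 3781499910454620506656768, 1222639596528285703602304,
  627034511192086608123520, 3439964984933648905088654, 956720294188134551315470,
  1896951060657543177431842, 1841673059887348543977633, 1590179374351331409880995,
  2716235333503310047956224]), ([38059408718982459379, 20558901665784978838,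
  20511568073696718817, 25224236053162048909, 25178000815918736362], [3654454725915382732785287,
  2717319037763382979461376, 1225711875847611436163072, 2277286530077385756638464,
  3131568215188453944626315, 2835806823947655442849940, 1907803044018177641364992,
  1293974581486526858497280, 797323240718470076366720, 3654796086911164628655232,
  2414357266868033541770130, 2122669504969482120057472, 414844703383110219928985,
  671169620024968735164928, 2119535062570495361406737, 2082754743437055034241429,
  3475400126675101001350528, 2184911888187578797964800, 3658737123491520221867264,
  173753711971143169169792, 2285406945977295791963783, 3656819255849836889128576,
  3654573178137931397375872, 3658738014039411021735040, 328691563742153623227152,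
  2633322572547545853465750, 2586666250332197822031894, 137911300355037033607296,
  3655335987929755019959199, 2122669504969482120057472, 2662372512587359245338112,
  2356752149778945521004307, 2352953969195807077820821, 1292338742577933079500574,
  131002257849332451002112, 101197839245162508375936, 3677510985226211282881822,
  2784091868601409555019520, 3450603924980201345701888, 1778893109203340728844416,
  1089516074100434678698382, 3658738014038109435054720, 3658738014034979103453568,
  3386363563631742906482591, 2622807230134843545078784, 2163355938368362007315840,
  2622807230134843545078784, 2622807230134843545078784, 3655377506433602693410304,
  3655341611102664276332288, 2184911888185371186017920, 689975266343354701329920,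
  3657636915239749057640704, 3654796086910572543854720, 2888420466694977505834774,
  2716902060702735066062336, 1907474920250894972372480, 1665874775526438170883096,
  2122669504969482120057472, 2662372512587045843179392, 3125432611007651971664800,
  1293068506840241682562304, 1281778251188639909821696, 3088530185029516896744604,
  1790740830467281751076992, 1779279729798711532193920, 3738283848724484060862877,
  711350005493924764824576, 2131880049475708843938708, 1822095611952165718384151,
  3767825770149156496262941, 1820939578549914839275417, 1789173132122865525132430,
  3125372003687035072067072, 3217526042520924743237248, 3658738014038422837213440,
  3658738014034979103453568, 459240970266252303377024, 1225711875847611438903040,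
  2401670927141075503085056, 1722686428670892652616192, 1103226497809485367120512,
  3765376516203559998501905, 3658738014040351446200704, 671556368155306951137536,
  3654796086910572543854720, 2252342429963748273259405, 3767403441232476580944263,
  386470316771597851904393, 2630005029752298765506567, 3657367938332836912651264,
  3125432610962527166313733, 488535187885483220332055, 3657082948347355873974528,
  3123796288543873718665987, 711350005493715793721088, 2284590925760798397218080,
  1204027073196268731900416, 2663785570745774504378515, 2455008986333769948246169,
  3125432610985096099320712, 426645585785388102838426, 2124454262986293774522380,
  3088529790164414775774470, 2836750770664897844622474, 2452483668033656770630683,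
  632720700487169896513152, 2774322501966233402831640, 3092420118104833467041688,
  3574231483534826176765340, 2783921286873159836040192, 3313755968982697395576464,
  3272705727937887706832384, 2784006577737320249644800, 3744638845219345302298775,
  2784091868601374726498688, 2184911888182797464889728, 632682793436463323585664,
  2627327645930578970387584, 328937712750008202420491, 3583862115856990070584722,
  1204188178161771666880000, 3088525168780146374976397, 3094670328348159824882825,
  2622892520998860774770560, 3180563573928929788284928, 3658360048847238445093504,
  2622892520998860774770560, 2835722451477996362398854, 3654189167957683528644224,
  2086535971097706844477576, 1126602836689991086669312, 2252399380815673190405519,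
  2414777996906467968085903, 1666238455890592777412736, 2180571530885641601856256,
  2180571530885641601856256, 2180571530885641601856256, 636711143255294720412321,
  630485305109871797917603, 3711320502358831012034448, 1124196151435732929753763,
  2831178533909553934994562, 2627062288342212771143808, 1204027073196268731900416,
  3740038971844841513097089, 2617433502640929461823360, 1791476455029660451781888,
  1777947069187704312982144, 1836442032613471725204641, 139976752108656602506368,
  1394711550879061449449762, 133836599669552599127808, 3658738014042472280805376]),
  ([38104659655523907874, 20116817216350558409, 38328831044374242777, 25301510419900435328,
  38549912789011490752, 20116817216276707840, 38107843296529035590, 38330992737796783935,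
  25297240207157092187], [3659002077965303537735168, 3658738014042786060443264,
  3658738014042785737707008, 3658738014036586273723904, 3162088539803014668394368,
  3162088539802039790070912, 3658738014036586273723904, 3658738014038467013828096,
  2590384158762284404726400, 2185262791581091772043776]), ([38104659655527687004,
  38104659655498336492, 38104659655486998436, 1595075547213211965, 1595075547220774125,
  1595075547216993045, 1595075547173351541], [3334035591781170506471040,
  1720528041512598781478656, 1775824995807519626598016, 962864381885557099035136,
  631517566225689046740352, 797323006016552521906816, 1665231087216737081910784,
  1720528041512598781478656, 1775824995807519626598016, 3658766488603786131360000,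
  1124829166181122384984064, 1456496935792550562761984, 1290663051291516344251520,
  3442983015565036732216600, 2356171875419658593859474, 3473453764282317841017874,
  2891068042225269977151378, 2633373820654850110243096, 796292509553289242559744,
  3162088539793127726850048, 3334206173509565052488834, 3334120882645370294103169,
  1669069175468848938730496, 2747572838954378894155298, 2274803068562102989312674,
  176823778440917547106688, 795400921622343151207680, 961206361412893223466624,
  3677510985221337438031632, 797058942102834144822528, 3658735536706915974254848,
  3160054179483415942795907, 3332436490584520114129030, 177591293546260384209187,
  1669069175468848938730496, 1669332056623447746602496, 1424288248856957474367650,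
  1127021278575509945467008, 1292826718366060017725952, 1458632158156610089725696,
  3334033729903862964389916, 3387723969133304414163341, 2164072486938368018369792,
  3159786361928127459365509, 177590623566510682298657, 3332376491061026185103496,
  1669069175468848938730496, 177590623566510682298658, 1669332056623447746602496,
  1127030755947546328797696, 1292836195738096400797440, 1458641635528646473056384,
  2660003316330382938834208, 3093435578667355813606285, 630487069758503474341376]),
  ([38104659655527687004, 1671170931621345624, 38104659655498336492, 1671170931581485200,
  1671170931570147144], [1665231087216737081910784, 1124829166181122384984064,
  1840946767913546635849728, 1124829166181122384984064, 2185262791586281040989969,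
  1952405836091155712968578, 3659002077961048228287106, 3217527601454310309960832,
  3162088539802039790070912, 1669069175468848938730496, 1290587237415791993883136,
  795103372511696718656256, 2770546205790285007670414, 599203094324233671562368,
  960991796400870071164160, 643032536718994488304519, 781634587516432403119247,
  3657368669561703825439360, 960991796400870071164160, 757529660941404936994820,
  261698888284745566122530, 1630959568085140481447329, 2273083688194589649986176,
  1776156681869273519843456, 3410469600509509231863822, 1669069175468848938730496,
  1290587237415791993883136, 2163788184041342594641664, 3658736326482347415350656,
  3767402256639963110447495, 2834605392000639255056266, 2596439415318079291598729,
  3198963391689215270186112, 3712133776709783855871898, 3658360050440195410195328,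
  2588258104292632002917134, 2772378897768679725536128, 3268288123616153486328844,
  693517020352043777458057, 2289303459534393273594496, 863370486344106575900441,
  2587274305021597702517520, 825890935927372426499972, 1776156681869273519843456,
  2273083688193926403215360, 2915739600011107727771648, 3654927438789166177438727,
  2944882901514896508391307, 2663857255597079492607764, 2946264373036601947151257,
  2774333191352944399261839, 3658360050441172113621376, 2719045729866232819520275,
  636798725327098319278976]), ([38104659655527687004, 1230151749100573566, 38104659655498336492,
  1230151749075004134, 38104659655486998436], [1665231087216737081910784,
  600218830249034147018752, 1665231087216737081910784, 1091694870388276542817536,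
  2202912996770315409467540, 1780544334828556761077121, 3659002077961048228287105,
  3162088539803014668394368, 794921417376074254886656, 1669069175468848938730496,
  960643550558714491599360, 1456335831255856337371648, 599865180899489507216270,
  635992296661096143257472, 794921417376074254886656, 3677510985221337438031631,
  3764932506995901577693703, 3657634063422793192417792, 794921417376074254886656,
  3677510985225584047830404, 1170387637390567006378403, 3777299550740836175036688,
  3160054179483415942795908, 3332436490584520114129031, 1720945018438442463081728,
  2217872069042609379327104, 228203230468986037255808, 2449268388028176718868736,
  1668668697858963734031118, 2630005027924219552193543, 2772959123076533868046089,
  2455374643567883165364736, 2663796232710010901463185, 3765731748465773560102795,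
  2774314209186083576771351, 3658735931594631694804480, 3777299550740836175036687,
  2479034625233471257890048, 3658416822660069671419264, 3811049211595898994757271,
  2774375261729319006659733, 1397596483545859313215906, 2217872069043899539408384,
  1720945018438442463081728, 1669069175468848938730496, 1456335831255856337371648,
  3658735931594630673593216, 2662693441234830218438412, 2633373820654850111816587,
  3269550416305678230661147, 1723513177231935040948366, 3213017002224341651398922,
  2455374643566593005283456, 3658738014042472280805376])],
    by decide +kernel⟩

theorem exists_checkReps7_11 : ∃ ds,
    checkReps true 7 reps8 (List.take 11 (List.drop 11 reps7)) ds = true :=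
  ⟨
  -- Extensions of other representatives can lead back to the same codes:
  -- `3659002077961061268829320` has residue 8 modulo 128, so this extension is equivalent to the
  -- eighth code in `reps8`.
  [([38104659655527687004, 38328831044445206404, 38549912789034165484, 31647204912245967134,
  38549912789059734916, 38104659655486998436, 20346592008707986883, 20121393912647718299,
  31724325416654210294, 31724325416657985542], [671931318489718502679680,
  690032609014358616141568, 708862525952338743129344, 2166749570005443036833152,
  1128166971679100361501857, 1091141347783799350502179, 3659002077961061268829320,
  3658738014039411021731459, 3676072740351663674833797, 3694437523674520485493766,
  2185812851145286309768192, 2167134020264723022370048, 2203594550635246060367488,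
  3695669089949287673464064]), ([38104659655527687004, 38061585538862491397,
  39438015470494019530, 22140412883527019833, 38771338356444236575, 25148132733529099684,
  38107843296568895360, 29547675794443793072, 38061585538913689877], [2393999894090553678886144,
  3162086937778357039423232, 3129451537678683711035408, 730332969265973724570000,
  3217413924580596776761104, 3315745806489327516944144, 3765730708940526370542464]),
  ([38104659655527687004, 20511568073730678553, 38059408719016419115, 20558901665784978838,
  38059408718979511627, 25178000815952696098, 25224236053162048909, 25178000815915788610,
  20511568073693771065, 25224236053125141421], [3654984720364795253176842,
  3654984720364795253179287, 759391446391181586338065, 881555489611227112337684,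
  797323240717493641686912, 3677331685725160621855628, 3475400126674757706334208,
  3444629428058760754448534, 3677331685722099370242329, 2164081963701986482761088,
  2184911888185614227940608, 1591568019908891366595072, 865404363458615364354065,
  2586549223250016598309376]), ([38105002420377661834, 38104659655486998436,
  38071182954756503057, 20116817216350610816, 20070886725918797723, 20076942238292484179,
  38107843296517696880, 38061570041260650245], [2581323583847174792936192,
  2163418590298658774504960, 2162973182456395691913728, 3656368823381319191762432,
  3655932892284109825109504, 2580233756143555850623232]), ([38104659655527687004,
  25621194721561602859, 38062603096716984599, 20292655587908778245, 25621194721524695371,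
  22635141583663888274, 38062603096768183079, 20292655587959976725, 25297240207168473526],
  [2912797145270280174386064, 2118790277004118739565696, 130851507032966471833344,
  3655249674833037563405715, 3677331685725160621858070, 137863434039808677502080,
  1357742876104293913803776, 3695669089947406822396309, 2219347094997297463195008,
  1131001514782343929519872, 139295218870090039347873, 2181339148658203088770323,
  97947704377189169245731, 3809574393197752332012048, 2375634307085868370115840]),
  ([38104659655527687004, 3606507006459561790, 26776998452717174924, 39146424246846842550,
  25224236053162048909, 26776998452754082412, 27966759818610915664, 38104659655486998436,
  5899502882721033872], [176991884668593259776910, 3439546224196570399163022,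
  2449910958572047180217601, 2222691569456059502738178, 3217526188565710094424832,
  3654127979119142526801152, 3654127979119142526801152, 2389363376123483229976832,
  2203422663342193948379648]), ([38104661242398228871, 38104659655531468084,
  20116758854639400603, 38328831044445206404, 38549914375897150375, 20116768375892900429],
  [3654397651250491986931456, 3654397651250491986931456, 3654397651250491986931456,
  3654131021945719800386816, 3695669221572485541130112]), ([38105687950085173639,
  38104659655498336492, 25223207758604562274, 20116817216350610816, 20287974307862476148,
  25693403852359863925], [2163039519796072615281152, 2617272405867648915198976,
  3677331685725160627814912, 2617528278459918282594304, 3658738014043099516601600]),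
  ([38104659655527687004, 1607509071549125421, 1607509071600323901, 21594308641575870652,
  27446530868204566093, 27446530868255764573, 21594308641538963164], [1791314504408269473411200,
  3654131021945719800386816, 1280826357893425716124544, 3654131021945719800386816,
  3654131021945719800386816, 792803380000489133200384, 3162087027760601003886336,
  792803380000489133200384, 3162088539793585543723904, 3162088539802039790070912,
  1280826357893425715462144, 3658360050441172113621376, 1590179374354152519778083,
  3657368669569842787702656, 1791314504408269472003456, 1172509618063912636782881,
  176906593786836874179586, 348937596676296757286401, 1283130935655488202893090,
  1282187454062400312634496, 2289575876657993596098178, 2289303459538505159038593,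
  2774710179911617182484352]), ([38770994531225383303, 38104659655509674548,
  39437329406930641762, 38107843296517696852, 3606504176914622782], [3162088539796397959928576,
  2659567381697861037190912, 1092591145278977224021539, 1670010426720846657480737,
  1780378001274460586956322, 631253502310137872656256]), ([7592089428526743776,
  31230704295983975577, 25190454605565911079], [3658736656228868546083712,
  3121789793893347548880278, 1088338569825932648548128, 3086533447217734107816213,
  2221115052329465710517888, 1725275127602830620465176, 3765605781015123642797336,
  1397990944440511203492502, 2221109557124105421094281, 3162170945024536050948369,
  2696380875732453522837661, 3655690499164192014417280, 1461213668552263452004237,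
  3766651001236987324764677, 1455561273447081087523584, 3119188367264794038971909,
  2719519143122560624578720, 3123944195699730627475356, 3401818809851365494552064,
  299595324049083416939669, 3085459225830949804088472, 1423667131969780595365772,
  2162011188671548296515072, 3656871089028963446363008, 3711786118236898510938521,
  3655068821156306321356183, 3658999807790607903333260, 1905522887306895882866560,
  3658160933757982593844736, 3674753123706595616281999, 1455551796684404444286336,
  3658416806826645870875528, 3131267772558838134482823, 1481271147314729452804352,
  2581645793773668531076352, 3741356361583166816280094, 3118977434868508165236096,
  3240052939585164622775827, 3397936864303685592934419, 2903670206449403565323008,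
  2184041897971995044753664, 3657320804088143112565504, 3654320851139148230888192,
  1290524729266014683790366, 3284789986234233703867776, 780168890739562408554752,
  2475723505783252800954368, 3389304071714180955707797, 728451483914850672800512,
  3657320350724496544753280, 3217527483556714084330624, 1422539059388313033928070,
  1409669863785093916150016, 3713263572759339075345053, 3768171226260719156067346,
  674504176968415304418432, 461779269931820212670464, 1091851241477442260546444,
  3284789953583329390252544, 1701498865072390974885632, 3657085712403154020429568,
  2786991758192400254258304, 2973919741703164717161741, 3236681516859247415399300,
  1249128128533905898012698, 986183145469136412688640, 628180859338578741468288,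
  1920798655720303165663770, 3217527483556712579401856, 3244103631267312692304781,
  3586949083354405576737820, 3084453867616377908446236, 3090824050871383339957014,
  3654450140959667679801472, 1629520102096928252792448, 1103986597564604711328923,
  2475391380350321871107200, 1483548657963182489188127, 2180306181529715023937792,
  3217522738428164647607936, 599402106489587974257408, 1624812515248636941722752,
  3654611245925170614773632, 3713559730003675517431819, 3588468843440822221018240,
  1595375697769768279662080, 3654831131519272611172224, 3658028485937550687124608,
  176085863921880734674304, 2719176484571506695656320, 3781441949137885552629149,
  2660069652348856071957760, 3655595325119449999925120, 674504176961146732602112,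
  3267277749748689022678176, 365259035493617531739035, 2164078907153551493821312,
  2741458916241978169254788, 177085572184619113856384, 177085572184619113856384,
  1281420412432379642816790, 1381103944872653039101970, 1592660914276026301300736,
  960143734724866659496064, 1790617955039188409259807, 2714921417876662307172352,
  488056630518806936052736, 2714921417876662307172352, 1893406049978382144909469,
  2391073014954792892689435, 3198957398662926357583104, 329079908656394879407903,
  3284789953425347235443072, 2619101416922613035616000, 3241978828339756490423327,
  3128698063919702910808605, 3118978424073144020640256, 843117688605773991780255,
  2274083939149258917716105, 229152774764915235749504, 229152774764915235749504,
  3284791901716312964551552, 2974461549890039231091082, 760452862391897461809695,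
  1453668377689175791178130, 1777961153319372941225088, 1686662598756178418881408,
  2625849274679895782703104, 1251610948588844826468113, 3658738014042777199047305,
  3656865356172529434129920, 3711063460669600071301786, 2337721531787966343947915,
  2785361763314176897692544, 985570196074672837338624, 3807779631584753431455616,
  3654843061978809074479232, 3217527483556714621810048, 1453327214248671513324308,
  1904848712989529049808287, 3658028485937550740875776, 1294147625137184696107680,
  2285707145096164858573312, 1624812515248636941722752, 3312063325412997500107538,
  464767177711794534301696, 1278434742805676115119391, 2915868214209696979086872,
  2274595144109096419874816, 2273121630244353563886848, 3657145921877878560596224,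
  962219343869134107301911, 1720124467228529751297664, 2389331618945083162275098,
  2222520870731265106490763, 192624172318424475975327, 212988546918737098917632,
  2273318501327365141597184, 133459223230974133473024, 841875664111571145931934,
  2697360758540407377193984, 3657075386802338292661760, 3236714827067317210604672,
  3657320804088143112565504, 194531566594221413546397, 1719764350246817308414976,
  796413904078873664135704, 2161764807470627293038336, 1778076208805495641558426,
  2338916640461580843837466, 1839371436444518191190431, 783897188813099184159104,
  1407341172961057424498176, 1668657608867572714134912, 728450928178767783233024,
  985489538557620151723264, 2783371632748664618154880, 427064301530558961908766,
  131248887966737999438592, 3118977434891077044499200, 3654160737669653598943232,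
  3654394101125320889148160, 1129523820169238476423684, 3658690630229089064638080,
  3654394101125320889148160, 1294469250745023882235776, 1171062017537934228405016,
  1407341172961057424498176, 3312070754727261060147352, 1169646204748502099131648,
  1087938080686151098270619, 1453809455077635371653263, 3658408045491729022106496,
  1409966115975777493310336, 214155308690974008899603, 1754997853560450552028045,
  2740287084757785251899149, 3657469568512469340356507, 3659085098640055306272522,
  3658733637681848147619328, 1720124467228529751297664, 2161812191284010509203072,
  3712134149843888526658716, 1920733917971600254846873, 3764798426731694580815771,
  729773919783054981309440, 2184041897971995044753664, 3655329933261687150670976,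
  1423752422847259804720266, 1588952112390388641708059, 2219325377414270018226432,
  3176546528629480239739284, 488056630518806936052736, 3655329933261687150670976,
  729773920414983600583168, 3270643298520764905836420, 1908568798102082754782976,
  729773919783054981309440, 3214315059549121212208263, 3214315059549120083512218,
  3655798521162144653024512, 3654577715227425901227904, 1461213668552263452004227,
  2953291957326640406788611, 3769274973902838959752448, 3658738014042472280802176])],
    by decide +kernel⟩

theorem exists_checkReps7_22 : ∃ ds,
    checkReps true 7 reps8 (List.take 11 (List.drop 22 reps7)) ds = true :=
  ⟨
  [([7114053230445659473, 25189426311005069130, 3458429943718221451, 21051139332213936292,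
  23847100146513702968, 8318393807380210670, 17532619504352880641, 17523027636363918993,
  38100787318153559582, 19679684981501550520, 19665993527137595338, 35894235199403448149,
  3052504634232791843, 26095605410802465096, 22856837057304541239, 26064347582032634166,
  39559913824165199140, 37181429099150821471, 37170583136976385237, 31259046242097795803],
  [3654323438393255198901279, 1725190478682665965174026, 3658142288425482349503872,
  3094416285680114022694297, 3781135828207802761970456, 2357089719808826358938270,
  2588356131547412110499864, 1280075514649137511381522, 1624812515248636948427264,
  3239289648006083916225044, 1787670994222644944781952, 3654983530278411058429209,
  3655329933261687150670976, 2974963712185325930193024, 3349656026128026680249873,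
  3655329933261687150670976, 3215374774513560372267785, 844652265173514142077708,
  1952410706150412043522592, 2129361290689598135556608]), ([3458429943718221451,
  26072842043854874044, 11140831965116234029, 38077890079234640314, 11850786686240900707,
  22145673372314025954, 19663017712111400299, 15442292475814758384, 33913886053363872692,
  39133930832604190094, 16856692939430690988, 26096825669147779505, 13560767205422682957,
  8353003699776793305, 11890717776386283370, 23555660677566263299, 37275946476142263852,
  14546951970834581174], [3272710790527472587636736, 1978377950282626855799956,
  2833430258171578377001751, 1669332061204917237244416, 729225642559108047396224,
  597505864375845664682776, 2596619078871583740085279, 671044518773482598113675,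
  3213100484785420815516049, 3385547382585609980615070, 1292440326641223060270871,
  3401823383775031090059776, 3441637065951655602463244, 1104279294537295224920852,
  3655697654057489104133009, 1187718713658880237403648, 1979217934937788617323794,
  3710337301082435765117336, 3162086251287127255991552, 3654321841125650762403584,
  3769536767649109884708618, 2953462144167067288271772, 1704767507843600928737792]),
  ([20084368810282373764, 15429512769057633003, 32116856319873744464, 31674227706955190765,
  14543868673753003181, 19273452401486808228, 37295571325929056292, 13582988421994834084,
  35595397335966096939, 21123016496103278818, 39140450967549654946], [1858296567398145395837335,
  3584333420762020024741272, 2402227540704071286618496, 2585496360838577897681054,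
  2739020853531064768828189, 3315640111735493658207127, 296449361688448987592576,
  1622595347697193341955340, 1185405571466939967824539, 1751866286278167415155360,
  2273949437271119588624640, 3212012216068661338346520, 2588301612399087860061568,
  3657633244444833555967360, 3655696056118780089456263, 3768796291679141318459269,
  143418272901363236181658, 2888698738304881629813523, 486543744828613180398592,
  2198621882659122631469184, 134131411232918311579551, 1132633521844990369671069,
  1778505043286063299105299, 2122868619359413005502976, 1687621130163239037249684,
  1721620700779717772447488, 1127014770608471351128704, 3118977831584298280115072,
  1484201975850648184065024, 1380930071220391501613715, 784333280786495111634176,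
  2198678743235182490871168, 213930610943139319452416, 103132470177601404609408,
  795195468178868628229918, 1380685627688649725236256, 2289570812478409271713280,
  913731008182925556861440, 3658237332141845601631104, 147006689541543093853214,
  1459175683053980809312640, 1105110948612970307153311, 3331100107174617271818252,
  3766233015979435859517190, 3217354134100491524310413, 2403103000540027373155328,
  1188140144688842227117568, 1323115828268798951305118, 3272711965798076031335936,
  3334033731731942184409881, 1258290454261497041007765, 2092325598989586538790912,
  757855027964942716497937, 2716494562633605168009344, 3384119496069812614759067,
  2775339571625293604324502, 1411037819773442096219929, 2162737979702924782947081,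
  1411806443984030792992530, 1905522988799145908279424, 847122804744095067055635,
  3272706327550383869044480, 729774329904728887636480, 3769274973902838959752448,
  3162085654170305288663936]), ([38104629809996060956, 7592089428526743776, 32116891109960150092,
  20084368810282373764, 26072842043854874072, 13582988421994834112, 32116856319873744436],
  [2218049067848718758762010, 635791105420969984114816, 2448258579193015671079301,
  1596274171345134576235528, 3809906096636468492316820, 2334153131481186253108363,
  2185177237536873681030144, 384403883963149816963085, 213937353962926513973398,
  2245787803877368915940511, 2587803709789644128580873, 1409295136491743801384863,
  1130555691701553828923392, 1130555691701553828923392, 3657155399249915055814912,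
  2478863897253973931865600, 1752212194531123390263172, 2334063139014899339157123,
  2370862817278496556739087, 2217090163007744081080320, 794072770355565752089216,
  2373150415278766321324062, 3125374049444681889661056, 1422930313484778834249118,
  2747740971394589515651993, 2217033302431684221678336, 3692134049242936278258948,
  2219620091352769068756616, 2164187745786633995644556, 1667532328424096302241413,
  2403179063259589679979392, 3450607432797101072834688, 1822885631726995692993818,
  1860328319231784032248207, 794878367375743200407424, 3450609759508883024926080,
  2094466403756974563998873, 425586357459968843633937, 3125372589932084492522880,
  3267309702820049736021130, 463087247056387378726944, 3590359508734980124287123,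
  1483741031362674821778432, 1092113113182207505709468, 1357715075110254101105158,
  3194460572139121153928219, 3450605696612509689725952, 1281370287043342724601216,
  3655330343383361056998016, 3213949761162678649323143, 729773919783054981309440,
  133156298268610104739584, 3213950214526325217132169, 3162088539799232117073152]),
  ([38104629809996060956, 32116891109960150092, 2125760375981276290, 38061574802156591669,
  38061544258982590877, 32116856319873744436, 2125733170081262194, 34134393866664584458],
  [192109795873460246986880, 3329424357036764123394688, 298104129540419520440192,
  2090756890688025938019998, 1128251472764137562530078, 1398453305133979124971545,
  3401822058551879262346240, 3088584660697971178185984, 142652779290431032280733,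
  2403915808438228574457984, 1909233947985153418187784, 3177732437348960039159711,
  1687491497562566642201600, 1948071080091695678852382, 1127217598223373053626122,
  881819776695065783648788, 3657199520845011323556352, 194433384669372988022912,
  635436123557654654687772, 3658997805136477168504832, 2899282461676969834260352,
  3712354065957485915084438, 3214182910722245533225365, 2199172174396884233358215,
  634974610445869071215125, 2090575855112418043705879, 2200347911194878665864192,
  2661026806641732512283929, 1950072772338743147795085, 2479708266360153226482205,
  195246599304075645554816, 823054452211998618510874, 3676288479746008338587416,
  1123958600428937060107392, 2389218459156026362675994, 1134808482460335730106496,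
  1950192163713689478686997, 1481136767572185642673280, 3123424573425653324940190,
  1087570827807851994036608, 2619707937595465774597504, 260386816108508517499544,
  1668628960293337972935040, 1133662455828643443484672, 254238723420412360314880,
  1859043274657914070617873, 1638080455670157988557855, 3712596141048496013278229,
  1837078472806468005706395, 2317076264972048990950430, 2092155265880172777516928,
  3655089458293061147300224, 1626348135127698116312704, 3656378297188426388973312,
  2660236045292071205861002, 1456062901256320686121600, 2719971449060008899410844,
  3441826802947075584792979, 193109679494561104813184, 1779633306268606815324675,
  3658732778423586110670592, 1622514787901244941832843, 3312066731375129250377623,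
  3767403354382208958867986, 193110862261818236123264, 133070744112986172829440,
  3162088539799232117073152]), ([7592089428526743776, 32116891109960150120, 20084368810282373764,
  38104629809996060956, 26072842043854874044, 13582988421994834084, 32116856319873744464],
  [2161942407031982228778505, 2203600064112351011380992, 385879092014757517355926,
  2198787586766792944711821, 3238902431876166250912671, 3743834406772875395570847,
  2624642558964602371810571, 229737195108049660227200, 229737195108049660227200,
  3765566461410579022519323, 2393253578311209370076163, 598945057269033285122048,
  1135043637725854481786246, 3471382306371899766492049, 3657145921876938246614144,
  3738122041630541088862991, 2272301767534113885325056, 2405115818122756106031360,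
  3768169838701513569305604, 2334310586508709862191109, 1665181630180962320825984,
  3735977310551204077542814, 3448643515929927968658718, 2913465544272761737198871,
  960143734726155314641408, 2164181029694510636376714, 1667539248945127995399683,
  2476869989322768691972096, 2272358628110173744727040, 1722971390082354734621316,
  2274809996511194949000710, 2287323752128265026908672, 260047609804555557607060,
  3088583797854259276202112, 3284794843090860667807488, 2088379416488176001941527,
  2852856708067836759419023, 960797396899411012830720, 1411386037375190964075163,
  2714892819089206754524172, 1185502235506452251020296, 3673766886393030708856218,
  1409964521875721394927360, 1128994235088651109405600, 3584159807517831190910741,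
  426247726524909970047900, 3658734357098243563471872, 785042399714178743754752,
  2090577311779479573243648, 785042399714178743754752, 2899495254269083489976967,
  3269141010478207955521419, 133422057091709224262400, 2164063010174758637323136]),
  ([7592089428526743776, 32116856319873744436, 26072842043854874072], [2339370768881973853442081,
  3657079993557307079448832, 465447479247627660998656, 330431251645034286089230,
  1127523546433150057520000, 3267280693475309153089294, 593809529526545647769479,
  1423435047988567963861632, 3738739471552504624997776, 2182228135885894594448931,
  3658237339703360571734912, 1720218388116088788335488, 385786658772019562375943,
  2616978621637343921547392, 2950892392464781354963328, 673466557702304017595658,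
  2623461122196232863743744, 1669331967047557653739776, 846351679812912039529868,
  2402382868947760892278400, 2119664174109672173787921, 1423519235257030835483264,
  2285469628931095779140623, 1669068122946582753457664, 2199389500431681679215872,
  2285469628931095779140631, 2181307574069223486130304, 2285469628931095779140626,
  2376130736462131656362768, 2339285478016145647597703, 1841284921141962781376896,
  2451275083143159644479384, 2889255680517116106849424, 2451275083143159644479379,
  2218817784934912372127504, 1724606975974586666179840, 2401751000999465982198034,
  3658142286763152024103680, 2285757583118835788376857, 3658057127543334956529792,
  3386400634030738381041807, 2451563007878512219877268, 3658057127498197198003584,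
  3658997332968922199225856, 986325794213845643362560, 2119952157749799616867093,
  863007989225848952494616, 3130327206084227780110599, 3658733459618679779853952,
  863926079994829561829898, 863841183973282420266380, 2786726408431215867480320,
  3586639494683735870681749, 1289755927097309401199620, 3125374531223312602684672,
  3709293445254382561833611, 2476660959431770323083264, 3267151118784240415670153,
  3083211341257038142606355, 3672746046388791475114513, 3088585665231640453611008,
  2849959299042199752452116, 3076823739834159645176470, 2904066965521991613807124,
  172984916911299963810176, 172984916911299963810176, 2272742568823869833746333,
  3577427204581004797886336, 209723470285392144592640, 2127780405603562566883328,
  3656368817129740122102400, 911551759692000637081600, 2631601756515765518205824,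
  3655192566043457967874944, 3176859039805746469276928, 329046844051706321080477,
  3658733812859505939753600, 3090376544100544571510532, 3738517522469046027707409,
  2678729487238648473515648, 1591212064538222894349184, 2618551761820203788032384,
  3658028480526348167278848, 2623660131147424003287296, 102802097599123970105489,
  3088582711064364324474880, 194803928956397015748235, 1134805104159976176723200,
  133198896016859668829962, 2200430657359772342061568, 3118975142466269357123840,
  147057950646226465173908, 1134805104159976176723200, 263621642452876718402569,
  100498066985995584151308, 3125376334466231073613312, 3658738014042463197457536,
  1133153779820564249556003, 1096877141918450841504289, 1252921867127529959200133,
  729772641657232087755904, 2586056431587797392874368, 3311450463690262601509120,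
  1744425035983093953627136, 986338326443259359712256, 1289757024147346119685635,
  3781822617809365213359104, 3744976964522576320376576, 3654517841971672355390080,
  1248095485766472955092739, 3654015480391605861974784, 1958696000828313755120896,
  2975051391267731426508416, 3655983663535358117253120, 1407758113962249950895877,
  2911027777212854098302736, 2873490570607248037768848, 3654835183577684610678675,
  3812383717010164391183360, 1168205040027670933552512, 1459514263223445751630336,
  1723066596206036347541376, 1124964820468216478585366, 1226420254008730153871124,
  1282454278403304457023249, 1459514263290838933251712, 1293708823499975404420480,
  1456319827456943146465809, 1290514387666392644229778, 3655091056170058947273749,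
  1169613977133483395400192, 1480473512896812056715392, 1226505544872856222682002,
  1291026132851139866228244, 901403940450461730279296, 2389544301216064911281792,
  1720559303359904905078656, 230581171878009894895232, 3658057127493251560977792,
  796373066895422062949769, 1460280695908090470722176, 1460280695772990651570688,
  1294475255982127122742912, 628628252596702733096331, 3658057127515820440240896,
  796373066895423030408605, 3384575838654262528256157, 960239132177801802985996,
  959983259585498574616202, 1460280695840070376533376, 1294475256050147217674752,
  463791078443898887992099, 101474583049243499107234, 3656515610831445434903552,
  3656515610831447208577408, 412358650941827699040156, 463226054174860857948160,
  3583389723392025151323810, 3676657595813465218852102, 295991832241301984432544,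
  1325829416540050636726278, 3809479037232692782408968, 263233573960967010196864,
  3654835183577684610678686, 2623461122196441834847360, 192111662978161688299520,
  2477323777086602281925504, 1093623775142022830799616, 1342361244630917808750464,
  1093794751757882815070080, 3655091056170058947273759, 1093794751757882815070080,
  2199389500433109648426496, 2618561241043840289332736, 3332450597101900412888192,
  1294475255982127122742912, 1294475256050147217674752, 298554654038024353585313,
  1103605510102991141461256, 211447423381803422564096, 1950280090539445131865503,
  2089753155164865202896896, 2125064353336373735249438, 1096619413689089221613056,
  3654131021948536556729600, 1294736552944969787548160, 3654131021948536556729600,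
  2619331323074387976914837, 3654131021948536556729600, 3654217102587987157958144,
  2586055490898332548202643, 3654217102587987157958144, 3654217102587987157958144,
  3654301998564396541000064, 3654301998564396541000064, 3654301998564396541000064,
  3080078075639886440993939, 2622478398035825464180885, 1456575689687303228725760,
  3331232938230193782804870, 3654852537523149246123392, 1127988935026845086768640,
  1669331967047557653739776, 366022974557410861401738, 1128074094291799912868736,
  134688128858055512440347, 2891886023911055463638298, 414679133758685368390144,
  297727265938510387732352, 1128074094246662154342528, 2696589379385902850494231,
  2098877012751345497349639, 3658733812859331797170944, 2833715834728904992928648,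
  3441769898090561429386375, 3175162637934502222406169, 3331232938230194266534300,
  2833715834728904025469856, 255292479606491238028940, 1774900149789292422347904,
  1127268578599233883245859, 1127012837606099479027489, 1723840542161184521977856,
  962449261655157836178560, 465448062520768222320640, 3658738014042472280802176]),
  ([7592089428526743776, 5565961592931775319, 38061585538862491397, 9591437349450599030,
  33596231217373241897, 39438015994558148002, 25555379108946746361, 11590785270363114923,
  15449903341965385702, 35595350628375694288, 14116547002931143624, 14783225172448267579,
  3566614024642882606], [195417450123610281965848, 3212278087175450482441112,
  3654071161787872085726208, 3658028485310959892309760, 2162701822376242440467328,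
  177085572184619113856384, 1480269052764384415629074, 1398542144992344285684754,
  368146721470235065151762, 1664405474822811014882304, 1097135283179983479425808,
  3654776628529939681921954, 3162170945023456366910880, 3334204313448296885266332,
  3654517387194473257267840, 3654261470525496313762304, 959848241938830599901056]),
  ([3579060056316961390, 7115081525004372778, 17475376687587555585, 25189426311004649199,
  35007179892373841515, 11154552807029973151, 38760204316423841980, 16181370601726271842,
  9147140037353224488, 39392554514493265145, 1170921842232037309, 28382433625591134119,
  32291512847570323337, 29896443432627278512, 3123593090009710168], [3442296310597235365309705,
  844652265172859645070731, 2129643408438432852292992, 2372861455277393918947345,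
  2127289650990232486344082, 2128962529364456804398464, 3475394561579599859066112,
  2375715247091695841033236, 3655667537645885203616000, 412366605013451118833152,
  2203328835660458709643136, 2286187608202865751387904, 2627826613130632072323231,
  1818123307595383958865311, 911551086778297115144832, 2475552485315824803756928,
  2199661577123371736784512, 2475969155756349123710720, 2166618742622423376356500,
  2584444900205888743525248, 1339897567677315970610688, 669568462314126201538176,
  2217286359086554665589920, 2901765381239184391185664, 2948633430974701302086280,
  3654572903722918808626048, 3120821858861261227634837, 3176095961135464287003022,
  428536642886725064755466, 2622841870475618149408532, 3659003765278181366960256,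
  754837095843272876069903, 3655064627783839762450304, 2677960643890209261332881,
  2164617313045063803165824, 3655159351533435012305024, 3236993644482566484056591,
  2680691183647277217972992, 261904783268230036959116, 2700641455559996124312334,
  2739777324755840625999251, 2200712013185272728502683, 3658735771311494218721792,
  3657199520843931637192064, 1281307201225616053337122, 1227186181445733743267968,
  2679388582650507428518288, 3331233069852546626746138, 2949015987980771183529856,
  3654577715227425901227904, 753242633781183050011014, 2242106517916974724250012,
  1896477046695272749146368]), ([38104629809996060956, 7592089428526743776, 20116817216350558409,
  7601329720433473968, 38076095917807457609, 38095419218316955242, 11600025569620264634,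
  20084368810282373764, 9600677656046830849, 5573319816235135363, 9150368868626711215],
  [2621186308849328278700160, 1779870308033363940420096, 1724601828103494111352704,
  1669333392046585086067200, 2391345473710312066056448, 232356337523687730747008,
  3778657708416162359202712, 1141957683771232783158040, 1724601915851296619361792,
  3388207422794915625498125, 2221020027472261327924736]), ([7592089428526743776,
  38095419218589053061, 19217425519693765790, 5890727902527554351, 7601329720977669606,
  3086554455218405006, 19744926244618366391], [3195227597043779959333765,
  3657155399250123914944000, 3658737518381476069322496, 1720791175032396819677696,
  1290666005620154478281600, 462700205351043610559488, 2717759853233317682270979,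
  3387853784217482802515203, 1779165926541015543874560, 2217857265931648237121175,
  899853435548088212056085, 1779869045349716145643776, 1776563202813597384383006,
  3330370915084386857107722, 3654025002021214310739072, 2164568876256591546145664,
  461930381088144307578880, 1459514263223445751630336, 628180465647014107644544,
  959848234874771391675520, 794014349990066440412416, 1622887565207985203550720,
  1788533377391900446100480, 1290523953395905269462423, 1124718513605354767226392,
  3656368815956158883590272, 3693471659865653933545501, 3475400559771141625142528,
  2480446117875304044697241, 1953749360755389159040669, 912202021760978265149696,
  3659025766919907056973339, 3656619182486696257902208, 2868808286939683153654163,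
  3366334867248159915709206, 2953378576411555979712798, 1123995309629746755688351,
  1292258725701975254546826, 640398786773876483294861, 2136214249173890507245597,
  2975616609082555809025693, 3656619182486696257902208, 414209768712087182582302,
  634688140638032471526400, 2871458320273886049753119, 256608465414827569764243,
  3714295450240868551560862, 628900158322929182618752, 3579028379736914760774528,
  1406668572760726628525696, 2289570812478409272872704, 3366761321568644173482389,
  1787408299464399292122752, 1422718263810482258721178, 2477546623287766214893068,
  261214185437099791900800, 1779137533875307347336832, 2131075075566238140677642,
  638824794102170089726348, 2914093631031436605430167, 691154207161747128444416,
  2582562332780595627806105, 464562033147797957144341, 826494866709767360930067,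
  912226488908440198273280, 133779586570903356552471, 2855210820866270157098784,
  3657325981208494233985152, 3159658559834033364183305, 3657320657841805512366592,
  1290313911920156564705152, 3158187253424438945207427, 3654843061369832394408320,
  1669067991189465634140416, 102734004187494838956569, 3655159761655108918632064,
  846270710460391767082116, 3217354134100491524306820, 2402337823714082462995350,
  414660179014612545914368, 3196626929642420302557067, 2715329887445663332487564,
  2451711673279427470167321, 3655159761655108918632064, 2451357446794368385498624,
  132254924154489612838034, 3657325981208494234568448, 3654085328723371887643008,
  3162085654171227358630172, 3655159761655108918632064, 1290666005191345772343680,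
  1774900149789292422347904, 3162170945023456366907269, 2774437104770819980375813,
  2135908286008323209777024])],
    by decide +kernel⟩

theorem exists_checkReps7_33 : ∃ ds,
    checkReps true 7 reps8 (List.take 11 (List.drop 33 reps7)) ds = true :=
  ⟨
  [([9152140741954999672, 26072842043854874044, 17592374808123814394, 38089309166557180168,
  21416980378742367702, 33450603351266181470, 1640523672021895422], [345575764254371173295901,
  287621159784256544536064, 464919115513152058012672, 3767824936295710395894670,
  2717319035935312447331968, 2219640667488785031519118, 2402595755411499787005831,
  3162085883281454165893376, 2476286798697193605744271, 174455768564565706656260,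
  1226329169829674587463424, 2164077137572842832793472, 2338805607519379034995840,
  2449825974458110559983630, 3270643296692685692523396, 634454564226367504250240,
  3655691828177784980533888, 3215374772685481158954761, 458033523949130594258697,
  3655695966949139105363584, 1411037819773442102928025, 3656018183145379458938880,
  3655691828177784980533888, 348440969151894525156123, 637392758748614235255296,
  1621747170127257949803147, 210948784563119571120896, 3657145921884909883878528,
  1255278106655954349266698, 404892217033049541080730, 175550182083749081386762,
  348768787419985491436552, 173689468829740430498819, 3658735769483419339832576,
  3215374772685481158954755, 3244607537247505848343810, 2333997435328364962631053,
  1779608601476090469228032, 3410162083433946608180482, 284165114823767686845216,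
  3271086990969842929744645, 3389302211663104477155714, 2164057686808069908003328,
  196009778506900653001857, 1957196338839536633558400, 3658733868590729895161344,
  1253922929789846184874786, 3658732450949148077238272, 3658737197771247215041792,
  214608167491594093121793, 2219325377414270018226432, 3658736919090726115089920,
  3658732539509430291432832, 1088117474742733786931361, 3658733867958801275887616,
  3658733868590729895161344, 2660770934060196100547840]), ([9593164861403811017,
  26072842043854874072, 15590166113060303504, 38086111078222117714, 20750645681809139697,
  32785291825564895554, 1234104781804368726, 1714559293558427844], [3764752872374189478774813,
  1290929901494138411256832, 462091486053647241060352, 3712637557793368397357326,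
  2320095821511347757624452, 1223530527387627216430592, 1281863408628092820880512,
  256061487138570860621711, 2772530523058579813617152, 174455768564878841320455,
  2274614112260963187571584, 3654568238461551914108800, 2339284209509079927747726,
  3655691433312673453649536, 599447019701787918280576, 1295243137144745778140570,
  347235945801864093521676, 3215105788002195389355788, 3655695966949139105363584,
  2161970361928937790917385, 2393638332060071216057344, 1129437697354196727084699,
  960144550995325495059456, 3312066731375129257085719, 3271093664406785939218308,
  3657145921884909883878528, 346397508467394275286283, 3655719863397583308772096,
  3270374178965856687299467, 348768787442554316952069, 173689600451444219018630,
  1724340531667894494886144, 3447263433681986955950849, 228958080381628526041116,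
  3270374281338293009061637, 3281196907865489712265985, 230553399773885099821453,
  3658736179583501072641408, 3215825184476601148471043, 3444570691593079165686657,
  196099639862435951201410, 2274593944889136005875200, 1791210694176344365109376,
  1088169516704880101751203, 3658733473725618368276992, 3658737329212400023566592,
  3658732583112505022067712, 2164057774555872469513984, 214432517537905813541122,
  3658732275588956229277184, 3658737577424934118600832, 3658733473093689749003264,
  1776211136596440169250466, 3658733473725618368276992, 2661537497028716084819840]),
  ([38104629809996060956, 38063055539315611508, 32116891109960150092, 32116856319873744436,
  3606479982274715710, 38063029048473475652, 3606513698653994950], [1124509517249267269628800,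
  926370042321890189107074, 594406870866733395596929, 1171149944951518926937891,
  3658737430772356687341312, 1624421970086035780238881, 1753695744881032268525346,
  1625484929991960589392033, 3658737430772356687254912, 3658737430772356687168512,
  1170305155082517089748003, 1754538184923463349688226, 3658732773774397007153920,
  3162087954633330665801472, 3658734014340552155457920, 3272706088365401499686272,
  3217524374401256363460992, 2625763983993278165481728, 2625763983991500996972032,
  3272706322901194765527808, 3658732539238603741312384, 212075716241900351778560,
  415791577954720732682752, 3658998442498283522235776, 3272711973290943938295168,
  3217528784224850388010752, 3272711973290943938208768, 3272709863832695302038528,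
  3217526674766601751754112, 2944353842043174138182272, 710483336683684872805270,
  3654217102584717254655488, 672640111531730212220309, 710312886622346895376531,
  3654217102584717254655488, 672896115790841180316822, 710397914220460120690197,
  3654217102584717254655488, 673152119982245510637843, 138927924719885311333139,
  144642281127610613109781, 132190078146202451404310, 3217527016295487043163520,
  3162087954637124125566720, 228385589196167746822784, 1779013977228175146942464,
  192624172318424475975299, 365847421770670916888965, 2774710179911294857479424,
  210985816671278928985224, 383666097851892901066246, 3712638372289711054815104,
  3656605735768611893661184, 2402026246381561827960456, 2402538123232939744730373,
  2899500199765007387440643, 2899756203956408331662726, 3655794133759931097732096,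
  2402282118973866991244448, 2184082585466827888513677, 2900012076548610460589724,
  3658731930194828016067584, 3658738145664176123069312, 3217528366926272884278656,
  3655032592522198873530368, 3655287202227691508761088]), ([38770994531225383303,
  38104629809996060956, 5602325162974065503, 5602295317446220535], [1624811415928423534338816,
  1167693947609444443852032, 2660770934060196096164992, 3657079993553513610649472,
  3658736640996995875046400, 2164063010174758630614656, 3658732013383716986870016,
  3658733268348817105974272, 2219325479786706342314880, 1087861962064879647733921,
  3334204313446993711236098, 2701598682198492158415105, 3657155399250851396940672,
  3658736671464982875657600, 2164063010174758632940672, 3658731998149723486521216,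
  3659002093195054768592256, 2274593974138403528708352, 1087862691333040819869219,
  3334119022582938750562945, 2683261014865190296538242, 3657145921878814959945216,
  3658736656230989375481600, 3119269240045084098073633, 3659003773517703134684928,
  826362541695353806707600, 3658735569004878548530560, 3714032478598499250559488,
  3659002108430929116288384, 3350799438792813860634376, 2868730878770042453155077,
  3657155399252732083293696, 2095292499666528755919516, 1289822165967422752245120,
  3368659648959649824724611, 3195227597043784312888069, 2659465809699470679523592,
  3657145921880695646298240, 2659380518835451031190560, 3119182489538764470858147,
  3659003773516762710881664, 489416243937079503751952, 2659738095125510678429958,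
  3657155399251791659490432, 2659652804261456685305500, 797056466594406725392384,
  3369275723686953452288902, 2850372651120028574668931, 3657145921879755383748480,
  2089086826859582751214752, 3658736671461921620972928, 287359380486744420016640,
  404304488007759115086336, 3658736671463802468493056, 3769272498395377387223936]),
  ([38105691124624450307, 38104662829280112031, 2094817315073293594, 38549912789059734916,
  31156709926388132913, 20121395499522039302, 38090839786024482970, 20121393912643939160],
  [1206284503229186172737024, 1186175225134423062040576, 1187946967517274857466368,
  1205109796938846832850944, 1169353559009973777817088, 2357815421127644762309120,
  3123130887816653999868160, 3657336129417166017854720]), ([38063756382975701774,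
  38328831044445206404, 20516252526692586212, 20557873371226242196, 38548884494498467210,
  38106716244646441354, 38554123136380856480, 20561040467583357296, 25666434923230966999,
  20513167643008783075, 38107852818308704928], [133070750387306529187584,
  139382405951654765163648, 674505849052527680026752, 2166489061411759767782400,
  692928675741059885542272, 2586255443606868287822336, 2586767188791407022612992,
  2590298867904185592229376, 3658732627389584873404288, 3658732495700174392858240,
  2586511316199137655218048]), ([38105687950085173639, 25695798444883056954,
  38328812372785731583, 38057586615608095500, 20115676254480881788, 38548884494499738583,
  20559929960346258199, 38549905224160434154, 25744699564018898888, 22635141583666419347,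
  38328831044447731663], [3658737123494076879077888, 3658737123494076879077888,
  2182189890791830782207008, 2373112634358079697246620, 2375719597948763790031360,
  2166754410762031577880832, 2590384158768170895532544, 2222692754052985304279192,
  2627327645931602369855488, 3584513143377721722023192, 3658737123494076879077888,
  2624256780098968135009408, 2181519207149267997420032]), ([38105687950086439183,
  38076095917807491844, 38082265685175880968, 38104659655523866465, 25224236053162054732,
  20532394517191043209, 20558901665784978823, 25222179464040784855, 20529309633508097378,
  38067635075441265481, 38063750407125008246, 38067635075441271316, 38068663370000025430],
  [3655837629000173328531968, 2590298867904290077533824, 2203337372477682620283392]),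
  ([38105687950086433348, 19598561690876671710, 10984652288083858688, 19572283052176898910,
  5875394456023773215, 5901673094723546015, 11007046258431826688, 38106716244648960772],
  [1093525379550292196176256, 1421067166105751511677455, 634354775885423085255822,
  3811784264970661969180559, 3654213397072394616579584, 3272705535699149759166849,
  3709402511828407035169051, 1130292072618724298939524, 3217525838883352369930624,
  2277022365308111537042688, 1133402371308415766974976, 3655596365466210757949312,
  102489979630735385778048, 2832012314025018623237014, 3215399551793906731762690,
  3654005965796417060257152, 2162779991038788872303744, 1093796649428948080271258,
  2121076823869849739373056, 3088582111456295712256000, 3765493585364896738025092,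
  1226395945795798498807680, 1409296122957525002859776]), ([38105687950086433348,
  8341645804632105763, 26776998474794101180, 38104615690779134728, 1234118073718421886,
  8319251834284137763, 38076051953062720648, 26754560923631348262, 19598561690876675592],
  [924106140672859929283610, 2183055745885101868182682, 2121588569054458453021184,
  879840966474079637819029, 3765433787268998164560147, 598434495012352159135744,
  2833427424162880941587483, 3658908595770860830114688]), ([38104659655525165642,
  26751519620598147972, 26736095202245897030, 21449442890360272592, 19548285537238996956,
  39146424268886911784, 26778026769357888322, 21404654949557261237], [2273572823703600246391424,
  2274596314079817530929664, 2696498372320121494642432, 2584071845018890180599552,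
  2203337372477477889939968, 1380451188207981569286656, 3655345333004234035784192,
  3655345333004234035784192, 3655089460411964668388864, 3659170801452366502699008,
  1294739560090148957151232, 3658823304906562070154752, 2119598119175553277078784])],
    by decide +kernel⟩

theorem exists_checkReps7_44 : ∃ ds,
    checkReps true 7 reps8 (List.take 11 (List.drop 44 reps7)) ds = true :=
  ⟨
  [([38770994531225383303, 38082265685175937924, 39438357701489388106, 3577841681837442334],
  [2449910960402938803027201, 2832660502280506984330637, 2249287365087226197854981,
  2677720816828652474046882, 1258562552733722766671004, 2479227646657098726402947,
  2222607463189349949172994, 2720107601264909825563040, 3657868023828162001081728,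
  3655608226058784889181568, 2249287375761679230285960, 726323203560277562402704,
  2245577975869092452398854, 962949672756612591579392]), ([16641638560501684627,
  38548886081375311516, 38096403508646553916, 14072624086498350830, 38079182388366039772,
  31600241130956226629, 25668491510759433551, 14294735710918404612, 38105653392307769143,
  38095420882434354751, 31230698646149593684], [3658823436663679188228608,
  132179287063056078451200, 1376740484515883947578752, 1702266487250234975646464,
  2166489061403052645758208, 2584505006707113978093824]), ([38104659655457141356,
  38060636940695682637, 38104661242400750239, 20340946112304062435, 20531632866070157203,
  38327755496294398207, 20068900312021623218, 38504894751394660285, 38282784712217604349],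
  [3658908727392460348323584, 2164059748881442519192064, 146468021043046398382848,
  3672820479791521195191040, 3655031314393901596554240, 2199371250519243287889792,
  3655089460411964668388864, 3658908595770651859507712, 3677331685725369599169152,
  3691935245455975164834560, 2629241952122015186334720, 2185262791586279544337280]),
  ([38105687950086433348, 38104620336304720444, 38106717831523285660, 38079136721649559924,
  1640550604737080832, 1670144223891187032, 1646674705387790592, 1671170931575610432],
  [3658732499363191878457984, 3658738012850108905090176, 797324699256809894921472,
  599197580838291843416704, 3658823568150074562478976]), ([38770994531225383303,
  38079180801491714884, 39438357701489388106, 3571646884704755422, 3577807123241226334],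
  [3658738277285880287822336, 3658738277285880287822336, 3658738277285880287822336,
  3658735147614267740897792, 3657971581490110622196224, 959981369977894484245504,
  959981369977894484241920]), ([38104659655458401065, 25255308640095909133, 38326774455322670983,
  38553099602767449980, 38056885588310518002, 20510800331307902629, 38501811454549958700,
  38106716244613741327, 38056885588276558266], [3658908595768044235512320,
  2201420540403235533179648, 2590384158768379705893632, 3655345333004234035784192,
  3654831898431514223700864, 3658906511494738750146048, 3691679372863618002042368]),
  ([38105687950085175580, 38104659655492467556, 38069926150346029900, 1608537366164114925,
  21571914671227066732, 27447559162785595861, 1608537366128891589], [963214526453822895909120,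
  2772274651910685413631488, 3658736728610351283432576, 3656112950781058928075264]),
  ([38079180801491714884, 3568587030689237278, 3608560766037162094, 39437329406926860682,
  38069926150344768892, 38079180801362166076, 38107843296537456964, 5563805746812273863],
  [3655857078188789507015168, 3658823304906562231149056, 3658823304906562231149056,
  3658823304906562231149056, 3658908595770652181496320, 3655857078188789507015168,
  3658908595770652181496320, 3658823304906771363497600, 3658908595770756505807616,
  629082038233535730411776]), ([38104659657972786055, 38088164609229182676, 38106716244648960772,
  38079180806389475146, 38104659602192738924, 38087136380246002033, 38088164672355870190,
  38060629166074876116, 38060629173421516501], [958609312856167704549376,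
  1456106391938133878142499, 2678929597812494717422726, 2680958161532694076057987,
  1456021101073940570945059, 2678929729434198452194054, 2680958029910990287539331,
  3655341821108451922840064, 3658908591347360514466688]), ([38105687950086433348,
  38104603585964495563, 38106716773607068426, 38079181859407930183, 38063047193628765692,
  38082266214134045578, 38106716244648960772, 38100102824765889578], [3654774852566410081671680,
  1187910783436535663119240, 1190427712020529099499653, 2333831177355801486139553,
  3162089719818478267106304, 3658104150430751456785280]), ([38105687950086433348,
  25592397713223085261, 5605481992591165607, 5573033586522946727, 25570003742875117261,
  38106716244648960772, 11602481584416911134, 11573118062032915294, 11604538173541965982],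
  [1126808327061892319447586, 2618807641431426958111744, 2623168926827070193007501,
  784447302308771309438989, 3654212947612177725364736, 960183453366165371014784,
  3658360055007572322893952, 1290134904168612034700032, 3658104167790669195416064,
  1457849955519651358157312, 1128930476521617090211200, 2836114539888793527653378,
  2677809642281941378066307, 2698319598887213703254792, 232090885323021210969728,
  2273058636205108207079040, 2166919062216799433813153, 599725698697447298583680,
  2166922420285409676196771, 176822420626831371754880, 2661537493380547218660358,
  2678155870578477346908037, 2854622657441415521771905, 2618551768839122762278400])],
    by decide +kernel⟩

theorem exists_checkReps7_55 : ∃ ds,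
    checkReps true 7 reps8 (List.take 11 (List.drop 55 reps7)) ds = true :=
  ⟨
  [([38770994531225385244, 13149282046493502304, 38106716244648960772, 15144246138932560960,
  38771972927406424859, 38745515677193194204], [2597124500554425782395520,
  3443409586885555356262528, 3658733875271118155972096, 1126807564701940414658048]),
  ([38104659655527685063, 38095419264287152868, 38104659657972787996, 38095419264335441677,
  38104659609468512001, 38095419218280047754], [175217470529995407322496,
  669632018310546703977728, 3156712331552500281249153, 3156712331552500281249154,
  3657971579233910739853568]), ([38104662829273811527, 38104629857613074116,
  38104610815058633405], [3658736332621089107116544]), ([38104661242399488580,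
  14119749680471363211, 25151288912993615230, 14119744867060242075, 14563972870805481172,
  25592397674256984314, 14563977686665479196], [2616315248552325595620608,
  1669333245800258016504832, 3658738277489209011020288]), ([39588607906957317976,
  38104662829275071236, 38104659609539475628, 27150381054440097544, 15452414842675473654,
  13675521840804867329, 16856013815610542031, 1237335536792314398], [2952531867694676205149696,
  2952531867694676205149696, 674237622440523369515008, 2903404856465807874776576,
  2903404856465807874776576, 1632488260665634033751552, 3781822881256101940261760]),
  ([38104659609539475628, 39144384656489666398, 1681557152495254872, 38104634618236462852,
  5602326754747412303, 37290225294421286763, 14786169008055995985, 26332769965984033535,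
  1681521352369990800, 29889676958808400954, 14786080143297144657], [2786726413279178970563072,
  2786726413279178970563072, 674237622440523369515008, 1908830547901339427301376,
  1822598749257920438099840]), ([38770994531225383303, 38104639378859851588,
  38770996118100965959, 38104659660421670068, 3603295452597760006, 5602300094395474199],
  [173750938148679959469440, 3655665100628489507153664, 3769275237349575690468608]),
  ([8119590248957686444, 38105689537777049668, 38326772867633318260, 38095389466424662276,
  8100282789614257516, 8322367790685061468, 8091040811550263020, 25576173543319104556,
  31597124817645003700], [3118979516007360648217088, 1127028386762519388214656,
  1624434044171006226473088, 3658738277286088936440320, 3658736332214848957956608,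
  3658738145664280608621056, 1687757651904213996811136]), ([38326771280757735604,
  8341703462699685535, 38106716179342971514, 16173448075087228324, 38104661243215781962,
  38063736106311647438, 14120787493012262102], [3658823568285592001601152,
  1206898819158957565583488, 3654132308010735532168448, 3677246394861280132302464,
  2596708313539362515108992, 2592388472134623758738304, 1687757652039627272621056,
  133925044154650305243392, 3677155045674957067253888, 3695848521004982715446784,
  1878129620952223972490624, 2617272800101217086326272]), ([38106717832338317383,
  15454558709717537582, 29574183150174271348, 16836698314449389149, 37220409739579149059,
  9605596677205484075, 15407641185286343898, 28984976714065552951, 15079120811325243028],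
  [3583388810328409447373056, 1981111113079306417186816, 2949139186659265395763712,
  1779871404880918777520128, 3654831511126925622829568, 3654833719441503628812800,
  3655345464626042363603456, 3658908727392460187327360]), ([38106716245462734727,
  38104662829275071236, 16956252970062386108, 14741306485091738995, 29866497568562928011,
  37270916173647413126, 13186599692195215362], [3655345333004234035784192,
  1724773521303863684847616, 2872959133680595789492736])],
    by decide +kernel⟩

theorem exists_checkReps7_66 : ∃ ds,
    checkReps true 7 reps8 (List.take 11 (List.drop 66 reps7)) ds = true :=
  ⟨
  [([38105689536959498527, 38082283075429283917, 38085292162973991796, 38088386652524686612,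
  38104662829273811527], [3658738145664176123317760, 3658823436663679510467200,
  3658738277285879965833728, 3657389838652912923541760]), ([38066816229372009348,
  38060671456844750005, 38060673087800269267, 38063757970667581694, 38057556819329854334,
  38060671500108393229, 38105658109727193199], [2617272397655674721690496,
  3655089460411964668388864, 3655089460547378266351232, 2617016525085974233547904,
  2163090457396848628085888, 131212118485879718778624, 2617471409649330591293568,
  3657645711255992789878016]), ([38106716244646445236, 1591151508820435101, 38073011074841886508,
  38106691208175293596, 39438359289180004426, 38091520293682875580], [797142152617038837670144,
  3714091784972159007675008, 3767929408632465039563264]), ([38085350609304894340,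
  39438357702304425652, 11590098653098901445, 3603295498582192245, 5604381753729441307,
  38762785609165697863, 38085320811394014016], [3767692490739132177451008,
  594796995791237344492928, 631253765554934935545344, 962861910334502283439616,
  795476868428871205597056, 3657971579035740649144832, 3712421436880361833805952,
  962864381892418316922368, 962862700064795316398336]), ([17558535065629061015,
  5589157766423873687, 25560665685177178228, 5567592187569329493, 38754770814658658764,
  5570676541479992613, 39439357433059854310, 5583016032951656229], [797144320849383218097920,
  793919852218796209637888, 3710869773274610472742400, 631424127913503946994432,
  3769445555631018860943872, 631253502311318279906816, 960239318631004964195840,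
  960239362505010730340096, 3658738057916478047360768, 3658823392716638034420992]),
  ([39437330464844337631, 27575123864210542123, 39424190128588212586, 7602358085457269829,
  38106688740527978164, 9600334417115160316], [3714436312727182170503424,
  1294526111738060126555520, 1127071645678950734130432, 3657392317124895542256128]),
  ([29591037654163191826, 3594423438426429215, 13580192496750002711, 38761683790242714661,
  11581173080207629972, 19603085037215274502, 33569907022903875100, 33579420885629933167,
  38770952214511426006, 21595005327695701660, 17587113571004310778], [2247745007325290344583808,
  3766970981823146312453248, 1292994606889842738377728, 794811766588837343666176,
  3712497323178305492219648, 795549859055446092932864, 1292937704400473720538752,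
  795524889388981942065280, 3712500871615584987604096, 3658738101857981641832960,
  2083588524302122744971648, 961386054444921693269504, 626542778683381784199936,
  1123941327364406351143680, 1294531027024713316738688, 2454403807766016899955200,
  1957725538804373193136640, 2620972172645927992575872]), ([38104659655498336498,
  25592397713226918751, 38107843296517696855, 38328831044445206410, 25224236053162048900,
  22635141583612689751, 38107843296568895338, 38554127897275048282], [3658738014042472273100928,
  3658738014042472273100928, 2338702968028986998412672, 3658738014042472273187328,
  3162088539793585543723904, 2203770777535521471333632]), ([38104659655523905930],
  [2660767386556793259990656]), ([38328831044445206407, 22420311264864816436,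
  38095419293926181452, 20561040467583357268, 38087754902113976887, 38107852818308704906,
  31570084405400185111, 38312952997633830967, 25674195435565853980, 25603241524780352290,
  31720582109888945236, 31286031434702595034, 38321737050665859010, 38549912789059734919],
  [3658738014042472273100928, 3658738014042472281301760, 3658738014042472281301760,
  3658738014042472281301760, 3658738014042472273187328, 3658738014042472281051776,
  2167134020265036307922688, 3658738014042472281050624, 3658738014042472281050624,
  3123881184473369778987008]), ([38070840189965308810, 39438015470494023418,
  38550941083622274004, 15443581379687216383, 25223207758603306450, 9594984162694223119,
  34414074835018398820, 16625603228767837516, 25592397713223137674, 7686243591074365060,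
  11534911577593028671, 22599151274105226028], [3658736728606323905904768,
  3162086939606453656363264, 3162086939606453646419712, 3658738014042472273187328,
  1292823851942997639114880, 1722689163477424569410048, 3658738014042472281301760,
  1668572058416241681227904, 3658738014042472273187328, 1723897443406372876130816,
  3658736728606323913605632, 3658736728606323913605632, 2185348082450476282357376])],
    by decide +kernel⟩

theorem exists_checkReps7_77 : ∃ ds,
    checkReps true 7 reps8 (List.take 11 (List.drop 77 reps7)) ds = true :=
  ⟨
  -- One automorphism is enough here to discard every nonzero vector. The only certificate is for
  -- the zero vector, which the sieve always keeps.
  [([38104659655523905927], [2164065667919921127881600]), ([38104659655523905930],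
  [3658908595770860830363136]), ([38104659655523905927], [3658734357884044573340672]),
  ([38076095917807491847, 38549912789059734922, 20075114159146349815, 25740476892302503495,
  38327802749885200351, 25116484112166264298, 20523139866044575378, 38072310006732239980,
  38066841266662226119, 25222179464039515420], [3658738014042472273100928,
  3658908595770652173709056, 3658738014042472281051776, 3655601205596520086455040,
  3658738014042472281301760, 3658823304906771363497600, 3658738014042472281050624,
  3658903081091370274216576, 2203507954202839898632832]), ([38104659655523905930],
  [2289304644136913406989696]), ([38105687950086433354, 7601329790078751178,
  39442569637096890676, 17161383088377754300, 7604513431123722442, 39437329406926864570,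
  32117919404522677519, 32116891109960150092, 38078479774184881351], [1789009872356770631943168,
  3658738014042472273100928, 1128933885605823463899136, 3658738014042472273014528,
  1294739325396373533998080, 1955071184739624907734272]), ([38104640041700257519,
  13566580795074570508, 11888530491942839194, 38100102846893888647, 38068663370068049716,
  8129882193760357162, 16170367758558614596, 21123407741977426495, 21141540057783221890,
  38090606347378764103, 39056603352380696116, 21417267074059387402, 20325240817894848346,
  13138472387205891028, 8101052427264921388, 29001238068976605028, 19221193464573713572],
  [1668742771788695432734464, 2835787788860882667656192]), ([38104659655523905930],
  [1409786056649872744809728]), ([38104659655523905930], [3162086448256175030356352]),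
  ([38105687950901467015, 22641740456042873332, 38076080420205650695, 20523115934512589764,
  31230708124263787396, 38548886079742724767, 14078805026383245559, 31597129578268392439],
  [3658735542484556247319040, 2596793604471158942239744, 3676479828232740165124224,
  3131517536339883101186816, 2163352794078336393588736, 2593475937970801301379968]),
  ([38104639378859851591, 38096449146588637831, 33953506436525511847, 35595392384564969791,
  23899091681344113172, 33935454188512022692, 15411590622061932559, 38082254948740841290,
  13635698057433564007], [3658142292521141831230208, 1776569387085367670235136,
  2904064995203211129492864, 2126942940568831113837568, 1097547546947389573030784])],
    by decide +kernel⟩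

theorem exists_checkReps7_88 : ∃ ds,
    checkReps true 7 reps8 (List.take 11 (List.drop 88 reps7)) ds = true :=
  ⟨
  [([38091520377216696199, 38104639378859851588, 38095419264335494087, 14788151015921338858,
  16966487842974440818, 28594439569943145610, 38097479028841781572, 8112376650613564975,
  20744398334430337714], [1724602939575684106141696, 1170564121326414535588736]),
  ([38104661242399488583, 38104659611444168599, 38106716245462736671, 38066841266659706047],
  [3656113214160088745068544]), ([38104659655523905930], [3769445687388240464072960]),
  ([38105659386415387039, 9577927245738739276, 38069926191430183108, 29590352655211143964,
  7578921559900959322, 25592342871227460730, 13600400790420161884, 21584320149550443364,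
  11570762106291018703], [3711125558119077332292224, 3766138165457095736509184,
  1126299536070127883326848, 3214219845171103965688448, 3658738014042472281050624,
  3656110672729262961972224]), ([29571044136317231434, 38106716775239655172,
  13598344729274251276, 39424190657579018311, 7602358614415680274, 17597381221108812922,
  9600334946141290948, 17580155211209076724, 11580001963358182660], [1957697020633022878867584,
  1626086141052027327656448, 961329193869061506557184, 629718767651503498299648,
  3658738101790484135904896, 3714057344237201907950976, 1289820916034311929815424,
  1458935004360222555591680]), ([38771681120482956871, 33579792259118004916,
  39437643608929642783, 17597024726200892596, 33570194799132732922, 9600678219582351754,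
  38086835928027255967, 27591361842077063530, 17560046321968793860], [3658766488201691220717056,
  1622298829663639809868416, 1791947346399079982433920, 3448436893948868029199360]),
  ([38079180801491668312, 38327802749886458116, 25592397713223143503, 38108871591131347656,
  38548884494500986628, 22189885277467764410, 25222179464040751226, 20084368810282373764,
  38107843296568868757], [3658738014042467556643328, 3656624695973621503021568,
  3658738014042472764780032, 3658738014042473248758272, 2618807641431429161353216,
  2619063514023737492024320, 3656310677372379306381824, 3658738014042470459185664,
  3656566549964688710348288, 3217527601452436812619904, 2590298867904284603643392]),
  ([38105687950086435295, 20116817216350594588, 20531678532941579938, 38328831044445208351,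
  25273175192077271074, 38107843296568826728, 20084368810282323301], [2618551768839118081853952,
  2164063010174758629708288, 2164063010174749285741824, 3658738014042472603539200,
  2590213577040086780239232]), ([38104659655523859352, 38104659655523883962],
  [2916449550559023310029056]), ([38104659655523909818], [2903428226398276823257472]),
  ([38105687950901420440, 38104661242399500250, 38076111804992065156, 38095389466424622817,
  38096450733464232154, 38095419264335441677, 38095420851211088410], [3658738014042470459185664,
  3656367537948229872695296, 3658738014042472764780032, 3656626013742798494670080])],
    by decide +kernel⟩

theorem exists_checkReps7_99 : ∃ ds,
    checkReps true 7 reps8 (List.take 11 (List.drop 99 reps7)) ds = true :=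
  ⟨
  [([38104659655523907868], [3656370272749767601750400]), ([29571043607359497112,
  38770995589144061064, 17577043879513081999, 38770995060183468986, 38105688479862072122,
  27591402685350067514], [1791891580856034867069440, 1957697020646619714011648,
  1624497530180092138539264, 3657648233616664604824064]), ([38104659655523909812],
  [2786896995147116832841088]), ([31561990576639676824, 13598344200481291681,
  13589800999689104520, 21585122848266501850, 31561607143504480417, 23593736175653163418,
  38761754162859190015, 17596682488673051642], [1625348225919805716919808,
  2123559413941182512214656, 2288598376698718120483328, 1791947258800215991524992,
  3447700078937876969398528, 3767796690329349070364288, 2950282485764086199569664]),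
  ([38770995590774187295, 25592699980129923460, 39428403812717065378, 19595701354382865247,
  15597348361384779328, 21595019208973880659], [2289366967290136387567104,
  593935275805966652713472, 3658794962434136526961536, 2122764499589504396962944,
  1791918916260050749902720, 2621570307308212459635584]), ([22420312851717252033,
  35503446807473894815, 38751819474595318233, 38544876971017294858, 38313652787691751185,
  34169938361964555652, 38321732290271332288, 39574879190810261380], [173750830000238171865728,
  2394028324371513268602112, 2915739600007564259533568, 3676742886662964377077376,
  3131517540058375731920896, 2124269891733110058146048]), ([22400577247025193511,
  37272787187390906722, 38107843296531550444, 28639230786559156276, 34837225665104641924,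
  26092151198586580204, 28859619433085803903], [3162088539802676111540224,
  3676742886663591612876416, 3676072740397950450113664, 2902106544517336919192192,
  2749905744761997232135296, 3658738014042785898950144, 3196717700993469993967744,
  2744629990867472326709504]), ([28410457174782802594, 38107843296524423740,
  39418269141623710717, 28859619433080319882, 25148132733567270775, 20121392325756579079,
  38535066210030832180, 23522898153699380194], [3162088539793374056020992,
  2975683954713417926323584, 3658738014042671846083200, 3768537015709713728985984,
  2947214292807654923897856, 3811865301205290650353280]), ([38085350609304894340,
  21587404856659892673, 38091520377168409330, 21584319972647353305, 32785278160851519943,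
  27592430804334798297, 38772023355512807872], [3162088129681974400796288,
  2454792159037328507233408, 2785380716369757773479936, 2122669504977638434521088,
  3658738014037526643776000, 2785380716365511166754816, 2122669504977634087674880,
  2620920958868975653116416]), ([38104659655509674548, 27593459099753144359,
  32118942756190686868], [2122925377589310448093184]), ([25592397705604401439,
  38106716246281549474, 38770995060115468612, 33449556974752205602, 32116886165434242853,
  39438358760223156484, 29574183150156195394, 33451613565508533133], [3658738014042681244288128,
  2785380716369851776170112, 2122669504967995286966784, 2619575261951742402299904,
  2288730832004075969036416, 3658738014042677228046080, 2951186170778322781647104])],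
    by decide +kernel⟩

theorem exists_checkReps7_110 : ∃ ds,
    checkReps true 7 reps8 (List.take 11 (List.drop 110 reps7)) ds = true :=
  ⟨
  [([38104659655486903979, 19595357615287582084, 38105003478301437343, 38771666858949161433,
  38095420345077690823, 33579847094314600186, 27572893075442522266], [3714062215723695112646144,
  2787377023083604076609024]), ([35595392416098006058, 39428775098050126138,
  27591705136196244322, 25593083411594373028, 38104659655529389951], [2289307993199420567671424,
  2123502553387482077487872, 2123559413986110807866496, 3768565401295095820612864,
  3657971668678111900604416, 2620920988185322898088704, 2952531838583681636761728,
  3768537014884586972574976, 2289336379614729616000128, 2123502465617737864401408,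
  3658736831275530538577408, 2620917688164111169757696, 3658738014039411026365952,
  2455141819358021052806912, 2122764462769781506830592, 2288599325878527042678656]),
  ([38104646454427429252, 38095763109111321811, 23584812559491058444, 21595048830018264631,
  39428090095629132748, 31570902306856059871], [2787367458579976886923776,
  3658738101852330889341056]), ([38104659646239925690, 35578166545164028999,
  35595164964141896071, 35578509085263845554, 7573549334024542132, 20752146645066822418,
  11571558889991212684, 27592088198485671967], [1457976504755279334491904,
  2786726410688119511326848, 3658738014042472273187328, 2219451178514237212164608]),
  ([39437672701558750168, 38104659644135247674, 25593083411631292186, 31597383690877439770,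
  39437330469743355652, 25600384071877274959, 38771337300979379425, 39437672640021913722,
  25600155055022525731], [2953184779301644437135104, 3449208979176266647271936,
  3449208981363180752953856]), ([38104659646301978170, 33596388852376888759,
  31580156932892950132], [2952588698755370270168576]), ([38771681120481701047,
  25592397685233596740, 33596273535637065022, 25592397707204286223, 35595392417763238480,
  38762096927712929671, 35595164964109196044, 38770995061816027237],
  [3658766532140369526150656]), ([25205976599656697386, 31230741490194118492,
  31597110546634020850, 33450221122797020359, 32783579653476439900, 14746266342112238095,
  33596275121758091050, 8091810798338879023, 20104386707615333212], [1457873020285387221536896,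
  3284794698963941497094912, 2632052276605753852665984, 2202738863245881952915968,
  3088586168083085713957120, 2454239515127892660981760, 2582474058152894105768960]),
  ([38104659655457145244, 39961419335160741532, 32340043520438347039, 37141379336901005611,
  26758830426860520604, 38771321982145827082, 35005830891858843295, 20104377708488581186,
  33450240392436657847], [3714033638818926474898560, 2772965047593972591383808,
  3284794698963627879193088, 3118980060833785199091456, 3118978233589646862548736,
  2582474218679194734373760]), ([38104659589405507240, 33596260332162251938,
  37295592267734859271, 33450256764257262439, 31230739002163401250, 32340026615818825402,
  39438014937451873171], [3118978824097267834684800, 3769331057671742369017728,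
  3658736046778272118869504, 3088581426838528622653056, 3272679580996664446385024]),
  ([38299008386440570210, 20123230790912751124, 32339670008332539517, 32515537008234975298,
  20086225938123891880, 26555569701283740154, 8101738508821924282, 32089822596826465357],
  [107024282659314853887360, 3656753907191411589148800, 1166928699735548811798528,
  94956486974483180196480, 2677606902952278013094784, 2336135034098601076900992,
  3677217745271241304750592, 2701075644111447311454336, 2677668091709228882383872,
  2678484281483206602844928])],
    by decide +kernel⟩

/-! ### Assembly of the classification up to length 8. -/

theorem isEncodedList_reps0 : IsEncodedList 0 reps0 := by
  intro G hG
  rw [reps0, List.mem_singleton] at hG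
  subst hG
  exact ⟨0, Matrix.isSymm_zero, rfl⟩

theorem isEncodedList_reps1 : IsEncodedList 1 reps1 :=
  isEncodedList_reps0.map_extCode (by decide +kernel)

theorem isEncodedList_reps2 : IsEncodedList 2 reps2 :=
  isEncodedList_reps1.map_extCode (by decide +kernel)

theorem isEncodedList_reps3 : IsEncodedList 3 reps3 :=
  isEncodedList_reps2.map_extCode (by decide +kernel)

theorem isEncodedList_reps4 : IsEncodedList 4 reps4 :=
  isEncodedList_reps3.map_extCode (by decide +kernel)

theorem isEncodedList_reps5 : IsEncodedList 5 reps5 :=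
  isEncodedList_reps4.map_extCode (by decide +kernel)

theorem isEncodedList_reps6 : IsEncodedList 6 reps6 :=
  isEncodedList_reps5.map_extCode (by decide +kernel)

theorem isEncodedList_reps7 : IsEncodedList 7 reps7 :=
  isEncodedList_reps6.map_extCode (by decide +kernel)

theorem isEncodedList_reps8 : IsEncodedList 8 reps8 :=
  isEncodedList_reps7.map_extCode (by decide +kernel)

/-- The induction starts from the empty graph, so that no length needs a separate classification. -/
theorem covers_reps0 : Covers false 0 reps0 := fun Γ hΓ _ =>
  Or.inr ⟨Γ, hΓ, List.mem_singleton.2 rfl, CodeEq.refl _⟩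

theorem covers_reps1 : Covers false 1 reps1 :=
  covers_succ (by norm_num) isEncodedList_reps1 covers_reps0 (.of_checkReps exists_checkReps0)

theorem covers_reps2 : Covers false 2 reps2 :=
  covers_succ (by norm_num) isEncodedList_reps2 covers_reps1 (.of_checkReps exists_checkReps1)

theorem covers_reps3 : Covers false 3 reps3 :=
  covers_succ (by norm_num) isEncodedList_reps3 covers_reps2 (.of_checkReps exists_checkReps2)

theorem covers_reps4 : Covers false 4 reps4 :=
  covers_succ (by norm_num) isEncodedList_reps4 covers_reps3 (.of_checkReps exists_checkReps3)

theorem covers_reps5 : Covers false 5 reps5 :=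
  covers_succ (by norm_num) isEncodedList_reps5 covers_reps4 (.of_checkReps exists_checkReps4)

theorem covers_reps6 : Covers false 6 reps6 :=
  covers_succ (by norm_num) isEncodedList_reps6 covers_reps5 (.of_checkReps exists_checkReps5)

theorem covers_reps7 : Covers false 7 reps7 :=
  covers_succ (by norm_num) isEncodedList_reps7 covers_reps6 (.of_checkReps exists_checkReps6)

theorem drop_reps7 : List.drop 121 reps7 = [] := by decide +kernel

/-- The 121 representatives of length 7 are the union of eleven blocks of eleven. -/
theorem certified_reps7 : Certified true 7 reps8 reps7 := by
  have h : Certified true 7 reps8 (List.drop 121 reps7) := by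
    rw [drop_reps7]
    exact fun G hG => absurd hG List.not_mem_nil
  exact .drop (i := 0) exists_checkReps7_0 <| .drop exists_checkReps7_11 <|
    .drop exists_checkReps7_22 <| .drop exists_checkReps7_33 <| .drop exists_checkReps7_44 <|
    .drop exists_checkReps7_55 <| .drop exists_checkReps7_66 <| .drop exists_checkReps7_77 <|
    .drop exists_checkReps7_88 <| .drop exists_checkReps7_99 <| .drop exists_checkReps7_110 h

/-- The upper bound: a code of length 8 without nontrivial automorphisms is equivalent to one of the
35 listed codes. -/
theorem covers_reps8 : Covers true 8 reps8 :=
  covers_succ le_rfl isEncodedList_reps8 covers_reps7 certified_reps7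

/-! ### The three claims: short lengths, the 35 classes, and their minimum distances. -/

theorem hasNontrivialAut_of_le_seven {n : ℕ} (h0 : 1 ≤ n) (hn : n ≤ 7) {C : AdditiveCode n}
    (hC : IsSelfDual C) : HasNontrivialAut C := by
  -- At each length the automorphisms come from the certificates used to pass to the next length.
  interval_cases n
  · exact hasNontrivialAut_of_covers (by norm_num) (by norm_num) covers_reps1
      (.of_checkReps exists_checkReps1) hC
  · exact hasNontrivialAut_of_covers (by norm_num) (by norm_num) covers_reps2
      (.of_checkReps exists_checkReps2) hC
  · exact hasNontrivialAut_of_covers (by norm_num) (by norm_num) covers_reps3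
      (.of_checkReps exists_checkReps3) hC
  · exact hasNontrivialAut_of_covers (by norm_num) (by norm_num) covers_reps4
      (.of_checkReps exists_checkReps4) hC
  · exact hasNontrivialAut_of_covers (by norm_num) (by norm_num) covers_reps5
      (.of_checkReps exists_checkReps5) hC
  · exact hasNontrivialAut_of_covers (by norm_num) (by norm_num) covers_reps6
      (.of_checkReps exists_checkReps6) hC
  · exact hasNontrivialAut_of_covers (by norm_num) (by norm_num) covers_reps7 certified_reps7 hC

/-- The evaluation behind the lower bound: it yields both the triviality of the 35 groups, up to the
signs at the vertices, and the pairwise inequivalence of the codes. -/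
theorem allRigid_reps8 : withTables 8 reps8 (allRigid 8) = true := by decide +kernel

theorem length_reps8 : reps8.length = 35 := by decide +kernel

/-- Connectedness of the 35 graphs, in the form required by `hasTrivialAut_of_rigid`: every vertex
but the last has a later neighbour. -/
theorem neighbor_reps8 : ∀ k : Fin 35, ∀ j : Fin 8, j ≠ Fin.last 7 →
    ∃ i : Fin 8, j < i ∧ nth 0 (nth [] reps8 k) j / 4096 ^ (i : ℕ) % 4096 ≠ 0 := by
  decide +kernel

/-- The minimum distances of the codes in the list `reps8`. -/
def dist8 (k : Fin 35) : ℕ := if k = 28 ∨ k = 29 ∨ k = 30 then 4 else 3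

/-- The zero word is the only one of weight below the claimed distance, and it is no longer the only
one when the bound is raised by 1. -/
theorem countw_reps8 : ∀ k : Fin 35,
    Nat.beq (countw 8 (dist8 k) (nth [] reps8 k)) 1 = true ∧
      Nat.beq (countw 8 (dist8 k + 1) (nth [] reps8 k)) 1 = false := by
  decide +kernel

theorem nth_eq_getElem {α : Type} (d : α) (l : List α) (k : ℕ) (h : k < l.length) :
    nth d l k = l[k] := by
  induction l generalizing k with
  | nil => cases h
  | cons x l ih =>
    cases k with
    | zero => rfl
    | succ k => exact ih k (Nat.lt_of_succ_lt_succ h)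

theorem enc_injective {n : ℕ} : Function.Injective (enc (n := n)) := fun Γ Γ' h => by
  ext i j
  apply ZMod.val_injective 3
  rw [← nth_enc_digit, h, nth_enc_digit]

theorem exists_enc_eq_reps8 (k : Fin 35) :
    ∃ Γ : Matrix (Fin 8) (Fin 8) (ZMod 3), Γ.IsSymm ∧ enc Γ = nth [] reps8 k :=
  isEncodedList_reps8 _ (nth_mem [] (by rw [length_reps8]; exact k.isLt))

/-- The matrix of a code in the list `reps8`. -/
def matrix8 (k : Fin 35) : Matrix (Fin 8) (Fin 8) (ZMod 3) := (exists_enc_eq_reps8 k).choose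

theorem matrix8_isSymm (k : Fin 35) : (matrix8 k).IsSymm := (exists_enc_eq_reps8 k).choose_spec.1

theorem enc_matrix8 (k : Fin 35) : enc (matrix8 k) = nth [] reps8 k :=
  (exists_enc_eq_reps8 k).choose_spec.2

theorem hasTrivialAut_matrix8 (k : Fin 35) : HasTrivialAut (graphCode (matrix8 k)) := by
  have h := allRigid_reps8
  rw [withTables_eq] at h
  refine hasTrivialAut_of_rigid le_rfl (matrix8_isSymm k) ?_ fun j hj => ?_
  · refine (of_allRigid h).1 _ (List.mem_map_of_mem ?_)
    rw [enc_matrix8]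
    exact nth_mem [] (by rw [length_reps8]; exact k.isLt)
  · obtain ⟨i, hi, h'⟩ := neighbor_reps8 k j hj
    rw [← enc_matrix8, nth_enc_digit] at h'
    exact ⟨i, hi, fun h0 => h' (by rw [h0]; rfl)⟩

/-- Tables are compared only for pairs in list order; the other order follows from symmetry of
equivalence. -/
theorem not_codeEq_matrix8 {k l : Fin 35} (hkl : k < l) :
    ¬ CodeEq (graphCode (matrix8 k)) (graphCode (matrix8 l)) := by
  have h := allRigid_reps8
  rw [withTables_eq] at h
  have h' := List.pairwise_iff_getElem.1 (List.pairwise_map.1 (of_allRigid h).2) k l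
    (by rw [length_reps8]; exact k.isLt) (by rw [length_reps8]; exact l.isLt) hkl
  refine not_codeEq_of_distinct le_rfl (matrix8_isSymm k) (matrix8_isSymm l) ?_
  rw [enc_matrix8, enc_matrix8, nth_eq_getElem, nth_eq_getElem]
  exact h'

theorem minDist_matrix8 (k : Fin 35) : minDist (graphCode (matrix8 k)) = dist8 k := by
  have h := countw_reps8 k
  rw [← enc_matrix8] at h
  exact minDist_graphCode le_rfl (matrix8_isSymm k) (Nat.eq_of_beq_eq_true h.1)
    (Nat.ne_of_beq_eq_false h.2)

/-- The coverage of length 8 offers two alternatives, and trivial automorphism group, which is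
invariant under equivalence, rules out the first. -/
theorem exists_codeEq_matrix8 {C : AdditiveCode 8} (hC : IsSelfDual C) (h : HasTrivialAut C) :
    ∃ k, CodeEq C (graphCode (matrix8 k)) := by
  obtain ⟨Γ, h1, h2, h3⟩ := codeEq_graphCode hC
  rcases covers_reps8 Γ h1 h2 with ⟨-, h4⟩ | ⟨Γ', -, h5, h6⟩
  · exact absurd (h4.of_codeEq h3) ((hasTrivialAut_iff C).1 h)
  · obtain ⟨k, hk, hk'⟩ := List.getElem_of_mem h5
    refine ⟨⟨k, length_reps8 ▸ hk⟩, ?_⟩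
    -- A matrix is determined by its packed rows, so the matrix found by the classification is the
    -- chosen one.
    have : Γ' = matrix8 ⟨k, length_reps8 ▸ hk⟩ :=
      enc_injective (by rw [enc_matrix8, ← hk', nth_eq_getElem])
    exact this ▸ h3.trans h6

/-- The equivalence class of a code in the list `reps8`. -/
def class8 (k : Fin 35) : Quotient (codeEquiv 8) :=
  Quotient.mk _ ⟨graphCode (matrix8 k), isSelfDual_graphCode (matrix8_isSymm k)⟩

theorem mk_eq_class8_iff (C : SelfDualCode 8) (k : Fin 35) :
    Quotient.mk (codeEquiv 8) C = class8 k ↔ CodeEq C.1 (graphCode (matrix8 k)) := Quotient.eq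

theorem class8_injective : Function.Injective class8 := fun k l h => by
  have h' := (mk_eq_class8_iff _ l).1 h
  rcases lt_trichotomy k l with hkl | hkl | hkl
  · exact absurd h' (not_codeEq_matrix8 hkl)
  · exact hkl
  · exact absurd h'.symm (not_codeEq_matrix8 hkl)

theorem trivialAutClasses_eight : trivialAutClasses 8 = class8 '' Set.univ := by
  ext q
  constructor
  · rintro ⟨C, rfl, hC⟩
    obtain ⟨k, hk⟩ := exists_codeEq_matrix8 C.2 hC
    exact ⟨k, Set.mem_univ k, ((mk_eq_class8_iff C k).2 hk).symm⟩
  · rintro ⟨k, -, rfl⟩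
    exact ⟨_, rfl, hasTrivialAut_matrix8 k⟩

/-- Minimum distance is constant on equivalence classes, so the classes with distance `d` are those
of the listed codes with distance `d`, and injectivity of `class8` reduces the count to one over
`Fin 35`. -/
theorem trivialAutClassesOfDist_eight (d : ℕ) :
    trivialAutClassesOfDist 8 d = class8 '' (Finset.univ.filter fun k => dist8 k = d) := by
  ext q
  constructor
  · rintro ⟨C, rfl, hC, hd⟩
    obtain ⟨k, hk⟩ := exists_codeEq_matrix8 C.2 hC
    refine ⟨k, ?_, ((mk_eq_class8_iff C k).2 hk).symm⟩
    simp [← minDist_matrix8, ← hk.minDist_eq, hd]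
  · rintro ⟨k, hk, rfl⟩
    exact ⟨_, rfl, hasTrivialAut_matrix8 k, (minDist_matrix8 k).trans (by simpa using hk)⟩

theorem ncard_trivialAutClassesOfDist_eight (d : ℕ) :
    (trivialAutClassesOfDist 8 d).ncard = (Finset.univ.filter fun k => dist8 k = d).card := by
  rw [trivialAutClassesOfDist_eight, Set.ncard_image_of_injective _ class8_injective,
    Set.ncard_coe_finset]

end AdditiveGF9

end

theorem mainTheorem4 :
    (∀ n : ℕ, 1 ≤ n → n ≤ 7 → ∀ C : AdditiveGF9.AdditiveCode n, AdditiveGF9.IsSelfDual C →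
      AdditiveGF9.trivialGroup n ⊂ (AdditiveGF9.autGroup C : Set (AdditiveGF9.LinAut n))) ∧
    (AdditiveGF9.trivialAutClasses 8).ncard = 35 ∧
    (AdditiveGF9.trivialAutClassesOfDist 8 3).ncard = 32 ∧
    (AdditiveGF9.trivialAutClassesOfDist 8 4).ncard = 3 := by
  refine ⟨fun n h0 hn C hC => (AdditiveGF9.hasNontrivialAut_of_le_seven h0 hn hC).ssubset,
    ?_, ?_, ?_⟩
  · rw [AdditiveGF9.trivialAutClasses_eight,
      Set.ncard_image_of_injective _ AdditiveGF9.class8_injective, Set.ncard_univ, Nat.card_fin]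
  -- Three indices are assigned distance 4 by `dist8`, and the remaining 32 distance 3.
  · rw [AdditiveGF9.ncard_trivialAutClassesOfDist_eight]
    decide
  · rw [AdditiveGF9.ncard_trivialAutClassesOfDist_eight]
    decide
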